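/- Let $d\in\{1,2,3\}$ and $\omega\in\mathbb R$, and let $U(x)=\tfrac12\omega^2|x|^2$ on $\mathbb R^d$. For $0<\varepsilon<1$ and $\theta\in\mathbb R$ consider the two subflows $$\mathcal E_A(t)u=e^{\,i t\frac{\varepsilon}{2}\Delta}u,\qquad \mathcal E_B(t,u)=e^{-i\frac{t}{\varepsilon}(U+\theta|u|^2)}u$$ on $L^2=L^2(\mathbb R^d;\mathbb C)$ of the cubic Schrödinger equation $i\,\partial_t\psi=-\tfrac{\varepsilon}{2}\Delta\psi+\tfrac1\varepsilon\,(U+\theta|\psi|^2)\,\psi$, where $\mathcal E_A(t)$ is the unitary group generated by $i\frac{\varepsilon}{2}\Delta$. Put $$w=\mathcal E_B\big(t,\mathcal E_A(\tfrac t2)u\big),\qquad \mathcal S(t,u)=\mathcal E_A(\tfrac t2)\,w\quad\text{(a Strang splitting step)},$$ and let $\|u\|_{H^m}=\big(\sum_{k=0}^m\|\nabla^k u\|_{L^2}^2\big)^{1/2}$, where $\|\nabla^k u\|_{L^2}^2=\sum_{j_1,\dots,j_k=1}^d\|\partial_{j_1}\cdots\partial_{j_k}u\|_{L^2}^2$.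 (i) For all $t\ge 0$ and $u\in L^2$, both flows conserve the $L^2$ norm, and $$\|\mathcal S(t,u)\|_{L^2}=\|w\|_{L^2}=\|u\|_{L^2}.$$ For every integer $m\ge0$: if $u\in H^m$, then $\mathcal E_A(t)u\in H^m$ and $\|\mathcal E_A(t)u\|_{H^m}=\|u\|_{H^m}$. Moreover $\mathcal S(t,u)\in H^m$ if and only if $w\in H^m$, and in that case $\|\mathcal S(t,u)\|_{H^m}=\|w\|_{H^m}$. (ii) There is a constant $C>0$, depending only on $d$ and $\omega$, such that the following holds for all $0<\varepsilon<1$, $\theta\in\mathbb R$, $t\ge0$ and $u\in H^2(\mathbb R^d)$. If $(\nabla U)u\in L^2$, then $w,\mathcal S(t,u)\in H^1$ and $$\|\mathcal S(t,u)\|_{H^1}=\|w\|_{H^1}\le\|u\|_{H^1}+C\Big(\tfrac t\varepsilon\big(\|(\nabla U)u\|_{L^2}+|\theta|\,\|u\|_{H^2}\|u\|_{H^1}^2\big)+t^2\|u\|_{H^1}\Big).$$ If $Uu\in L^2$, then $w,\mathcal S(t,u)\in H^2$ and $$\begin{aligned}\|\mathcal S(t,u)\|_{H^2}=\|w\|_{H^2}\le\|u\|_{H^2}+C\Big(&\tfrac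 t\varepsilon\big(\|Uu\|_{L^2}+\|u\|_{H^2}+|\theta|\,\|u\|_{H^2}^3\big)+t^2\|u\|_{H^2}\\&+\tfrac{t^2}{\varepsilon^2}\big(\|Uu\|_{L^2}+|\theta|\,\|Uu\|_{L^2}\|u\|_{H^2}^2+|\theta|\,\|u\|_{H^2}^3+|\theta|^2\|u\|_{H^2}^5\big)\\&+\tfrac{t^3}{\varepsilon}\big(\|Uu\|_{L^2}+\|u\|_{H^2}+|\theta|\,\|u\|_{H^2}^3\big)+t^4\|u\|_{H^2}\Big).\end{aligned}$$ -/

import Mathlib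

open MeasureTheory Set
open scoped FourierTransform LineDeriv SchwartzMap

noncomputable section

namespace CubicNLS

/-- The space `ℝ^d` with its Euclidean norm. -/
abbrev Space (d : ℕ) : Type := EuclideanSpace ℝ (Fin d)

/-- The Hilbert space `L²(ℝ^d; ℂ)`. -/
abbrev L2 (d : ℕ) : Type := Lp ℂ 2 (volume : Measure (Space d))

/-- Multiplying a square integrable function by a measurable function with values in the unit
circle, written `exp (i φ)` with a real phase `φ`, gives a square integrable function. -/
theorem memLp_phase_mul {d : ℕ} {φ : Space d → ℝ} (hφ : AEStronglyMeasurable φ volume)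
    (u : L2 d) :
    MemLp (fun x => Complex.exp ((φ x : ℂ) * Complex.I) * u x) 2 volume := by
  have hc : Continuous fun r : ℝ => Complex.exp ((r : ℂ) * Complex.I) := by fun_prop
  refine (Lp.memLp u).of_le
    ((hc.comp_aestronglyMeasurable hφ).mul (Lp.aestronglyMeasurable u)) ?_
  refine Filter.Eventually.of_forall fun x => ?_
  simp [Complex.norm_exp_ofReal_mul_I]

/-- The harmonic potential `U(x) = (1/2) ω² |x|²`. -/
def potential (d : ℕ) (ω : ℝ) (x : Space d) : ℝ := 1 / 2 * ω ^ 2 * ‖x‖ ^ 2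

/-- The symbol phase of `exp (i t (ε/2) Δ)`. The Fourier transform is
`∫ exp (-2πi⟨x, ξ⟩) u(x) dx`, so that `Δ` acts as multiplication by `-(2π|ξ|)²`. -/
def freePhase (d : ℕ) (ε t : ℝ) (ξ : Space d) : ℝ :=
  -(t * (ε / 2) * (2 * Real.pi * ‖ξ‖) ^ 2)

theorem aestronglyMeasurable_freePhase (d : ℕ) (ε t : ℝ) :
    AEStronglyMeasurable (freePhase d ε t) volume := by
  have h : Continuous (freePhase d ε t) := by unfold freePhase; fun_prop
  exact h.aestronglyMeasurable

/-- The free flow `E_A(t) u = exp (i t (ε/2) Δ) u` on `L²(ℝ^d)`, the unitary group generated by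
`A = i (ε/2) Δ`, as a Fourier multiplier. -/
def flowA {d : ℕ} (ε t : ℝ) (u : L2 d) : L2 d :=
  𝓕⁻ (memLp_phase_mul (aestronglyMeasurable_freePhase d ε t) (𝓕 u)).toLp

/-- The phase `-(t/ε) (U(x) + θ |u(x)|²)`. -/
def nonlinearPhase {d : ℕ} (ω θ ε t : ℝ) (u : L2 d) (x : Space d) : ℝ :=
  -(t / ε * (potential d ω x + θ * ‖u x‖ ^ 2))

theorem aestronglyMeasurable_nonlinearPhase {d : ℕ} (ω θ ε t : ℝ) (u : L2 d) :
    AEStronglyMeasurable (nonlinearPhase ω θ ε t u) volume := by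
  have h : Continuous (potential d ω) := by unfold potential; fun_prop
  have hu : AEStronglyMeasurable (fun x => ‖u x‖ ^ 2) volume :=
    (Lp.aestronglyMeasurable u).norm.pow 2
  exact ((h.aestronglyMeasurable.add (hu.const_mul θ)).const_mul (t / ε)).neg

/-- The nonlinear flow `E_B(t, u) = exp (-i (t/ε) (U + θ |u|²)) u`. -/
def flowB {d : ℕ} (ω θ ε t : ℝ) (u : L2 d) : L2 d :=
  (memLp_phase_mul (aestronglyMeasurable_nonlinearPhase ω θ ε t u) u).toLp

/-- The intermediate composition `E_B(t, E_A(t/2) u)`. -/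
def halfStep {d : ℕ} (ω θ ε t : ℝ) (u : L2 d) : L2 d :=
  flowB ω θ ε t (flowA ε (t / 2) u)

/-- The Strang splitting step `S(t, u) = E_A(t/2) E_B(t, E_A(t/2) u)`. -/
def strangStep {d : ℕ} (ω θ ε t : ℝ) (u : L2 d) : L2 d :=
  flowA ε (t / 2) (halfStep ω θ ε t u)

/-- `u ∈ H^m(ℝ^d)`. -/
def MemH {d : ℕ} (m : ℕ) (u : L2 d) : Prop :=
  TemperedDistribution.MemSobolev (m : ℝ) 2 (u : 𝓢'(Space d, ℂ))

open Classical in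
/-- The `L²` function that represents the tempered distribution `T`; it is unique if it exists, and
the value is `0` if there is none. -/
def toL2 {d : ℕ} (T : 𝓢'(Space d, ℂ)) : L2 d :=
  if h : ∃ g : L2 d, (g : 𝓢'(Space d, ℂ)) = T then h.choose else 0

/-- The weak derivative `∂_{j₁} ⋯ ∂_{jₖ} u` of `u ∈ L²` (for `u ∈ H^m` and `k ≤ m`). -/
def weakDeriv {d k : ℕ} (j : Fin k → Fin d) (u : L2 d) : L2 d :=
  toL2 (∂^{fun i => (EuclideanSpace.single (j i) (1 : ℝ) : Space d)} (u : 𝓢'(Space d, ℂ)))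

/-- The norm `‖u‖_{H^m} = (∑_{k ≤ m} ‖∇ᵏ u‖²_{L²})^{1/2}` of `u ∈ H^m`, with
`‖∇ᵏ u‖²_{L²} = ∑_{j₁, …, jₖ} ‖∂_{j₁} ⋯ ∂_{jₖ} u‖²_{L²}`. -/
def normH {d : ℕ} (m : ℕ) (u : L2 d) : ℝ :=
  Real.sqrt (∑ k ∈ Finset.range (m + 1), ∑ j : Fin k → Fin d, ‖weakDeriv j u‖ ^ 2)

/-- The product `U u`. -/
def potMul {d : ℕ} (ω : ℝ) (u : L2 d) (x : Space d) : ℂ := (potential d ω x : ℂ) * u x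

/-- The vector field `(∇U) u`, with values in `ℂ^d`. -/
def gradPotMul {d : ℕ} (ω : ℝ) (u : L2 d) (x : Space d) : EuclideanSpace ℂ (Fin d) :=
  WithLp.toLp 2 fun j => (gradient (potential d ω) x j : ℂ) * u x

/-- The `L²` norm of a function (meaningful for functions in `L²`). -/
def normL2 {d : ℕ} {F : Type*} [NormedAddCommGroup F] (f : Space d → F) : ℝ :=
  (eLpNorm f 2 volume).toReal

end CubicNLS

end

open CubicNLS

noncomputable section

namespace CubicNLS

open Filter Topology
open scoped ENNReal ComplexConjugate

variable {d : ℕ}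

/-! ### Phases of temperate growth -/

/-! The free flow is a Fourier multiplier of modulus one. It commutes with all derivatives and is
inverted by reversing time, so it preserves every $H^m$ and its norm. The nonlinear flow only
changes the phase pointwise. Part (i) follows, and part (ii) reduces to bounding the derivatives of
$e^{-i\tau(U+\theta|v|^2)}v$, where $\tau=t/\varepsilon$ and $v=\mathcal E_A(t/2)u$ has the Sobolev
norms of $u$.

Up to the unimodular phase, a derivative of this function is the same derivative of $v$ plus error
terms of two kinds. The cubic terms are bounded by Agmon's inequality $\|v\|_\infty\le
K\|v\|_{H^1}^{1/2}\|v\|_{H^2}^{1/2}$ and by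
$\|\partial_jv\|_{L^4}^2\le3\|v\|_\infty\|\partial_j^2v\|_{L^2}$, applied to products of two first
derivatives (`exists_agmon`). The potential terms carry weights $\partial_jU=\omega^2x_j$. These are
moved through the free flow by
$x_je^{is\varepsilon\Delta/2}=e^{is\varepsilon\Delta/2}(x_j-is\varepsilon\partial_j)$
(`coord_mul_flowA`), and $x_j\partial_ku$ is controlled by $x_j^2u$ and $\partial_k^2u$ through
integration by parts (`exists_coord_mul_partialDeriv`). With $s=t/2$ each commutator brings a factor
$t\varepsilon/2$ against $\tau=t/\varepsilon$; hence the terms $t^2$, $t^3/\varepsilon$ and $t^4$.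

The calculus is justified separately for the two phase factors. For $e^{i\beta|v|^2}v$ the chain
rule passes to the limit from Schwartz functions that converge in $H^2$ and uniformly, with
gradients converging in $L^4$ (`exists_cubicPhase_chain_rule`). The factor $e^{-i\tau U}$ is smooth
of temperate growth, so the product rule holds for distributions (`HasWeakDeriv.mul`).

Every component satisfies $\|\partial^jw\|\le\|\partial^jv\|+B$ with a common $B$, and Minkowski's
inequality in $\ell^2$ keeps the coefficient of $\|u\|_{H^m}$ equal to one (`normH_le_add`). -/

theorem iteratedDeriv_exp_ofReal_mul_I (n : ℕ) :
    iteratedDeriv n (fun r : ℝ => Complex.exp ((r : ℂ) * Complex.I)) =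
      fun r : ℝ => Complex.I ^ n * Complex.exp ((r : ℂ) * Complex.I) := by
  induction n with
  | zero => simp
  | succ n ih =>
    rw [iteratedDeriv_succ, ih]
    ext r
    have h : HasDerivAt (fun r : ℝ => Complex.exp ((r : ℂ) * Complex.I))
        (Complex.exp ((r : ℂ) * Complex.I) * (1 * Complex.I)) r :=
      ((Complex.ofRealCLM.hasDerivAt (x := r)).mul_const Complex.I).cexp
    rw [(h.const_mul (Complex.I ^ n)).deriv]
    ring

/-- All derivatives have modulus one, so exponent 0 and constant 1 serve for each order. This makes
both unimodular phases admissible multipliers of tempered distributions. -/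
theorem hasTemperateGrowth_exp_ofReal_mul_I :
    (fun r : ℝ => Complex.exp ((r : ℂ) * Complex.I)).HasTemperateGrowth := by
  refine ⟨(Complex.ofRealCLM.contDiff.mul contDiff_const).cexp, fun n => ⟨0, 1, fun r => ?_⟩⟩
  rw [norm_iteratedFDeriv_eq_norm_iteratedDeriv, iteratedDeriv_exp_ofReal_mul_I]
  simp [Complex.norm_exp_ofReal_mul_I]

theorem hasTemperateGrowth_phase {φ : Space d → ℝ} (hφ : φ.HasTemperateGrowth) :
    (fun x => Complex.exp ((φ x : ℂ) * Complex.I)).HasTemperateGrowth :=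
  hasTemperateGrowth_exp_ofReal_mul_I.comp hφ

theorem hasTemperateGrowth_freePhase (ε t : ℝ) : (freePhase d ε t).HasTemperateGrowth := by
  have h : freePhase d ε t = fun ξ => (-(t * (ε / 2) * (2 * Real.pi) ^ 2)) * ‖ξ‖ ^ 2 := by
    ext ξ; simp only [freePhase]; ring
  rw [h]; fun_prop

theorem hasTemperateGrowth_potential (ω : ℝ) : (potential d ω).HasTemperateGrowth := by
  have h : potential d ω = fun ξ => (1 / 2 * ω ^ 2) * ‖ξ‖ ^ 2 := rfl
  rw [h]; fun_prop

/-! ### Square integrable functions as tempered distributions -/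

/-- This allows identities in $L^2$ to be checked among distributions, where multipliers and
derivatives act without domain conditions. -/
theorem toDistribution_injective {f g : L2 d} (h : (f : 𝓢'(Space d, ℂ)) = g) : f = g := by
  have := LinearMap.ker_eq_bot.1
    (Lp.ker_toTemperedDistributionCLM_eq_bot (F := ℂ) (μ := (volume : Measure (Space d))) (p := 2))
  exact this h

theorem toDistribution_add (f g : L2 d) :
    ((f + g : L2 d) : 𝓢'(Space d, ℂ)) = (f : 𝓢'(Space d, ℂ)) + g :=
  (Lp.toTemperedDistributionCLM ℂ (volume : Measure (Space d)) 2).map_add f g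

theorem toDistribution_smul (c : ℂ) (f : L2 d) :
    ((c • f : L2 d) : 𝓢'(Space d, ℂ)) = c • (f : 𝓢'(Space d, ℂ)) :=
  (Lp.toTemperedDistributionCLM ℂ (volume : Measure (Space d)) 2).map_smul c f

theorem continuous_toDistribution : Continuous fun f : L2 d => (f : 𝓢'(Space d, ℂ)) :=
  (Lp.toTemperedDistributionCLM ℂ (volume : Measure (Space d)) 2).continuous

theorem toDistribution_eq_smulLeftCLM {a : Space d → ℂ} (ha : a.HasTemperateGrowth) {F f : L2 d}
    (h : F =ᵐ[volume] fun x => a x * f x) :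
    (F : 𝓢'(Space d, ℂ)) = TemperedDistribution.smulLeftCLM ℂ a f := by
  ext ψ
  simp only [Lp.toTemperedDistribution_apply, TemperedDistribution.smulLeftCLM_apply_apply]
  refine integral_congr_ae ?_
  filter_upwards [h] with x hx
  simp only [hx, SchwartzMap.smulLeftCLM_apply_apply ha, smul_eq_mul]
  ring

theorem toL2_eq {T : 𝓢'(Space d, ℂ)} {g : L2 d} (h : (g : 𝓢'(Space d, ℂ)) = T) : toL2 T = g := by
  have h' : ∃ g : L2 d, (g : 𝓢'(Space d, ℂ)) = T := ⟨g, h⟩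
  rw [toL2, dif_pos h']
  exact toDistribution_injective (h'.choose_spec.trans h.symm)

/-- A bounded Fourier multiplier acts on `L²`. -/
theorem exists_multiplier {m : Space d → ℂ} (hm : m.HasTemperateGrowth)
    (hC : ∃ C, ∀ ξ, ‖m ξ‖ ≤ C) :
    ∃ T : L2 d →L[ℂ] L2 d, ∀ g : L2 d, ((T g : L2 d) : 𝓢'(Space d, ℂ)) =
      TemperedDistribution.fourierMultiplierCLM ℂ m g := by
  obtain ⟨C, hC⟩ := hC
  have hm' : MemLp m ∞ (volume : Measure (Space d)) :=
    memLp_top_of_bound hm.1.continuous.aestronglyMeasurable C (Eventually.of_forall hC)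
  -- Multiplication by the bounded symbol is the Hölder pairing $L^\infty\times L^2\to L^2$;
  -- conjugation by the Fourier transform gives the multiplier.
  let S : L2 d →L[ℂ] L2 d :=
    (ContinuousLinearMap.lsmul ℂ ℂ).holderL (volume : Measure (Space d)) ∞ 2 2 (hm'.toLp m)
  refine ⟨FourierTransform.fourierInvCLM ℂ (L2 d) ∘L S ∘L FourierTransform.fourierCLM ℂ (L2 d),
    fun g => ?_⟩
  have h1 : ((S (𝓕 g) : L2 d) : 𝓢'(Space d, ℂ)) =
      TemperedDistribution.smulLeftCLM ℂ m ((𝓕 g : L2 d) : 𝓢'(Space d, ℂ)) :=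
    MeasureTheory.Lp.toTemperedDistribution_smul_eq hm hm' (𝓕 g)
  rw [TemperedDistribution.fourierMultiplierCLM_apply, Lp.fourier_toTemperedDistribution_eq, ← h1,
    Lp.fourierInv_toTemperedDistribution_eq]
  rfl

/-! ### The two flows on $L^2$ -/

theorem flowA_toDistribution (ε t : ℝ) (u : L2 d) :
    ((flowA ε t u : L2 d) : 𝓢'(Space d, ℂ)) = TemperedDistribution.fourierMultiplierCLM ℂ
      (fun ξ => Complex.exp ((freePhase d ε t ξ : ℂ) * Complex.I)) u := by
  rw [flowA, ← Lp.fourierInv_toTemperedDistribution_eq,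
    TemperedDistribution.fourierMultiplierCLM_apply, Lp.fourier_toTemperedDistribution_eq]
  congr 1
  exact toDistribution_eq_smulLeftCLM (hasTemperateGrowth_phase (hasTemperateGrowth_freePhase ε t))
    (MemLp.coeFn_toLp _)

theorem norm_toLp_phase_mul {φ : Space d → ℝ} (hφ : AEStronglyMeasurable φ volume) (u : L2 d) :
    ‖(memLp_phase_mul hφ u).toLp‖ = ‖u‖ := by
  rw [Lp.norm_toLp, Lp.norm_def]
  congr 1
  exact eLpNorm_congr_norm_ae (Eventually.of_forall fun x => by
    simp [Complex.norm_exp_ofReal_mul_I])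

theorem norm_flowA (ε t : ℝ) (u : L2 d) : ‖flowA ε t u‖ = ‖u‖ := by
  rw [flowA, ← Lp.norm_fourier_eq, FourierTransform.fourier_fourierInv_eq,
    norm_toLp_phase_mul (aestronglyMeasurable_freePhase d ε t),
    Lp.norm_fourier_eq]

theorem norm_flowB (ω θ ε t : ℝ) (u : L2 d) : ‖flowB ω θ ε t u‖ = ‖u‖ :=
  norm_toLp_phase_mul (aestronglyMeasurable_nonlinearPhase ω θ ε t u) u

theorem flowA_flowA (ε s t : ℝ) (u : L2 d) : flowA ε s (flowA ε t u) = flowA ε (s + t) u := by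
  apply toDistribution_injective
  rw [flowA_toDistribution, flowA_toDistribution, flowA_toDistribution,
    TemperedDistribution.fourierMultiplierCLM_fourierMultiplierCLM_apply
      (hasTemperateGrowth_phase (hasTemperateGrowth_freePhase ε t))
      (hasTemperateGrowth_phase (hasTemperateGrowth_freePhase ε s))]
  congr 2
  ext ξ
  rw [Pi.mul_apply, ← Complex.exp_add]
  congr 1
  simp only [freePhase]
  push_cast
  ring

theorem flowA_zero (ε : ℝ) (u : L2 d) : flowA ε 0 u = u := by
  apply toDistribution_injective
  rw [flowA_toDistribution]
  simp [freePhase]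

theorem flowA_neg_flowA (ε t : ℝ) (u : L2 d) : flowA ε (-t) (flowA ε t u) = u := by
  rw [flowA_flowA, neg_add_cancel, flowA_zero]

theorem MemH.flowA {m : ℕ} {u : L2 d} (hu : MemH m u) (ε t : ℝ) : MemH m (flowA ε t u) := by
  rw [MemH, flowA_toDistribution]
  exact TemperedDistribution.MemSobolev.fourierMultiplierCLM_of_bounded hu
    (hasTemperateGrowth_phase (hasTemperateGrowth_freePhase ε t))
    ⟨1, fun ξ => by simp [Complex.norm_exp_ofReal_mul_I]⟩

theorem memH_flowA_iff {m : ℕ} {u : L2 d} (ε t : ℝ) : MemH m (flowA ε t u) ↔ MemH m u :=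
  ⟨fun h => by simpa [flowA_neg_flowA] using h.flowA ε (-t), fun h => h.flowA ε t⟩

/-! ### Weak derivatives -/

/-- The coordinate vector `e_j`. -/
abbrev coordVec (j : Fin d) : Space d := EuclideanSpace.single j (1 : ℝ)

/-- `g` is the weak derivative `∂_j f`. -/
def HasWeakDeriv (j : Fin d) (f g : L2 d) : Prop :=
  ∂_{coordVec j} (f : 𝓢'(Space d, ℂ)) = g

/-- The weak derivative is a closed operator: differentiation is continuous on tempered
distributions and $L^2$ embeds continuously in them. -/
theorem hasWeakDeriv_of_tendsto {j : Fin d} {ι : Type*} {l : Filter ι} [l.NeBot]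
    {F G : ι → L2 d} {f g : L2 d} (h : ∀ n, HasWeakDeriv j (F n) (G n))
    (hF : Tendsto F l (𝓝 f)) (hG : Tendsto G l (𝓝 g)) : HasWeakDeriv j f g := by
  have hc : Continuous fun T : 𝓢'(Space d, ℂ) => (∂_{coordVec j} T : 𝓢'(Space d, ℂ)) :=
    ContinuousLineDeriv.continuous_lineDerivOp _
  have h1 := ((hc.comp continuous_toDistribution).tendsto f).comp hF
  have h2 := (continuous_toDistribution.tendsto g).comp hG
  refine tendsto_nhds_unique h1 (h2.congr fun n => ?_)
  exact (h n).symm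

theorem hasWeakDeriv_iff {j : Fin d} {f g : L2 d} :
    HasWeakDeriv j f g ↔ ∀ ψ : 𝓢(Space d, ℂ),
      ∫ x, (∂_{coordVec j} ψ) x * f x = -∫ x, ψ x * g x := by
  rw [HasWeakDeriv, DFunLike.ext_iff]
  refine forall_congr' fun ψ => ?_
  simp only [TemperedDistribution.lineDerivOp_apply_apply, map_neg,
    Lp.toTemperedDistribution_apply, smul_eq_mul]
  exact neg_eq_iff_eq_neg

theorem HasWeakDeriv.add {j : Fin d} {f g f' g' : L2 d} (h : HasWeakDeriv j f g)
    (h' : HasWeakDeriv j f' g') : HasWeakDeriv j (f + f') (g + g') := by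
  unfold HasWeakDeriv at *
  rw [toDistribution_add, toDistribution_add, ← h, ← h', LineDerivAdd.lineDerivOp_add]

theorem HasWeakDeriv.smul {j : Fin d} {f g : L2 d} (h : HasWeakDeriv j f g) (c : ℂ) :
    HasWeakDeriv j (c • f) (c • g) := by
  unfold HasWeakDeriv at *
  rw [toDistribution_smul, toDistribution_smul, ← h, LineDerivSMul.lineDerivOp_smul]

theorem hasWeakDeriv_toLp (j : Fin d) (ψ : 𝓢(Space d, ℂ)) :
    HasWeakDeriv j (ψ.toLp 2) ((∂_{coordVec j} ψ).toLp 2) := by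
  rw [HasWeakDeriv, Lp.toTemperedDistribution_toLp_eq, Lp.toTemperedDistribution_toLp_eq,
    TemperedDistribution.lineDerivOp_toTemperedDistributionCLM_eq]

/-- A derivative is itself a Fourier multiplier, and symbols commute. -/
theorem lineDerivOp_multiplier_comm {m : Space d → ℂ} (hm : m.HasTemperateGrowth) (e : Space d)
    (T : 𝓢'(Space d, ℂ)) :
    ∂_{e} (TemperedDistribution.fourierMultiplierCLM ℂ m T) =
      TemperedDistribution.fourierMultiplierCLM ℂ m (∂_{e} T) := by
  rw [TemperedDistribution.lineDeriv_eq_fourierMultiplierCLM,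
    TemperedDistribution.lineDeriv_eq_fourierMultiplierCLM, map_smul,
    TemperedDistribution.fourierMultiplierCLM_fourierMultiplierCLM_apply hm (by fun_prop),
    TemperedDistribution.fourierMultiplierCLM_fourierMultiplierCLM_apply (by fun_prop) hm,
    mul_comm m]

theorem HasWeakDeriv.flowA {j : Fin d} {f g : L2 d} (h : HasWeakDeriv j f g) (ε t : ℝ) :
    HasWeakDeriv j (flowA ε t f) (flowA ε t g) := by
  unfold HasWeakDeriv at *
  rw [flowA_toDistribution, flowA_toDistribution, ← h, lineDerivOp_multiplier_comm
    (hasTemperateGrowth_phase (hasTemperateGrowth_freePhase ε t))]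

theorem iteratedLineDerivOp_multiplier_comm {m : Space d → ℂ} (hm : m.HasTemperateGrowth) {k : ℕ}
    (e : Fin k → Space d) (T : 𝓢'(Space d, ℂ)) :
    ∂^{e} (TemperedDistribution.fourierMultiplierCLM ℂ m T) =
      TemperedDistribution.fourierMultiplierCLM ℂ m (∂^{e} T) := by
  induction k with
  | zero => simp
  | succ k ih =>
    rw [LineDeriv.iteratedLineDerivOp_succ_left, LineDeriv.iteratedLineDerivOp_succ_left, ih,
      lineDerivOp_multiplier_comm hm]

theorem norm_weakDeriv_flowA {k : ℕ} (j : Fin k → Fin d) (ε t : ℝ) (u : L2 d) :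
    ‖weakDeriv j (flowA ε t u)‖ = ‖weakDeriv j u‖ := by
  have hm := hasTemperateGrowth_phase (hasTemperateGrowth_freePhase (d := d) ε t)
  have key : ∀ (u g : L2 d) (s : ℝ),
      (g : 𝓢'(Space d, ℂ)) = ∂^{fun i => coordVec (j i)} (u : 𝓢'(Space d, ℂ)) →
      ((CubicNLS.flowA ε s g : L2 d) : 𝓢'(Space d, ℂ)) =
        ∂^{fun i => coordVec (j i)} ((CubicNLS.flowA ε s u : L2 d) : 𝓢'(Space d, ℂ)) := by
    intro u g s h
    rw [flowA_toDistribution, flowA_toDistribution, h, iteratedLineDerivOp_multiplier_comm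
      (hasTemperateGrowth_phase (hasTemperateGrowth_freePhase ε s))]
  by_cases h : ∃ g : L2 d, (g : 𝓢'(Space d, ℂ)) = ∂^{fun i => coordVec (j i)} (u : 𝓢'(Space d, ℂ))
  · obtain ⟨g, hg⟩ := h
    rw [weakDeriv, weakDeriv, toL2_eq hg, toL2_eq (key u g t hg), norm_flowA]
  -- A derivative that is not in $L^2$ stays outside $L^2$, by flowing backwards. Both sides are
  -- then the default value 0 of `toL2`, so no regularity of `u` is required.
  · have h' : ¬ ∃ g : L2 d, (g : 𝓢'(Space d, ℂ)) = ∂^{fun i => coordVec (j i)}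
        ((CubicNLS.flowA ε t u : L2 d) : 𝓢'(Space d, ℂ)) := by
      rintro ⟨g, hg⟩
      refine h ⟨CubicNLS.flowA ε (-t) g, ?_⟩
      rw [key _ g (-t) hg, flowA_neg_flowA]
    rw [weakDeriv, weakDeriv, toL2, toL2, dif_neg h, dif_neg h']

theorem normH_flowA (m : ℕ) (ε t : ℝ) (u : L2 d) : normH m (flowA ε t u) = normH m u := by
  simp only [normH, norm_weakDeriv_flowA]

/-! ### Sobolev spaces of integer order and weak derivatives -/

/-- The symbol $1+|\xi|^2$ is a polynomial, so at order two the potential is a differential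
operator. This links the Fourier definition of Sobolev spaces to weak derivatives. -/
theorem besselPotential_two_eq (T : 𝓢'(Space d, ℂ)) :
    TemperedDistribution.besselPotential (Space d) ℂ 2 T =
      T + (-((2 * Real.pi : ℂ) ^ 2)⁻¹) • Laplacian.laplacian T := by
  have h0 : (fun x : Space d => (((1 + ‖x‖ ^ 2) ^ ((2 : ℝ) / 2) : ℝ) : ℂ)) =
      (fun _ => (1 : ℂ)) + fun x => ((‖x‖ ^ 2 : ℝ) : ℂ) := by
    ext x; simp
  have hg : (fun x : Space d => ((‖x‖ ^ 2 : ℝ) : ℂ)).HasTemperateGrowth := by fun_prop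
  have hπ : ((2 * Real.pi : ℝ) : ℂ) ≠ 0 := by
    exact_mod_cast (by positivity : (2 * Real.pi : ℝ) ≠ 0)
  rw [TemperedDistribution.besselPotential, h0, TemperedDistribution.fourierMultiplierCLM_apply,
    TemperedDistribution.smulLeftCLM_add (by fun_prop) hg,
    TemperedDistribution.laplacian_eq_fourierMultiplierCLM,
    TemperedDistribution.fourierMultiplierCLM_apply]
  simp only [add_apply, TemperedDistribution.smulLeftCLM_const, one_smul,
    FourierTransform.fourierInv_add, FourierTransform.fourierInv_fourier_eq]
  congr 1
  rw [← Complex.coe_smul, smul_smul]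
  convert (one_smul ℂ _).symm using 2
  push_cast at hπ ⊢
  field_simp

theorem memH_zero (u : L2 d) : MemH 0 u := by
  rw [MemH, Nat.cast_zero, TemperedDistribution.memSobolev_zero_iff]
  exact ⟨u, rfl⟩

theorem MemH.mono {m n : ℕ} (h : m ≤ n) {u : L2 d} (hu : MemH n u) : MemH m u :=
  TemperedDistribution.MemSobolev.mono (by exact_mod_cast h) hu

/-- For the converse, $\partial_ju\in H^m$ for all $j$ gives $\Delta u\in H^{m-1}$. Hence the Bessel
potential of order two sends $u$ into $H^{m-1}$, which means $u\in H^{m+1}$. -/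
theorem memH_succ_iff {m : ℕ} {u : L2 d} :
    MemH (m + 1) u ↔ MemH m u ∧ ∀ j, ∃ g, HasWeakDeriv j u g ∧ MemH m g := by
  constructor
  · intro hu
    refine ⟨hu.mono (Nat.le_succ m), fun j => ?_⟩
    have h1 : TemperedDistribution.MemSobolev (m : ℝ) 2
        (∂_{coordVec j} (u : 𝓢'(Space d, ℂ))) := by
      have := TemperedDistribution.MemSobolev.lineDerivOp hu (m := coordVec j)
      simpa using this
    obtain ⟨g, hg⟩ := TemperedDistribution.memSobolev_zero_iff.1
      (h1.mono (by positivity : (0 : ℝ) ≤ m))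
    exact ⟨g, hg, by rw [MemH, ← hg]; exact h1⟩
  · rintro ⟨hu, h⟩
    have h2 : TemperedDistribution.MemSobolev ((m : ℝ) - 1) 2
        (TemperedDistribution.besselPotential (Space d) ℂ 2 (u : 𝓢'(Space d, ℂ))) := by
      rw [besselPotential_two_eq, TemperedDistribution.laplacian_eq_sum
        (EuclideanSpace.basisFun (Fin d) ℝ), Finset.smul_sum]
      refine TemperedDistribution.MemSobolev.add
        (TemperedDistribution.MemSobolev.mono (by linarith) hu) ?_
      refine Finset.sum_induction _ (TemperedDistribution.MemSobolev ((m : ℝ) - 1) 2)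
        (fun _ _ => TemperedDistribution.MemSobolev.add)
        (TemperedDistribution.memSobolev_fun_zero _ _ _ _) fun j _ => ?_
      obtain ⟨g, hg, hgm⟩ := h j
      refine TemperedDistribution.MemSobolev.smul _ ?_
      rw [EuclideanSpace.basisFun_apply]
      refine TemperedDistribution.MemSobolev.lineDerivOp ?_
      rw [hg]
      exact hgm
    rw [TemperedDistribution.memSobolev_besselPotential_iff] at h2
    rw [MemH]
    convert h2 using 1
    push_cast
    ring

/-- The weak derivative `∂_j u`. -/
def partialDeriv (j : Fin d) (u : L2 d) : L2 d := toL2 (∂_{coordVec j} (u : 𝓢'(Space d, ℂ)))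

theorem HasWeakDeriv.partialDeriv_eq {j : Fin d} {f g : L2 d} (h : HasWeakDeriv j f g) :
    partialDeriv j f = g :=
  toL2_eq h.symm

theorem MemH.hasWeakDeriv {m : ℕ} {u : L2 d} (hu : MemH (m + 1) u) (j : Fin d) :
    HasWeakDeriv j u (partialDeriv j u) := by
  obtain ⟨g, hg, -⟩ := (memH_succ_iff.1 hu).2 j
  rwa [hg.partialDeriv_eq]

theorem MemH.partialDeriv {m : ℕ} {u : L2 d} (hu : MemH (m + 1) u) (j : Fin d) :
    MemH m (partialDeriv j u) := by
  obtain ⟨g, hg, hm⟩ := (memH_succ_iff.1 hu).2 j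
  rwa [hg.partialDeriv_eq]

theorem memH_one_of {u : L2 d} {g : Fin d → L2 d} (h : ∀ j, HasWeakDeriv j u (g j)) : MemH 1 u :=
  memH_succ_iff.2 ⟨memH_zero u, fun j => ⟨g j, h j, memH_zero _⟩⟩

theorem memH_two_of {u : L2 d} {g : Fin d → L2 d} {h : Fin d → Fin d → L2 d}
    (hg : ∀ j, HasWeakDeriv j u (g j)) (hh : ∀ j k, HasWeakDeriv k (g j) (h j k)) : MemH 2 u :=
  memH_succ_iff.2 ⟨memH_one_of hg, fun j => ⟨g j, hg j, memH_one_of (hh j)⟩⟩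

theorem weakDeriv_zero (j : Fin 0 → Fin d) (u : L2 d) : weakDeriv j u = u :=
  toL2_eq (by rw [LineDeriv.iteratedLineDerivOp_fin_zero])

theorem weakDeriv_one (j : Fin 1 → Fin d) (u : L2 d) : weakDeriv j u = partialDeriv (j 0) u := by
  rw [weakDeriv, LineDeriv.iteratedLineDerivOp_one, partialDeriv]

/-- Membership in $H^1$ ensures that the inner `partialDeriv` is a true derivative and not the
default value of `toL2`. -/
theorem weakDeriv_two (j : Fin 2 → Fin d) {u : L2 d} (hu : MemH 1 u) :
    weakDeriv j u = partialDeriv (j 0) (partialDeriv (j 1) u) := by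
  have h : ∂_{coordVec (j 1)} (u : 𝓢'(Space d, ℂ)) = partialDeriv (j 1) u := hu.hasWeakDeriv (j 1)
  rw [weakDeriv, LineDeriv.iteratedLineDerivOp_succ_left, LineDeriv.iteratedLineDerivOp_one,
    partialDeriv, ← h]
  rfl

/-! ### The norms of $H^1$ and $H^2$ in terms of partial derivatives -/

theorem normH_nonneg (m : ℕ) (u : L2 d) : 0 ≤ normH m u := Real.sqrt_nonneg _

theorem normH_one_sq (u : L2 d) : normH 1 u ^ 2 = ‖u‖ ^ 2 + ∑ j, ‖partialDeriv j u‖ ^ 2 := by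
  rw [normH, Real.sq_sqrt (by positivity), Finset.sum_range_succ, Finset.sum_range_one]
  congr 1
  · simp [weakDeriv_zero]
  · rw [← (Equiv.funUnique (Fin 1) (Fin d)).sum_comp]
    simp [weakDeriv_one]

theorem normH_two_sq {u : L2 d} (hu : MemH 1 u) :
    normH 2 u ^ 2 = ‖u‖ ^ 2 + ∑ j, ‖partialDeriv j u‖ ^ 2 +
      ∑ j, ∑ k, ‖partialDeriv j (partialDeriv k u)‖ ^ 2 := by
  rw [← normH_one_sq, normH, normH, Real.sq_sqrt (by positivity), Real.sq_sqrt (by positivity),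
    Finset.sum_range_succ]
  congr 1
  rw [← Fintype.sum_prod_type', ← (finTwoArrowEquiv (Fin d)).sum_comp]
  simp [weakDeriv_two _ hu]

theorem norm_weakDeriv_le_normH {m k : ℕ} (hk : k ≤ m) (j : Fin k → Fin d) (u : L2 d) :
    ‖weakDeriv j u‖ ≤ normH m u := by
  refine Real.le_sqrt_of_sq_le ?_
  refine le_trans ?_ (Finset.single_le_sum (f := fun k => ∑ j : Fin k → Fin d, ‖weakDeriv j u‖ ^ 2)
    (fun _ _ => by positivity) (Finset.mem_range_succ_iff.2 hk))
  exact Finset.single_le_sum (f := fun j : Fin k → Fin d => ‖weakDeriv j u‖ ^ 2)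
    (fun _ _ => by positivity) (Finset.mem_univ j)

theorem norm_le_normH (m : ℕ) (u : L2 d) : ‖u‖ ≤ normH m u := by
  simpa [weakDeriv_zero] using norm_weakDeriv_le_normH (Nat.zero_le m) Fin.elim0 u

theorem norm_partialDeriv_le_normH {m : ℕ} (hm : 1 ≤ m) (j : Fin d) (u : L2 d) :
    ‖partialDeriv j u‖ ≤ normH m u := by
  simpa [weakDeriv_one] using norm_weakDeriv_le_normH hm ![j] u

theorem norm_partialDeriv_partialDeriv_le_normH {m : ℕ} (hm : 2 ≤ m) (j k : Fin d) {u : L2 d}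
    (hu : MemH 1 u) : ‖partialDeriv j (partialDeriv k u)‖ ≤ normH m u := by
  simpa [weakDeriv_two _ hu] using norm_weakDeriv_le_normH hm ![j, k] u

theorem normH_mono {m n : ℕ} (h : m ≤ n) (u : L2 d) : normH m u ≤ normH n u := by
  refine Real.sqrt_le_sqrt (Finset.sum_le_sum_of_subset_of_nonneg ?_ fun _ _ _ => by positivity)
  exact Finset.range_mono (by omega)

/-- Minkowski's inequality in $\ell^2$ together with $\|r\|_{\ell^2}\le\|r\|_{\ell^1}$. The point is
the coefficient one of the first term. -/
theorem sqrt_sum_sq_le_add {ι : Type*} (s : Finset ι) {a b r : ι → ℝ} (ha : ∀ i ∈ s, 0 ≤ a i)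
    (hr : ∀ i ∈ s, 0 ≤ r i) (h : ∀ i ∈ s, a i ≤ b i + r i) :
    √(∑ i ∈ s, a i ^ 2) ≤ √(∑ i ∈ s, b i ^ 2) + ∑ i ∈ s, r i := by
  have hR : 0 ≤ ∑ i ∈ s, r i := Finset.sum_nonneg hr
  refine Real.sqrt_le_iff.2 ⟨by positivity, ?_⟩
  rw [add_sq, Real.sq_sqrt (by positivity)]
  calc ∑ i ∈ s, a i ^ 2
      ≤ ∑ i ∈ s, (b i ^ 2 + 2 * √(∑ i ∈ s, b i ^ 2) * r i + (∑ i ∈ s, r i) * r i) := by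
        refine Finset.sum_le_sum fun i hi => ?_
        have h1 : b i ≤ √(∑ i ∈ s, b i ^ 2) := Real.le_sqrt_of_sq_le
          (Finset.single_le_sum (f := fun i => b i ^ 2) (fun _ _ => by positivity) hi)
        have h2 : r i ≤ ∑ i ∈ s, r i := Finset.single_le_sum hr hi
        have h3 := pow_le_pow_left₀ (ha i hi) (h i hi) 2
        nlinarith [mul_le_mul_of_nonneg_right h1 (hr i hi),
          mul_le_mul_of_nonneg_right h2 (hr i hi)]
    _ = _ := by
        rw [Finset.sum_add_distrib, Finset.sum_add_distrib, ← Finset.mul_sum, ← Finset.mul_sum]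
        ring

theorem normH_le_add {m : ℕ} {w v : L2 d} (R : (k : ℕ) → (Fin k → Fin d) → ℝ)
    (hR : ∀ k j, 0 ≤ R k j)
    (h : ∀ k ≤ m, ∀ j : Fin k → Fin d, ‖weakDeriv j w‖ ≤ ‖weakDeriv j v‖ + R k j) :
    normH m w ≤ normH m v + ∑ k ∈ Finset.range (m + 1), ∑ j : Fin k → Fin d, R k j := by
  simp only [normH, Finset.sum_sigma']
  refine sqrt_sum_sq_le_add _ (fun _ _ => norm_nonneg _)
    (fun i _ => hR i.1 i.2) fun i hi => ?_
  exact h i.1 (Finset.mem_range_succ_iff.1 (Finset.mem_sigma.1 hi).1) i.2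

/-! ### Density of Schwartz functions -/

theorem partialDeriv_toLp (j : Fin d) (ψ : 𝓢(Space d, ℂ)) :
    partialDeriv j (ψ.toLp 2) = (∂_{coordVec j} ψ).toLp 2 :=
  (hasWeakDeriv_toLp j ψ).partialDeriv_eq

theorem memH_toLp (m : ℕ) (ψ : 𝓢(Space d, ℂ)) : MemH m (ψ.toLp 2) := by
  rw [MemH, Lp.toTemperedDistribution_toLp_eq]
  exact SchwartzMap.memSobolev ψ

theorem coord_sq_le (ξ : Space d) (j : Fin d) : |inner ℝ ξ (coordVec j)| ^ 2 ≤ ‖ξ‖ ^ 2 := by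
  have h := abs_real_inner_le_norm ξ (coordVec j)
  rw [PiLp.norm_single, norm_one, mul_one] at h
  exact pow_le_pow_left₀ (abs_nonneg _) h 2

/-- The Fourier symbol of the Bessel potential of order `-2`. -/
def besselSymbol (x : Space d) : ℂ := (((1 + ‖x‖ ^ 2) ^ (-((2 : ℕ) : ℝ) / 2) : ℝ) : ℂ)

theorem hasTemperateGrowth_besselSymbol : (besselSymbol (d := d)).HasTemperateGrowth := by
  unfold besselSymbol; fun_prop

/-- The symbols $(1+|\xi|^2)^{-1}$ times $1$, $\xi_j$ or $\xi_j\xi_k$ are bounded by one. So the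
inverse Bessel potential and its derivatives up to order two are bounded on $L^2$, and approximation
of $g$ in $L^2$ becomes approximation of $T_0g$ in $H^2$. -/
theorem exists_besselPotential_partialDeriv (d : ℕ) :
    ∃ (T0 : L2 d →L[ℂ] L2 d) (T1 : Fin d → L2 d →L[ℂ] L2 d)
      (T2 : Fin d → Fin d → L2 d →L[ℂ] L2 d),
      (∀ h : L2 d, ((T0 h : L2 d) : 𝓢'(Space d, ℂ)) =
        TemperedDistribution.fourierMultiplierCLM ℂ besselSymbol h) ∧
      (∀ j h, HasWeakDeriv j (T0 h) (T1 j h)) ∧ ∀ j k h, HasWeakDeriv j (T1 k h) (T2 j k h) := by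
  have hbT := hasTemperateGrowth_besselSymbol (d := d)
  have hbn : ∀ x : Space d, ‖besselSymbol x‖ = (1 + ‖x‖ ^ 2)⁻¹ := by
    intro x
    rw [besselSymbol, Complex.norm_real, Real.norm_of_nonneg (by positivity)]
    norm_num [Real.rpow_neg_one]
  have hi : ∀ j : Fin d, (fun x : Space d =>
      ((inner ℝ x (coordVec j) : ℝ) : ℂ)).HasTemperateGrowth := fun j => by fun_prop
  have hnorm : ∀ (j : Fin d) (x : Space d), ‖((inner ℝ x (coordVec j) : ℝ) : ℂ)‖ ^ 2 ≤ ‖x‖ ^ 2 := by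
    intro j x
    rw [Complex.norm_real, Real.norm_eq_abs]
    exact coord_sq_le x j
  obtain ⟨T0, hT0⟩ := exists_multiplier hbT ⟨1, fun x => by
    rw [hbn]; exact inv_le_one_of_one_le₀ (by nlinarith [sq_nonneg ‖x‖])⟩
  have hT1 : ∀ j : Fin d, ∃ T : L2 d →L[ℂ] L2 d, ∀ h : L2 d, HasWeakDeriv j (T0 h) (T h) := by
    intro j
    obtain ⟨T, hT⟩ := exists_multiplier (hbT.mul (hi j)) ⟨1, fun x => by
      rw [Pi.mul_apply, norm_mul, hbn, inv_mul_le_one₀ (by positivity)]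
      nlinarith [hnorm j x, norm_nonneg ((inner ℝ x (coordVec j) : ℝ) : ℂ)]⟩
    refine ⟨(2 * Real.pi * Complex.I : ℂ) • T, fun h => ?_⟩
    rw [HasWeakDeriv, hT0, TemperedDistribution.lineDeriv_eq_fourierMultiplierCLM,
      TemperedDistribution.fourierMultiplierCLM_fourierMultiplierCLM_apply hbT (hi j),
      smul_apply, toDistribution_smul, hT]
  choose T1 hT1 using hT1
  have hT2 : ∀ j k : Fin d, ∃ T : L2 d →L[ℂ] L2 d, ∀ h : L2 d,
      HasWeakDeriv j (T1 k h) (T h) := by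
    intro j k
    obtain ⟨T, hT⟩ := exists_multiplier ((hbT.mul (hi k)).mul (hi j)) ⟨1, fun x => by
      rw [Pi.mul_apply, Pi.mul_apply, norm_mul, norm_mul, hbn, mul_assoc,
        inv_mul_le_one₀ (by positivity)]
      nlinarith [hnorm j x, hnorm k x, sq_nonneg (‖((inner ℝ x (coordVec k) : ℝ) : ℂ)‖ -
        ‖((inner ℝ x (coordVec j) : ℝ) : ℂ)‖)]⟩
    refine ⟨(2 * Real.pi * Complex.I : ℂ) • (2 * Real.pi * Complex.I : ℂ) • T, fun h => ?_⟩
    rw [HasWeakDeriv, ← hT1 k h, hT0, TemperedDistribution.lineDeriv_eq_fourierMultiplierCLM,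
      TemperedDistribution.lineDeriv_eq_fourierMultiplierCLM, map_smul,
      TemperedDistribution.fourierMultiplierCLM_fourierMultiplierCLM_apply hbT (hi k),
      TemperedDistribution.fourierMultiplierCLM_fourierMultiplierCLM_apply (hbT.mul (hi k)) (hi j),
      smul_apply, smul_apply, toDistribution_smul, toDistribution_smul, hT]
  choose T2 hT2 using hT2
  exact ⟨T0, T1, T2, hT0, hT1, hT2⟩

/-- Schwartz functions are dense in `H²`. -/
theorem MemH.exists_schwartz_tendsto {u : L2 d} (hu : MemH 2 u) :
    ∃ f : ℕ → 𝓢(Space d, ℂ), Tendsto (fun n => (f n).toLp 2) atTop (𝓝 u) ∧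
      (∀ j, Tendsto (fun n => (∂_{coordVec j} (f n)).toLp 2) atTop (𝓝 (CubicNLS.partialDeriv j u))) ∧
      ∀ j k, Tendsto (fun n => (∂_{coordVec j} (∂_{coordVec k} (f n))).toLp 2) atTop
        (𝓝 (CubicNLS.partialDeriv j (CubicNLS.partialDeriv k u))) := by
  obtain ⟨T0, T1, T2, hT0, hT1, hT2⟩ := exists_besselPotential_partialDeriv d
  obtain ⟨g, hg⟩ := hu
  rw [← TemperedDistribution.besselPotential_neg_apply_eq_iff] at hg
  have hu0 : T0 g = u := toDistribution_injective ((hT0 g).trans hg)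
  have hu1 : ∀ j, T1 j g = CubicNLS.partialDeriv j u := fun j => by
    rw [← hu0, (hT1 j g).partialDeriv_eq]
  have hu2 : ∀ j k, T2 j k g = CubicNLS.partialDeriv j (CubicNLS.partialDeriv k u) := fun j k => by
    rw [← hu1, (hT2 j k g).partialDeriv_eq]
  obtain ⟨G, hG⟩ : ∃ G : ℕ → 𝓢(Space d, ℂ), Tendsto (fun n => (G n).toLp 2) atTop (𝓝 g) := by
    have hd : g ∈ closure (Set.range fun ψ : 𝓢(Space d, ℂ) => ψ.toLp 2) :=
      (SchwartzMap.denseRange_toLpCLM (E := Space d) (F := ℂ) (p := 2)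
        (μ := volume) ENNReal.ofNat_ne_top) g
    obtain ⟨x, hx, hlim⟩ := mem_closure_iff_seq_limit.1 hd
    choose G hG using hx
    exact ⟨G, by simpa only [hG] using hlim⟩
  -- The symbol has temperate growth, so the multiplier maps Schwartz functions to Schwartz
  -- functions.
  obtain ⟨F, hF⟩ : ∃ F : ℕ → 𝓢(Space d, ℂ), ∀ n, (F n).toLp 2 volume = T0 ((G n).toLp 2 volume) := by
    refine ⟨fun n => SchwartzMap.fourierMultiplierCLM ℂ besselSymbol (G n), fun n => ?_⟩
    apply toDistribution_injective
    rw [hT0, Lp.toTemperedDistribution_toLp_eq, Lp.toTemperedDistribution_toLp_eq,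
      TemperedDistribution.fourierMultiplierCLM_toTemperedDistributionCLM_eq
        hasTemperateGrowth_besselSymbol]
  have hF1 : ∀ j n, (∂_{coordVec j} (F n)).toLp 2 volume = T1 j ((G n).toLp 2 volume) := fun j n => by
    rw [← partialDeriv_toLp, hF, (hT1 j _).partialDeriv_eq]
  have hF2 : ∀ j k n, (∂_{coordVec j} (∂_{coordVec k} (F n))).toLp 2 volume = T2 j k ((G n).toLp 2 volume) :=
    fun j k n => by rw [← partialDeriv_toLp, hF1, (hT2 j k _).partialDeriv_eq]
  refine ⟨F, ?_, fun j => ?_, fun j k => ?_⟩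
  · simp only [hF, ← hu0]
    exact (T0.continuous.tendsto g).comp hG
  · simp only [hF1, ← hu1]
    exact ((T1 j).continuous.tendsto g).comp hG
  · simp only [hF2, ← hu2]
    exact ((T2 j k).continuous.tendsto g).comp hG

/-! ### Agmon's inequality for Schwartz functions -/

theorem integrableOn_inv_add_mul_sq {a b : ℝ} (ha : 0 < a) (hb : 0 < b) :
    IntegrableOn (fun y : ℝ => (a + b * y ^ 2)⁻¹) (Ioi 0) ∧
      ∫ y in Ioi (0 : ℝ), (a + b * y ^ 2)⁻¹ ≤ Real.pi / √(a * b) := by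
  have hc : √(b / a) ≠ 0 := (Real.sqrt_pos.2 (div_pos hb ha)).ne'
  have h1 : Integrable fun y : ℝ => a⁻¹ * (1 + (√(b / a) * y) ^ 2)⁻¹ :=
    (integrable_inv_one_add_sq.comp_mul_left' hc).const_mul _
  have h2 : (fun y : ℝ => (a + b * y ^ 2)⁻¹) = fun y : ℝ => a⁻¹ * (1 + (√(b / a) * y) ^ 2)⁻¹ := by
    ext y
    rw [← mul_inv, mul_pow, Real.sq_sqrt (by positivity)]
    congr 1
    field_simp
  rw [h2]
  refine ⟨h1.integrableOn, ?_⟩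
  calc ∫ y in Ioi (0 : ℝ), a⁻¹ * (1 + (√(b / a) * y) ^ 2)⁻¹
      ≤ ∫ y : ℝ, a⁻¹ * (1 + (√(b / a) * y) ^ 2)⁻¹ :=
        setIntegral_le_integral h1 (Eventually.of_forall fun y => by positivity)
    _ = a⁻¹ * (|(√(b / a))⁻¹| * Real.pi) := by
        rw [integral_const_mul, Measure.integral_comp_mul_left (fun y => (1 + y ^ 2)⁻¹) √(b / a),
          integral_univ_inv_one_add_sq, smul_eq_mul]
    _ = Real.pi / √(a * b) := by
        rw [abs_of_nonneg (by positivity), Real.sqrt_div hb.le, Real.sqrt_mul ha.le]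
        have h3 : √a ^ 2 = a := Real.sq_sqrt ha.le
        have h4 := Real.sqrt_pos.2 ha
        have h5 := Real.sqrt_pos.2 hb
        field_simp
        rw [h3]

/-- In polar coordinates the Jacobian $r^{d-1}$ is at most $1+r^2$ because $d\le3$, which leaves the
one-dimensional integral of $(a+br^2)^{-1}$. This is where the restriction on the dimension enters.
-/
theorem exists_integral_weight_le (hd : d ∈ ({1, 2, 3} : Set ℕ)) :
    ∃ K : ℝ, 0 < K ∧ ∀ a b : ℝ, 0 < a → 0 < b →
      Integrable (fun ξ : Space d => ((1 + ‖ξ‖ ^ 2) * (a + b * ‖ξ‖ ^ 2))⁻¹) ∧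
      ∫ ξ : Space d, ((1 + ‖ξ‖ ^ 2) * (a + b * ‖ξ‖ ^ 2))⁻¹ ≤ K / √(a * b) := by
  have hd1 : 1 ≤ d := by rcases hd with rfl | rfl | rfl <;> norm_num
  have hd3 : d - 1 ≤ 2 := by rcases hd with rfl | rfl | rfl <;> norm_num
  have : Nontrivial (Space d) := by
    refine Module.nontrivial_of_finrank_pos (R := ℝ) ?_
    rw [finrank_euclideanSpace_fin]; exact hd1
  set B : ℝ := (volume : Measure (Space d)).real (Metric.ball 0 1)
  -- Here $d\,B$ is the area of the unit sphere; $B+1$ replaces $B$ to make positivity immediate.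
  refine ⟨d * (B + 1) * Real.pi, by positivity, fun a b ha hb => ?_⟩
  have hpt : ∀ y ∈ Ioi (0 : ℝ), y ^ (d - 1) • ((1 + y ^ 2) * (a + b * y ^ 2))⁻¹ ≤
      (a + b * y ^ 2)⁻¹ := by
    intro y hy
    have hy0 : 0 < y := hy
    have h1 : y ^ (d - 1) ≤ 1 + y ^ 2 := by
      rcases le_total y 1 with h | h
      · nlinarith [pow_le_one₀ hy0.le h (n := d - 1), sq_nonneg y]
      · nlinarith [pow_le_pow_right₀ h hd3]
    rw [smul_eq_mul, mul_inv, ← mul_assoc]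
    refine mul_le_of_le_one_left (by positivity) ?_
    rw [← div_eq_mul_inv]
    exact div_le_one_of_le₀ h1 (by positivity)
  obtain ⟨hi, hle⟩ := integrableOn_inv_add_mul_sq ha hb
  have hint : IntegrableOn (fun y : ℝ => y ^ (d - 1) • ((1 + y ^ 2) * (a + b * y ^ 2))⁻¹)
      (Ioi 0) := by
    refine Integrable.mono' hi ?_ ?_
    · refine Measurable.aestronglyMeasurable ?_
      simp only [smul_eq_mul]
      fun_prop
    · refine (ae_restrict_mem measurableSet_Ioi).mono fun y hy => ?_
      rw [Real.norm_of_nonneg]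
      · exact hpt y hy
      · have : 0 < y := hy
        rw [smul_eq_mul]; positivity
  have hfr : Module.finrank ℝ (Space d) = d := finrank_euclideanSpace_fin
  refine ⟨?_, ?_⟩
  · have := (integrable_fun_norm_addHaar (E := Space d) volume
      (f := fun y : ℝ => ((1 + y ^ 2) * (a + b * y ^ 2))⁻¹)).2 (by rw [hfr]; exact hint)
    exact this
  · have := integral_fun_norm_addHaar (E := Space d) volume
      (fun y : ℝ => ((1 + y ^ 2) * (a + b * y ^ 2))⁻¹)
    rw [this, hfr]
    have h5 : ∫ y in Ioi (0 : ℝ), y ^ (d - 1) • ((1 + y ^ 2) * (a + b * y ^ 2))⁻¹ ≤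
        Real.pi / √(a * b) :=
      (setIntegral_mono_on hint hi measurableSet_Ioi hpt).trans hle
    have hB : 0 ≤ B := measureReal_nonneg
    calc d • B • ∫ y in Ioi (0 : ℝ), y ^ (d - 1) • ((1 + y ^ 2) * (a + b * y ^ 2))⁻¹
        ≤ d • (B + 1) • (Real.pi / √(a * b)) := by
          simp only [nsmul_eq_mul, smul_eq_mul] at h5 ⊢
          refine mul_le_mul_of_nonneg_left ?_ d.cast_nonneg
          refine (mul_le_mul_of_nonneg_left h5 hB).trans ?_
          exact mul_le_mul_of_nonneg_right (by linarith) (by positivity)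
      _ = d * (B + 1) * Real.pi / √(a * b) := by
          rw [nsmul_eq_mul, smul_eq_mul]; ring

/-! ### Plancherel formulas for the Sobolev norms of Schwartz functions -/

theorem integrable_norm_sq (ψ : 𝓢(Space d, ℂ)) : Integrable fun x => ‖ψ x‖ ^ 2 :=
  (ψ.memLp 2 volume).integrable_norm_pow two_ne_zero

theorem integral_norm_sq (ψ : 𝓢(Space d, ℂ)) : ∫ x, ‖ψ x‖ ^ 2 = ‖ψ.toLp 2 volume‖ ^ 2 := by
  have h := SchwartzMap.inner_toL2_toL2_eq ψ ψ (volume : Measure (Space d))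
  rw [inner_self_eq_norm_sq_to_K] at h
  simp only [inner_self_eq_norm_sq_to_K] at h
  have h3 : (∫ x, ((‖ψ x‖ : ℂ)) ^ 2) = ((∫ x, ‖ψ x‖ ^ 2 : ℝ) : ℂ) := by
    rw [← integral_complex_ofReal]
    push_cast
    rfl
  have h4 : ((∫ x, ‖ψ x‖ ^ 2 : ℝ) : ℂ) = ((‖ψ.toLp 2 volume‖ ^ 2 : ℝ) : ℂ) := by
    rw [← h3]
    push_cast
    exact h.symm
  exact_mod_cast h4

theorem integral_norm_sq_fourier_eq (ψ : 𝓢(Space d, ℂ)) :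
    ∫ ξ, ‖(𝓕 ψ) ξ‖ ^ 2 = ‖ψ.toLp 2 volume‖ ^ 2 := by
  rw [integral_norm_sq, ← SchwartzMap.toLp_fourier_eq, Lp.norm_fourier_eq]

theorem norm_le_integral_norm_fourier (f : 𝓢(Space d, ℂ)) (x : Space d) :
    ‖f x‖ ≤ ∫ ξ, ‖(𝓕 f) ξ‖ := by
  have h : f x = (𝓕⁻ (𝓕 f)) x := by rw [FourierTransform.fourierInv_fourier_eq]
  rw [h, SchwartzMap.fourierInv_coe, Real.fourierInv_eq]
  refine (norm_integral_le_integral_norm _).trans (le_of_eq ?_)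
  refine integral_congr_ae (Eventually.of_forall fun ξ => ?_)
  simp

theorem norm_fourier_lineDerivOp (f : 𝓢(Space d, ℂ)) (j : Fin d) (ξ : Space d) :
    ‖(𝓕 (∂_{coordVec j} f : 𝓢(Space d, ℂ)) : 𝓢(Space d, ℂ)) ξ‖ ^ 2 = (2 * Real.pi) ^ 2 * ξ j ^ 2 * ‖(𝓕 f) ξ‖ ^ 2 := by
  rw [SchwartzMap.fourier_lineDerivOp_eq]
  have h : (fun x : Space d => inner ℝ x (coordVec j)).HasTemperateGrowth := by fun_prop
  simp only [smul_apply, SchwartzMap.smulLeftCLM_apply_apply h, norm_smul]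
  simp only [mul_pow, norm_mul, Complex.norm_I, Complex.norm_real, Real.norm_eq_abs, sq_abs]
  simp [EuclideanSpace.inner_single_right]
  ring

theorem sum_norm_fourier_lineDerivOp (f : 𝓢(Space d, ℂ)) (ξ : Space d) :
    ∑ j : Fin d, ‖(𝓕 (∂_{coordVec j} f : 𝓢(Space d, ℂ)) : 𝓢(Space d, ℂ)) ξ‖ ^ 2 = (2 * Real.pi) ^ 2 * ‖ξ‖ ^ 2 * ‖(𝓕 f) ξ‖ ^ 2 := by
  simp_rw [norm_fourier_lineDerivOp, ← Finset.sum_mul, ← Finset.mul_sum,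
    EuclideanSpace.norm_sq_eq, Real.norm_eq_abs, sq_abs]

theorem normH_one_toLp_sq (f : 𝓢(Space d, ℂ)) :
    normH 1 (f.toLp 2 volume) ^ 2 =
      ∫ ξ, (‖(𝓕 f) ξ‖ ^ 2 + ∑ j : Fin d, ‖(𝓕 (∂_{coordVec j} f : 𝓢(Space d, ℂ)) : 𝓢(Space d, ℂ)) ξ‖ ^ 2) := by
  rw [integral_add (integrable_norm_sq _) (integrable_finsetSum _ fun j _ => integrable_norm_sq _),
    integral_finsetSum _ fun j _ => integrable_norm_sq _, normH_one_sq]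
  simp only [integral_norm_sq_fourier_eq, partialDeriv_toLp]

theorem normH_two_toLp_sq (f : 𝓢(Space d, ℂ)) :
    normH 2 (f.toLp 2 volume) ^ 2 =
      ∫ ξ, (‖(𝓕 f) ξ‖ ^ 2 + ∑ j : Fin d, ‖(𝓕 (∂_{coordVec j} f : 𝓢(Space d, ℂ)) : 𝓢(Space d, ℂ)) ξ‖ ^ 2 +
        ∑ j : Fin d, ∑ k : Fin d, ‖(𝓕 (∂_{coordVec j} (∂_{coordVec k} f : 𝓢(Space d, ℂ)) : 𝓢(Space d, ℂ)) : 𝓢(Space d, ℂ)) ξ‖ ^ 2) := by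
  have i1 : Integrable fun ξ => ‖(𝓕 f) ξ‖ ^ 2 +
      ∑ j : Fin d, ‖(𝓕 (∂_{coordVec j} f : 𝓢(Space d, ℂ)) : 𝓢(Space d, ℂ)) ξ‖ ^ 2 :=
    (integrable_norm_sq _).add (integrable_finsetSum _ fun j _ => integrable_norm_sq _)
  rw [integral_add i1
      (integrable_finsetSum _ fun j _ => integrable_finsetSum _ fun k _ => integrable_norm_sq _),
    ← normH_one_toLp_sq, normH_one_sq,
    integral_finsetSum _ fun j _ => integrable_finsetSum _ fun k _ => integrable_norm_sq _,
    normH_two_sq (memH_toLp 1 f)]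
  congr 1
  refine Finset.sum_congr rfl fun j _ => ?_
  rw [integral_finsetSum _ fun k _ => integrable_norm_sq _]
  simp only [integral_norm_sq_fourier_eq, partialDeriv_toLp]

/-- Agmon's inequality `‖f‖_∞ ≤ C ‖f‖_{H¹}^{1/2} ‖f‖_{H²}^{1/2}` in dimension at most three. -/
theorem exists_agmon_schwartz (hd : d ∈ ({1, 2, 3} : Set ℕ)) :
    ∃ K : ℝ, 0 < K ∧ ∀ (f : 𝓢(Space d, ℂ)) (x : Space d),
      ‖f x‖ ≤ K * √(normH 1 (f.toLp 2 volume) * normH 2 (f.toLp 2 volume)) := by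
  obtain ⟨K, hK, hw⟩ := exists_integral_weight_le hd
  refine ⟨(K + 2) / 2, by positivity, fun f x => ?_⟩
  set A := normH 1 (f.toLp 2 volume) with hA
  set B := normH 2 (f.toLp 2 volume) with hB
  have hAB : A ≤ B := normH_mono (by norm_num) _
  have hA0 : 0 ≤ A := normH_nonneg _ _
  rcases hA0.eq_or_lt with h0 | hApos
  -- The weights below divide by $A$, so the case $A=0$, in which $f=0$, is settled first.
  · have hn : ‖f.toLp 2 volume‖ = 0 :=
      le_antisymm ((norm_le_normH 1 _).trans h0.symm.le) (norm_nonneg _)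
    have hz : f = 0 := by
      have h1 : (⇑f : Space d → ℂ) =ᵐ[volume] 0 :=
        (f.coeFn_toLp 2 volume).symm.trans ((Lp.eq_zero_iff_ae_eq_zero).1 (norm_eq_zero.1 hn))
      have h2 : (⇑f : Space d → ℂ) = 0 :=
        (f.continuous.ae_eq_iff_eq volume continuous_zero).1 h1
      ext y
      exact congrFun h2 y
    rw [hz]
    simp only [zero_apply, norm_zero]
    positivity
  have hBpos : 0 < B := hApos.trans_le hAB
  set S1 : Space d → ℝ := fun ξ => ‖(𝓕 f) ξ‖ ^ 2 + ∑ j : Fin d, ‖(𝓕 (∂_{coordVec j} f : 𝓢(Space d, ℂ)) : 𝓢(Space d, ℂ)) ξ‖ ^ 2 with hS1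
  set S2 : Space d → ℝ := fun ξ => ‖(𝓕 f) ξ‖ ^ 2 + ∑ j : Fin d, ‖(𝓕 (∂_{coordVec j} f : 𝓢(Space d, ℂ)) : 𝓢(Space d, ℂ)) ξ‖ ^ 2 +
    ∑ j : Fin d, ∑ k : Fin d, ‖(𝓕 (∂_{coordVec j} (∂_{coordVec k} f : 𝓢(Space d, ℂ)) : 𝓢(Space d, ℂ)) : 𝓢(Space d, ℂ)) ξ‖ ^ 2 with hS2
  have iS1 : Integrable S1 :=
    (integrable_norm_sq _).add (integrable_finsetSum _ fun j _ => integrable_norm_sq _)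
  have iS2 : Integrable S2 := iS1.add
    (integrable_finsetSum _ fun j _ => integrable_finsetSum _ fun k _ => integrable_norm_sq _)
  have hI1 : ∫ ξ, S1 ξ = A ^ 2 := (normH_one_toLp_sq f).symm
  have hI2 : ∫ ξ, S2 ξ = B ^ 2 := (normH_two_toLp_sq f).symm
  have hπ : 1 ≤ Real.pi := by linarith [Real.pi_gt_three]
  -- The factor 2 pays for the cross term $2|\xi|^2$ of $(1+|\xi|^2)^2$ in `hp2`.
  have hπ4 : 2 ≤ (2 * Real.pi) ^ 2 := by nlinarith
  have hp1 : ∀ ξ, (1 + ‖ξ‖ ^ 2) * ‖(𝓕 f) ξ‖ ^ 2 ≤ S1 ξ := by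
    intro ξ
    simp only [hS1, sum_norm_fourier_lineDerivOp]
    have : 0 ≤ ‖ξ‖ ^ 2 * ‖(𝓕 f) ξ‖ ^ 2 := by positivity
    nlinarith
  have hp2 : ∀ ξ, (1 + ‖ξ‖ ^ 2) ^ 2 * ‖(𝓕 f) ξ‖ ^ 2 ≤ S2 ξ := by
    intro ξ
    simp only [hS2, sum_norm_fourier_lineDerivOp]
    rw [Finset.sum_comm]
    simp only [sum_norm_fourier_lineDerivOp, ← Finset.mul_sum]
    have h1 : 0 ≤ ‖ξ‖ ^ 2 * ‖(𝓕 f) ξ‖ ^ 2 := by positivity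
    have h2 : 0 ≤ ‖ξ‖ ^ 2 * ‖ξ‖ ^ 2 * ‖(𝓕 f) ξ‖ ^ 2 := by positivity
    have h3 : 1 ≤ (2 * Real.pi) ^ 2 * (2 * Real.pi) ^ 2 := by nlinarith
    nlinarith [mul_le_mul_of_nonneg_right hπ4 h1, mul_le_mul_of_nonneg_right h3 h2]
  set a : ℝ := (A ^ 2)⁻¹ with ha
  set b : ℝ := (B ^ 2)⁻¹ with hb
  obtain ⟨iW, hW⟩ := hw a b (by positivity) (by positivity)
  set W : Space d → ℝ := fun ξ => (1 + ‖ξ‖ ^ 2) * (a + b * ‖ξ‖ ^ 2) with hWdef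
  have hab : √(a * b) = (A * B)⁻¹ := by
    rw [ha, hb, ← mul_inv, ← mul_pow, Real.sqrt_inv, Real.sqrt_sq (by positivity)]
  have hL : 0 < √(A * B) := Real.sqrt_pos.2 (by positivity)
  set L := √(A * B) with hLdef
  have hL2 : L ^ 2 = A * B := Real.sq_sqrt (by positivity)
  -- Young's inequality with weight $LW$ replaces Cauchy–Schwarz. With $L=\sqrt{AB}$ both halves
  -- integrate to a multiple of $L$, namely at most $K L$ and $2L$.
  have hpt : ∀ ξ, ‖(𝓕 f) ξ‖ ≤ 1 / 2 * (L⁻¹ * (W ξ)⁻¹ + L * (a * S1 ξ + b * S2 ξ)) := by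
    intro ξ
    have hWpos : 0 < W ξ := by simp only [hWdef]; positivity
    have h1 : W ξ * ‖(𝓕 f) ξ‖ ^ 2 ≤ a * S1 ξ + b * S2 ξ := by
      have e1 := mul_le_mul_of_nonneg_left (hp1 ξ) (by positivity : 0 ≤ a)
      have e2 := mul_le_mul_of_nonneg_left (hp2 ξ) (by positivity : 0 ≤ b)
      have e3 : 0 ≤ b * ((1 + ‖ξ‖ ^ 2) * ‖(𝓕 f) ξ‖ ^ 2) := by positivity
      simp only [hWdef]
      nlinarith
    have h2 := mul_le_mul_of_nonneg_left h1 hL.le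
    have h3 : 2 * ‖(𝓕 f) ξ‖ ≤ L⁻¹ * (W ξ)⁻¹ + L * (W ξ * ‖(𝓕 f) ξ‖ ^ 2) := by
      have hm : 0 < L * W ξ := by positivity
      have h4 : (L * W ξ)⁻¹ + L * W ξ * ‖(𝓕 f) ξ‖ ^ 2 - 2 * ‖(𝓕 f) ξ‖ =
          (L * W ξ)⁻¹ * (L * W ξ * ‖(𝓕 f) ξ‖ - 1) ^ 2 := by
        field_simp
        ring
      have h5 : 0 ≤ (L * W ξ)⁻¹ + L * W ξ * ‖(𝓕 f) ξ‖ ^ 2 - 2 * ‖(𝓕 f) ξ‖ := by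
        rw [h4]; positivity
      rw [mul_inv] at h5
      linarith
    linarith
  have i1 : Integrable fun ξ => a * S1 ξ + b * S2 ξ := (iS1.const_mul a).add (iS2.const_mul b)
  have i2 : Integrable fun ξ => L⁻¹ * (W ξ)⁻¹ := iW.const_mul _
  calc ‖f x‖ ≤ ∫ ξ, ‖(𝓕 f) ξ‖ := norm_le_integral_norm_fourier f x
    _ ≤ ∫ ξ, 1 / 2 * (L⁻¹ * (W ξ)⁻¹ + L * (a * S1 ξ + b * S2 ξ)) :=
        integral_mono (𝓕 f).integrable.norm
          ((i2.add (i1.const_mul L)).const_mul _) hpt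
    _ = 1 / 2 * (L⁻¹ * (∫ ξ, (W ξ)⁻¹) + L * (a * A ^ 2 + b * B ^ 2)) := by
        rw [integral_const_mul, integral_add i2 (i1.const_mul L), integral_const_mul,
          integral_const_mul, integral_add (iS1.const_mul a) (iS2.const_mul b),
          integral_const_mul, integral_const_mul, hI1, hI2]
    _ ≤ 1 / 2 * (L⁻¹ * (K * L ^ 2) + L * (1 + 1)) := by
        have h1 : a * A ^ 2 = 1 := inv_mul_cancel₀ (by positivity)
        have h2 : b * B ^ 2 = 1 := inv_mul_cancel₀ (by positivity)
        rw [hab, div_inv_eq_mul, ← hL2] at hW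
        rw [h1, h2]
        gcongr
    _ = (K + 2) / 2 * L := by
        field_simp
        ring

/-! ### An `L⁴` bound for the gradient -/

theorem conj_hasTemperateGrowth (f : 𝓢(Space d, ℂ)) :
    (fun x => conj (f x)).HasTemperateGrowth :=
  (Complex.conjCLE : ℂ ≃L[ℝ] ℂ).hasTemperateGrowth.comp f.hasTemperateGrowth

theorem hasLineDerivAt_schwartz (f : 𝓢(Space d, ℂ)) (x e : Space d) :
    HasLineDerivAt ℝ f ((∂_{e} f : 𝓢(Space d, ℂ)) x) x e := by
  rw [SchwartzMap.lineDerivOp_apply_eq_fderiv]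
  exact (f.hasFDerivAt x).hasLineDerivAt e

theorem hasLineDerivAt_mul {f g : Space d → ℂ} {f' g' : ℂ} {x e : Space d}
    (hf : HasLineDerivAt ℝ f f' x e) (hg : HasLineDerivAt ℝ g g' x e) :
    HasLineDerivAt ℝ (fun y => f y * g y) (f' * g x + f x * g') x e := by
  have h := HasDerivAt.fun_mul (x := (0 : ℝ)) hf hg
  simp only [zero_smul, add_zero] at h
  exact h

theorem hasLineDerivAt_conj {f : Space d → ℂ} {f' : ℂ} {x e : Space d}
    (hf : HasLineDerivAt ℝ f f' x e) :
    HasLineDerivAt ℝ (fun y => conj (f y)) (conj f') x e :=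
  (Complex.conjCLE : ℂ ≃L[ℝ] ℂ).hasFDerivAt.comp_hasDerivAt (0 : ℝ) hf

/-- With $g=\partial_ef$, integration by parts gives $\int|g|^4=-\int f\,\partial_e(\bar
g^2g)\le3M\int|g|^2|\partial_eg|$. Young's inequality absorbs half of $\int|g|^4$ into the left
side. -/
theorem integral_norm_lineDerivOp_pow_four_le (f : 𝓢(Space d, ℂ)) (e : Space d) {M : ℝ}
    (hM : ∀ x, ‖f x‖ ≤ M) :
    ∫ x, ‖(∂_{e} f : 𝓢(Space d, ℂ)) x‖ ^ 4 ≤ 9 * M ^ 2 * ‖(∂_{e} (∂_{e} f : 𝓢(Space d, ℂ)) : 𝓢(Space d, ℂ)).toLp 2 volume‖ ^ 2 := by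
  set g : 𝓢(Space d, ℂ) := ∂_{e} f with hg
  have ha : (fun x => conj (g x) * conj (g x)).HasTemperateGrowth :=
    (conj_hasTemperateGrowth g).mul (conj_hasTemperateGrowth g)
  set G : 𝓢(Space d, ℂ) := SchwartzMap.smulLeftCLM ℂ (fun x => conj (g x) * conj (g x)) g with hG
  have hGx : ∀ x, G x = conj (g x) * conj (g x) * g x := fun x => by
    rw [hG, SchwartzMap.smulLeftCLM_apply_apply ha, smul_eq_mul]
  have hG' : ∀ x, (∂_{e} G : 𝓢(Space d, ℂ)) x = (conj ((∂_{e} g : 𝓢(Space d, ℂ)) x) * conj (g x) + conj (g x) * conj ((∂_{e} g : 𝓢(Space d, ℂ)) x))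
      * g x + conj (g x) * conj (g x) * (∂_{e} g : 𝓢(Space d, ℂ)) x := by
    intro x
    have h1 := hasLineDerivAt_schwartz g x e
    have h2 := hasLineDerivAt_mul (hasLineDerivAt_mul (hasLineDerivAt_conj h1) (hasLineDerivAt_conj h1)) h1
    have h3 := hasLineDerivAt_schwartz G x e
    have h4 : (⇑G : Space d → ℂ) = fun y => conj (g y) * conj (g y) * g y := funext hGx
    rw [h4] at h3
    exact h3.unique h2
  have i4 : Integrable fun x => ‖g x‖ ^ 4 := by
    exact (g.memLp (4 : ℕ) volume).integrable_norm_pow (by norm_num)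
  have ibp := SchwartzMap.integral_mul_lineDerivOp_right_eq_neg_left (μ := volume) f G e
  have h4 : ((∫ x, ‖g x‖ ^ 4 : ℝ) : ℂ) = - ∫ x, f x * (∂_{e} G : 𝓢(Space d, ℂ)) x := by
    rw [ibp, neg_neg, ← integral_complex_ofReal]
    refine integral_congr_ae (Eventually.of_forall fun x => ?_)
    have : ((‖g x‖ ^ 2 : ℝ) : ℂ) = g x * conj (g x) := by
      rw [Complex.mul_conj, Complex.normSq_eq_norm_sq]
    simp only [hGx, ← hg]
    calc ((‖g x‖ ^ 4 : ℝ) : ℂ) = ((‖g x‖ ^ 2 : ℝ) : ℂ) * ((‖g x‖ ^ 2 : ℝ) : ℂ) := by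
          push_cast; ring
      _ = _ := by rw [this]; ring
  have hle : ∫ x, ‖g x‖ ^ 4 ≤ ∫ x, (1 / 2 * ‖g x‖ ^ 4 + 9 * M ^ 2 / 2 * ‖(∂_{e} g : 𝓢(Space d, ℂ)) x‖ ^ 2) := by
    calc ∫ x, ‖g x‖ ^ 4 = ‖((∫ x, ‖g x‖ ^ 4 : ℝ) : ℂ)‖ := by
          rw [Complex.norm_real, Real.norm_of_nonneg (by positivity)]
      _ ≤ ∫ x, ‖f x * (∂_{e} G : 𝓢(Space d, ℂ)) x‖ := by
          rw [h4, norm_neg]; exact norm_integral_le_integral_norm _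
      _ ≤ _ := by
          refine integral_mono_of_nonneg (Eventually.of_forall fun x => norm_nonneg _)
            ((i4.const_mul _).add ((integrable_norm_sq _).const_mul _))
            (Eventually.of_forall fun x => ?_)
          have h1 : ‖(∂_{e} G : 𝓢(Space d, ℂ)) x‖ ≤ 3 * (‖g x‖ ^ 2 * ‖(∂_{e} g : 𝓢(Space d, ℂ)) x‖) := by
            rw [hG']
            refine (norm_add_le _ _).trans ?_
            rw [norm_mul, norm_mul, norm_mul]
            have := norm_add_le (conj ((∂_{e} g : 𝓢(Space d, ℂ)) x) * conj (g x)) (conj (g x) * conj ((∂_{e} g : 𝓢(Space d, ℂ)) x))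
            simp only [norm_mul, RCLike.norm_conj] at this ⊢
            nlinarith [mul_le_mul_of_nonneg_right this (norm_nonneg (g x))]
          have hM0 : 0 ≤ M := (norm_nonneg _).trans (hM x)
          have h2 : ‖f x‖ * ‖(∂_{e} G : 𝓢(Space d, ℂ)) x‖ ≤ M * (3 * (‖g x‖ ^ 2 * ‖(∂_{e} g : 𝓢(Space d, ℂ)) x‖)) :=
            mul_le_mul (hM x) h1 (norm_nonneg _) hM0
          simp only [norm_mul]
          nlinarith [sq_nonneg (‖g x‖ ^ 2 - 3 * M * ‖(∂_{e} g : 𝓢(Space d, ℂ)) x‖)]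
  rw [integral_add (i4.const_mul _) ((integrable_norm_sq _).const_mul _), integral_const_mul,
    integral_const_mul, integral_norm_sq] at hle
  linarith

theorem eLpNorm_lineDerivOp_four_le (f : 𝓢(Space d, ℂ)) (e : Space d) {M : ℝ}
    (hM : ∀ x, ‖f x‖ ≤ M) :
    eLpNorm (∂_{e} f : 𝓢(Space d, ℂ)) 4 volume ≤
      ENNReal.ofReal (√(3 * M * ‖(∂_{e} (∂_{e} f : 𝓢(Space d, ℂ)) : 𝓢(Space d, ℂ)).toLp 2 volume‖)) := by
  have hM0 : 0 ≤ M := (norm_nonneg _).trans (hM 0)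
  rw [((∂_{e} f : 𝓢(Space d, ℂ)).memLp 4 volume).eLpNorm_eq_integral_rpow_norm (by norm_num) (by norm_num)]
  refine ENNReal.ofReal_le_ofReal ?_
  have h4 : (4 : ℝ≥0∞).toReal = 4 := by norm_num
  rw [h4]
  have h := integral_norm_lineDerivOp_pow_four_le f e hM
  have hI : ∫ x, ‖(∂_{e} f : 𝓢(Space d, ℂ)) x‖ ^ (4 : ℝ) = ∫ x, ‖(∂_{e} f : 𝓢(Space d, ℂ)) x‖ ^ 4 := by
    congr 1; ext x; norm_cast
  rw [hI]
  have hnn : 0 ≤ ∫ x, ‖(∂_{e} f : 𝓢(Space d, ℂ)) x‖ ^ 4 := by positivity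
  rw [Real.rpow_inv_le_iff_of_pos hnn (Real.sqrt_nonneg _) (by norm_num)]
  refine h.trans (le_of_eq ?_)
  have e : √(3 * M * ‖(∂_{e} (∂_{e} f : 𝓢(Space d, ℂ)) : 𝓢(Space d, ℂ)).toLp 2 volume‖) ^ (4 : ℝ) =
      (√(3 * M * ‖(∂_{e} (∂_{e} f : 𝓢(Space d, ℂ)) : 𝓢(Space d, ℂ)).toLp 2 volume‖) ^ 2) ^ 2 := by
    rw [← pow_mul]; norm_cast
  rw [e, Real.sq_sqrt (by positivity)]
  ring

/-! ### Convergence of functions in `L^p` -/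

/-- The functions `F n` and `G` are in `L^p` and `F n` tends to `G` in `L^p`. -/
structure LpTendsto (p : ℝ≥0∞) (F : ℕ → Space d → ℂ) (G : Space d → ℂ) : Prop where
  memLp : ∀ n, MemLp (F n) p volume
  memLp_limit : MemLp G p volume
  tendsto : Tendsto (fun n => eLpNorm (F n - G) p volume) atTop (𝓝 0)

instance holderTriple_four_four_two : ENNReal.HolderTriple 4 4 2 where
  inv_add_inv_eq_inv := by
    have h : (4 : ℝ≥0∞) = 2 * 2 := by norm_num
    rw [h, ENNReal.mul_inv (by simp) (by simp), ← mul_add, ENNReal.inv_two_add_inv_two, mul_one]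

namespace LpTendsto

variable {p q r : ℝ≥0∞} {F F' : ℕ → Space d → ℂ} {G G' : Space d → ℂ}

theorem add (hp : 1 ≤ p) (h : LpTendsto p F G) (h' : LpTendsto p F' G') :
    LpTendsto p (fun n x => F n x + F' n x) (fun x => G x + G' x) := by
  refine ⟨fun n => (h.memLp n).add (h'.memLp n), h.memLp_limit.add h'.memLp_limit, ?_⟩
  have hlim := h.tendsto.add h'.tendsto
  rw [add_zero] at hlim
  refine tendsto_of_tendsto_of_tendsto_of_le_of_le tendsto_const_nhds hlim
    (fun _ => zero_le) fun n => ?_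
  have e : (fun x => F n x + F' n x) - (fun x => G x + G' x) = (F n - G) + (F' n - G') := by
    ext x; simp only [Pi.sub_apply, Pi.add_apply]; ring
  simp only [e]
  exact eLpNorm_add_le ((h.memLp n).sub h.memLp_limit).1 ((h'.memLp n).sub h'.memLp_limit).1 hp

/-- The difference of the products is expanded in the two differences and the two limits, so
Hölder's inequality needs only the finite norms of the limits. -/
theorem mul [ENNReal.HolderTriple p q r] (hr : 1 ≤ r) (h : LpTendsto p F G)
    (h' : LpTendsto q F' G') : LpTendsto r (fun n x => F n x * F' n x) (fun x => G x * G' x) := by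
  refine ⟨fun n => (h'.memLp n).mul' (h.memLp n), h'.memLp_limit.mul' h.memLp_limit, ?_⟩
  have hG := h.memLp_limit.2.ne
  have hG' := h'.memLp_limit.2.ne
  have hlim := ((ENNReal.Tendsto.mul h.tendsto (Or.inr ENNReal.zero_ne_top) h'.tendsto
    (Or.inr ENNReal.zero_ne_top)).add
    (ENNReal.Tendsto.const_mul h'.tendsto (Or.inr hG))).add
    (ENNReal.Tendsto.mul_const h.tendsto (Or.inr hG'))
  simp only [mul_zero, zero_mul, add_zero] at hlim
  refine tendsto_of_tendsto_of_tendsto_of_le_of_le tendsto_const_nhds hlim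
    (fun _ => zero_le) fun n => ?_
  have m1 := ((h.memLp n).sub h.memLp_limit).1
  have m2 := ((h'.memLp n).sub h'.memLp_limit).1
  have e : (fun x => F n x * F' n x) - (fun x => G x * G' x) =
      ((F n - G) • (F' n - G') + G • (F' n - G')) + (F n - G) • G' := by
    ext x; simp only [smul_eq_mul, Pi.sub_apply, Pi.add_apply, Pi.mul_apply]; ring
  simp only [e]
  refine (eLpNorm_add_le ((m1.smul m2).add (h.memLp_limit.1.smul m2))
    (m1.smul h'.memLp_limit.1) hr).trans ?_
  refine add_le_add ((eLpNorm_add_le (m1.smul m2) (h.memLp_limit.1.smul m2) hr).trans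
    (add_le_add ?_ ?_)) ?_
  · exact eLpNorm_smul_le_mul_eLpNorm m2 m1
  · exact eLpNorm_smul_le_mul_eLpNorm m2 h.memLp_limit.1
  · exact eLpNorm_smul_le_mul_eLpNorm h'.memLp_limit.1 m1

theorem const_mul (h : LpTendsto p F G) (c : ℂ) :
    LpTendsto p (fun n x => c * F n x) (fun x => c * G x) := by
  refine ⟨fun n => (h.memLp n).const_mul c, h.memLp_limit.const_mul c, ?_⟩
  have hlim := ENNReal.Tendsto.const_mul h.tendsto (Or.inr (enorm_ne_top (x := c)))
  rw [mul_zero] at hlim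
  refine hlim.congr fun n => ?_
  rw [← eLpNorm_const_smul]
  congr 1
  ext x
  simp only [Pi.smul_apply, Pi.sub_apply, smul_eq_mul]
  ring

theorem conjugate (h : LpTendsto p F G) :
    LpTendsto p (fun n x => conj (F n x)) (fun x => conj (G x)) := by
  refine ⟨fun n => (h.memLp n).star, h.memLp_limit.star, h.tendsto.congr fun n => ?_⟩
  refine eLpNorm_congr_norm_ae (Eventually.of_forall fun x => ?_)
  simp only [Pi.sub_apply]
  rw [← map_sub, RCLike.norm_conj]

theorem tendsto_toLp [Fact (1 ≤ p)] (h : LpTendsto p F G) :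
    Tendsto (fun n => (h.memLp n).toLp (F n)) atTop (𝓝 (h.memLp_limit.toLp G)) :=
  (Lp.tendsto_Lp_iff_tendsto_eLpNorm'' F h.memLp G h.memLp_limit).2 h.tendsto

theorem eLpNorm_le (hp : 1 ≤ p) (h : LpTendsto p F G) {b : ℕ → ℝ≥0∞} {B : ℝ≥0∞}
    (hb : ∀ n, eLpNorm (F n) p volume ≤ b n) (hB : Tendsto b atTop (𝓝 B)) :
    eLpNorm G p volume ≤ B := by
  have hlim := hB.add h.tendsto
  rw [add_zero] at hlim
  refine ge_of_tendsto' hlim fun n => ?_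
  have e : G = F n - (F n - G) := by simp
  calc eLpNorm G p volume = eLpNorm (F n - (F n - G)) p volume := by rw [← e]
    _ ≤ eLpNorm (F n) p volume + eLpNorm (F n - G) p volume :=
        eLpNorm_sub_le (h.memLp n).1 ((h.memLp n).sub h.memLp_limit).1 hp
    _ ≤ _ := by gcongr; exact hb n

/-- A sequence that converges in `L^q` and is Cauchy in `L^p` converges in `L^p`. -/
theorem of_cauchy (hp : 1 ≤ p) (hq : q ≠ 0) (h : LpTendsto q F G)
    (hF : ∀ n, MemLp (F n) p volume)
    (hc : Tendsto (fun k : ℕ × ℕ => eLpNorm (F k.1 - F k.2) p volume) atTop (𝓝 0)) :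
    LpTendsto p F G := by
  -- A subsequence converges almost everywhere to the $L^q$ limit `G`; Fatou's lemma along it turns
  -- the Cauchy bound into a bound of `F n - G` in $L^p$.
  obtain ⟨ns, hns, hae⟩ := (tendstoInMeasure_of_tendsto_eLpNorm hq (fun n => (h.memLp n).1)
    h.memLp_limit.1 h.tendsto).exists_seq_tendsto_ae
  have key : ∀ ε : ℝ≥0∞, 0 < ε → ∃ N, ∀ n ≥ N, eLpNorm (F n - G) p volume ≤ ε := by
    intro ε hε
    obtain ⟨N, hN⟩ := eventually_atTop_prod_self'.1 (ENNReal.tendsto_nhds_zero.1 hc ε hε)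
    refine ⟨N, fun n hn => ?_⟩
    refine Lp.eLpNorm_le_of_ae_tendsto (u := atTop) (f := fun k => F n - F (ns k)) ?_
      (fun k => ((hF n).sub (hF (ns k))).1) ?_
    · filter_upwards [hns.tendsto_atTop.eventually_ge_atTop N] with k hk
      exact hN n hn _ hk
    · filter_upwards [hae] with x hx
      exact hx.const_sub (F n x)
  have hlim : Tendsto (fun n => eLpNorm (F n - G) p volume) atTop (𝓝 0) := by
    refine ENNReal.tendsto_nhds_zero.2 fun ε hε => ?_
    obtain ⟨N, hN⟩ := key ε hε
    exact eventually_atTop.2 ⟨N, hN⟩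
  refine ⟨hF, ?_, hlim⟩
  exact Lp.memLp_of_cauchy_tendsto hp hF G h.memLp_limit.1 hlim

end LpTendsto

/-! ### Schwartz approximation in $H^2$, in $L^\infty$, and of gradients in $L^4$ -/

theorem lpTendsto_of_tendsto {f : ℕ → 𝓢(Space d, ℂ)} {u : L2 d}
    (h : Tendsto (fun n => (f n).toLp 2 volume) atTop (𝓝 u)) :
    LpTendsto 2 (fun n => f n) u := by
  refine ⟨fun n => (f n).memLp 2 volume, Lp.memLp u, ?_⟩
  have := (Lp.tendsto_Lp_iff_tendsto_eLpNorm' _ _).1 h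
  refine this.congr fun n => eLpNorm_congr_ae ?_
  filter_upwards [(f n).coeFn_toLp 2 volume] with x hx
  simp [hx]

theorem lineDerivOp_sub (e : Space d) (f g : 𝓢(Space d, ℂ)) :
    (∂_{e} (f - g) : 𝓢(Space d, ℂ)) = ∂_{e} f - ∂_{e} g := by
  rw [sub_eq_add_neg, LineDeriv.lineDerivOp_add, LineDeriv.lineDerivOp_neg, ← sub_eq_add_neg]

theorem toLp_sub (f g : 𝓢(Space d, ℂ)) :
    (f - g).toLp 2 volume = f.toLp 2 volume - g.toLp 2 volume :=
  (SchwartzMap.toLpCLM ℂ ℂ 2 (volume : Measure (Space d))).map_sub f g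

/-- Schwartz functions that tend to `u` in `H²`, uniformly, and with gradients in `L⁴`. -/
structure SchwartzApprox (u : L2 d) (f : ℕ → 𝓢(Space d, ℂ)) : Prop where
  tendsto : Tendsto (fun n => (f n).toLp 2 volume) atTop (𝓝 u)
  tendsto_deriv : ∀ j, Tendsto (fun n => (∂_{coordVec j} (f n) : 𝓢(Space d, ℂ)).toLp 2 volume)
    atTop (𝓝 (partialDeriv j u))
  tendsto_deriv_deriv : ∀ j k, Tendsto (fun n =>
    (∂_{coordVec j} (∂_{coordVec k} (f n) : 𝓢(Space d, ℂ)) : 𝓢(Space d, ℂ)).toLp 2 volume)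
    atTop (𝓝 (partialDeriv j (partialDeriv k u)))
  lpTendsto_top : LpTendsto ∞ (fun n => f n) u
  lpTendsto_four : ∀ j, LpTendsto 4 (fun n => (∂_{coordVec j} (f n) : 𝓢(Space d, ℂ)))
    (partialDeriv j u)

theorem tendsto_normH_one {u : L2 d} {v : ℕ → L2 d}
    (h : Tendsto v atTop (𝓝 u))
    (h1 : ∀ j, Tendsto (fun n => partialDeriv j (v n)) atTop (𝓝 (partialDeriv j u))) :
    Tendsto (fun n => normH 1 (v n)) atTop (𝓝 (normH 1 u)) := by
  have e : ∀ w : L2 d, normH 1 w = √(‖w‖ ^ 2 + ∑ j, ‖partialDeriv j w‖ ^ 2) := fun w => by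
    rw [← normH_one_sq, Real.sqrt_sq (normH_nonneg _ _)]
  simp only [e]
  refine Tendsto.sqrt ((h.norm.pow 2).add (tendsto_finsetSum _ fun j _ => ?_))
  exact (h1 j).norm.pow 2

theorem tendsto_normH_two {ι : Type*} {l : Filter ι} {u : L2 d} (hu : MemH 1 u) {v : ι → L2 d}
    (hv : ∀ n, MemH 1 (v n)) (h : Tendsto v l (𝓝 u))
    (h1 : ∀ j, Tendsto (fun n => partialDeriv j (v n)) l (𝓝 (partialDeriv j u)))
    (h2 : ∀ j k, Tendsto (fun n => partialDeriv j (partialDeriv k (v n))) l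
      (𝓝 (partialDeriv j (partialDeriv k u)))) :
    Tendsto (fun n => normH 2 (v n)) l (𝓝 (normH 2 u)) := by
  have e : ∀ w : L2 d, MemH 1 w → normH 2 w = √(‖w‖ ^ 2 + ∑ j, ‖partialDeriv j w‖ ^ 2 +
      ∑ j, ∑ k, ‖partialDeriv j (partialDeriv k w)‖ ^ 2) := fun w hw => by
    rw [← normH_two_sq hw, Real.sqrt_sq (normH_nonneg _ _)]
  rw [e u hu]
  simp only [fun n => e _ (hv n)]
  refine Tendsto.sqrt (((h.norm.pow 2).add (tendsto_finsetSum _ fun j _ => ?_)).add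
    (tendsto_finsetSum _ fun j _ => tendsto_finsetSum _ fun k _ => ?_))
  · exact (h1 j).norm.pow 2
  · exact (h2 j k).norm.pow 2

theorem eLpNorm_top_le_of_bound {f : Space d → ℂ} {M : ℝ} (h : ∀ x, ‖f x‖ ≤ M) :
    eLpNorm f ∞ volume ≤ ENNReal.ofReal M := by
  rw [eLpNorm_exponent_top]
  exact eLpNormEssSup_le_of_ae_bound (Eventually.of_forall h)

theorem toLp_zero : (0 : 𝓢(Space d, ℂ)).toLp 2 volume = 0 :=
  (SchwartzMap.toLpCLM ℂ ℂ 2 (volume : Measure (Space d))).map_zero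

theorem partialDeriv_zero (j : Fin d) : partialDeriv j (0 : L2 d) = 0 := by
  have h := partialDeriv_toLp j (0 : 𝓢(Space d, ℂ))
  rwa [LineDeriv.lineDerivOp_zero, toLp_zero] at h

theorem normH_zero_right (m : ℕ) (hm : m ≤ 2) : normH m (0 : L2 d) = 0 := by
  refine le_antisymm ((normH_mono hm _).trans ?_) (normH_nonneg _ _)
  have h := normH_two_sq ((memH_toLp 1 (0 : 𝓢(Space d, ℂ))))
  rw [toLp_zero] at h
  simp only [partialDeriv_zero, norm_zero] at h
  simp at h
  exact h.le

theorem tendsto_toLp_sub {g : ℕ → 𝓢(Space d, ℂ)} {v : L2 d}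
    (hg : Tendsto (fun n => (g n).toLp 2 volume) atTop (𝓝 v)) :
    Tendsto (fun k : ℕ × ℕ => (g k.1 - g k.2).toLp 2 volume) atTop (𝓝 0) := by
  have hfst : Tendsto (Prod.fst : ℕ × ℕ → ℕ) atTop atTop := by
    rw [← prod_atTop_atTop_eq]; exact tendsto_fst
  have hsnd : Tendsto (Prod.snd : ℕ × ℕ → ℕ) atTop atTop := by
    rw [← prod_atTop_atTop_eq]; exact tendsto_snd
  have h := (hg.comp hfst).sub (hg.comp hsnd)
  rw [sub_self] at h
  exact h.congr fun k => (toLp_sub _ _).symm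

/-- The Cauchy property in $H^2$, stated for differences of Schwartz functions because the a priori
estimates apply to these. -/
theorem tendsto_normH_two_sub {f : ℕ → 𝓢(Space d, ℂ)} {u : L2 d} {v : Fin d → L2 d}
    {w : Fin d → Fin d → L2 d} (h0 : Tendsto (fun n => (f n).toLp 2 volume) atTop (𝓝 u))
    (h1 : ∀ j, Tendsto (fun n => (∂_{coordVec j} (f n) : 𝓢(Space d, ℂ)).toLp 2 volume) atTop
      (𝓝 (v j)))
    (h2 : ∀ j k, Tendsto (fun n =>
      (∂_{coordVec j} (∂_{coordVec k} (f n) : 𝓢(Space d, ℂ)) : 𝓢(Space d, ℂ)).toLp 2 volume) atTop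
      (𝓝 (w j k))) :
    Tendsto (fun k : ℕ × ℕ => normH 2 ((f k.1 - f k.2).toLp 2 volume)) atTop (𝓝 0) := by
  rw [← normH_zero_right (d := d) 2 le_rfl]
  have hz : MemH 1 (0 : L2 d) := by rw [← toLp_zero]; exact memH_toLp 1 _
  have e1 : ∀ (j : Fin d) (k : ℕ × ℕ), partialDeriv j ((f k.1 - f k.2).toLp 2 volume) =
      ((∂_{coordVec j} (f k.1) : 𝓢(Space d, ℂ)) - ∂_{coordVec j} (f k.2)).toLp 2 volume :=
    fun j k => by rw [partialDeriv_toLp, lineDerivOp_sub]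
  have e2 : ∀ (i j : Fin d) (k : ℕ × ℕ),
      partialDeriv i (partialDeriv j ((f k.1 - f k.2).toLp 2 volume)) =
      ((∂_{coordVec i} (∂_{coordVec j} (f k.1) : 𝓢(Space d, ℂ)) : 𝓢(Space d, ℂ)) -
        ∂_{coordVec i} (∂_{coordVec j} (f k.2) : 𝓢(Space d, ℂ))).toLp 2 volume :=
    fun i j k => by rw [e1, partialDeriv_toLp, lineDerivOp_sub]
  refine tendsto_normH_two hz (fun k => memH_toLp 1 _) (tendsto_toLp_sub h0) (fun j => ?_)
    fun i j => ?_
  · rw [partialDeriv_zero]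
    exact (tendsto_toLp_sub (h1 j)).congr fun k => (e1 j k).symm
  · rw [partialDeriv_zero, partialDeriv_zero]
    exact (tendsto_toLp_sub (h2 i j)).congr fun k => (e2 i j k).symm

/-- Agmon's inequality and the $L^4$ estimate, applied to $f_m-f_n$, make an approximating sequence
in $H^2$ Cauchy in $L^\infty$, with gradients Cauchy in $L^4$. The $L^2$ limits identify the limits.
-/
theorem exists_schwartzApprox (hd : d ∈ ({1, 2, 3} : Set ℕ)) {u : L2 d} (hu : MemH 2 u) :
    ∃ f, SchwartzApprox u f := by
  obtain ⟨f, h0, h1, h2⟩ := hu.exists_schwartz_tendsto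
  obtain ⟨K, hK, hA⟩ := exists_agmon_schwartz hd
  have hbd : ∀ (g : 𝓢(Space d, ℂ)) (x : Space d), ‖g x‖ ≤ K * normH 2 (g.toLp 2 volume) := by
    intro g x
    refine (hA g x).trans (mul_le_mul_of_nonneg_left (Real.sqrt_le_iff.2
      ⟨normH_nonneg _ _, ?_⟩) hK.le)
    nlinarith [normH_mono (show 1 ≤ 2 by norm_num) (g.toLp 2 volume),
      normH_nonneg 2 (g.toLp 2 volume)]
  have hdiff := tendsto_normH_two_sub h0 h1 h2
  refine ⟨f, h0, h1, h2, ?_, fun j => ?_⟩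
  · refine (lpTendsto_of_tendsto h0).of_cauchy le_top two_ne_zero (fun n => (f n).memLp ∞ volume) ?_
    have hlim := ENNReal.tendsto_ofReal (hdiff.const_mul K)
    rw [mul_zero, ENNReal.ofReal_zero] at hlim
    refine tendsto_of_tendsto_of_tendsto_of_le_of_le tendsto_const_nhds hlim
      (fun _ => zero_le) fun k => ?_
    exact eLpNorm_top_le_of_bound (f := ⇑(f k.1 - f k.2)) (hbd (f k.1 - f k.2))
  · refine (lpTendsto_of_tendsto (h1 j)).of_cauchy (by norm_num) two_ne_zero
      (fun n => SchwartzMap.memLp _ 4 volume) ?_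
    have hlim := ENNReal.tendsto_ofReal ((hdiff.pow 2).const_mul (3 * K)).sqrt
    rw [zero_pow two_ne_zero, mul_zero, Real.sqrt_zero, ENNReal.ofReal_zero] at hlim
    refine tendsto_of_tendsto_of_tendsto_of_le_of_le tendsto_const_nhds hlim
      (fun _ => zero_le) fun k => ?_
    have h4 := eLpNorm_lineDerivOp_four_le (f k.1 - f k.2) (coordVec j) (hbd (f k.1 - f k.2))
    have e : (fun x => (∂_{coordVec j} (f k.1) : 𝓢(Space d, ℂ)) x) -
        (fun x => (∂_{coordVec j} (f k.2) : 𝓢(Space d, ℂ)) x) =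
        ⇑(∂_{coordVec j} (f k.1 - f k.2) : 𝓢(Space d, ℂ)) := by
      rw [lineDerivOp_sub]; rfl
    refine (le_of_eq (congrArg (fun F => eLpNorm F 4 volume) e)).trans
      (h4.trans (ENNReal.ofReal_le_ofReal (Real.sqrt_le_sqrt ?_)))
    have h5 := norm_partialDeriv_partialDeriv_le_normH (m := 2) le_rfl j j
      (memH_toLp 1 (f k.1 - f k.2))
    rw [partialDeriv_toLp, partialDeriv_toLp] at h5
    have h6 := mul_le_mul_of_nonneg_left h5 (by
      have := normH_nonneg 2 ((f k.1 - f k.2).toLp 2 volume)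
      positivity : 0 ≤ 3 * (K * normH 2 ((f k.1 - f k.2).toLp 2 volume)))
    refine h6.trans (le_of_eq ?_)
    ring

/-- Agmon's inequality and the `L⁴` bound for the gradient in `H²`. -/
theorem exists_agmon (hd : d ∈ ({1, 2, 3} : Set ℕ)) :
    ∃ K : ℝ, 0 < K ∧ ∀ u : L2 d, MemH 2 u →
      eLpNorm u ∞ volume ≤ ENNReal.ofReal (K * √(normH 1 u * normH 2 u)) ∧
      ∀ j, eLpNorm (partialDeriv j u) 4 volume ≤
        ENNReal.ofReal (√(3 * (K * √(normH 1 u * normH 2 u)) *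
          ‖partialDeriv j (partialDeriv j u)‖)) := by
  obtain ⟨K, hK, hA⟩ := exists_agmon_schwartz hd
  refine ⟨K, hK, fun u hu => ?_⟩
  obtain ⟨f, hf⟩ := exists_schwartzApprox hd hu
  have hd1 : ∀ j, Tendsto (fun n => partialDeriv j ((f n).toLp 2 volume)) atTop
      (𝓝 (partialDeriv j u)) := fun j => by
    simp only [partialDeriv_toLp]; exact hf.tendsto_deriv j
  have hd2 : ∀ j k, Tendsto (fun n => partialDeriv j (partialDeriv k ((f n).toLp 2 volume))) atTop
      (𝓝 (partialDeriv j (partialDeriv k u))) := fun j k => by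
    simp only [partialDeriv_toLp]; exact hf.tendsto_deriv_deriv j k
  have hn1 := tendsto_normH_one hf.tendsto hd1
  have hn2 := tendsto_normH_two (hu.mono one_le_two) (fun n => memH_toLp 1 (f n)) hf.tendsto hd1 hd2
  have hM := (hn1.mul hn2).sqrt.const_mul K
  refine ⟨hf.lpTendsto_top.eLpNorm_le le_top (fun n => eLpNorm_top_le_of_bound (hA (f n)))
    (ENNReal.tendsto_ofReal hM), fun j => ?_⟩
  refine (hf.lpTendsto_four j).eLpNorm_le (by norm_num)
    (fun n => eLpNorm_lineDerivOp_four_le (f n) (coordVec j) (hA (f n))) ?_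
  exact ENNReal.tendsto_ofReal ((hM.const_mul 3).mul (hf.tendsto_deriv_deriv j j).norm).sqrt

/-! ### Weak derivatives of classically differentiable functions -/

/-- Integration by parts against a Schwartz function needs only integrable products, which Hölder's
inequality supplies. -/
theorem hasWeakDeriv_of_hasLineDerivAt {j : Fin d} {F F' : Space d → ℂ}
    (hF : MemLp F 2 volume) (hF' : MemLp F' 2 volume)
    (h : ∀ x, HasLineDerivAt ℝ F (F' x) x (coordVec j)) :
    HasWeakDeriv j (hF.toLp F) (hF'.toLp F') := by
  rw [hasWeakDeriv_iff]
  intro ψ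
  have h2 : ∀ (φ : 𝓢(Space d, ℂ)) {g : Space d → ℂ}, MemLp g 2 volume →
      Integrable (fun x => φ x * g x) := fun φ g hg => (φ.memLp 2 volume).integrable_mul hg
  have ibp := integral_bilinear_hasLineDerivAt_right_eq_neg_left_of_integrable
    (μ := (volume : Measure (Space d))) (f := ψ) (f' := (∂_{coordVec j} ψ : 𝓢(Space d, ℂ)))
    (g := F) (g' := F') (v := coordVec j) (B := ContinuousLinearMap.mul ℝ ℂ)
    (h2 _ hF) (h2 _ hF') (h2 _ hF) (fun x _ => hasLineDerivAt_schwartz ψ x _) (fun x _ => h x)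
  have e1 : ∫ x, (∂_{coordVec j} ψ : 𝓢(Space d, ℂ)) x * (hF.toLp F) x =
      ∫ x, (∂_{coordVec j} ψ : 𝓢(Space d, ℂ)) x * F x :=
    integral_congr_ae (by filter_upwards [hF.coeFn_toLp] with x hx; rw [hx])
  have e2 : ∫ x, ψ x * (hF'.toLp F') x = ∫ x, ψ x * F' x :=
    integral_congr_ae (by filter_upwards [hF'.coeFn_toLp] with x hx; rw [hx])
  simp only [ContinuousLinearMap.mul_apply'] at ibp
  rw [e1, e2, ibp, neg_neg]

theorem hasWeakDeriv_of_lpTendsto {j : Fin d} {F F' : ℕ → Space d → ℂ} {G G' : Space d → ℂ}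
    (hF : LpTendsto 2 F G) (hF' : LpTendsto 2 F' G')
    (h : ∀ n x, HasLineDerivAt ℝ (F n) (F' n x) x (coordVec j)) :
    HasWeakDeriv j (hF.memLp_limit.toLp G) (hF'.memLp_limit.toLp G') :=
  hasWeakDeriv_of_tendsto
    (fun n => hasWeakDeriv_of_hasLineDerivAt (hF.memLp n) (hF'.memLp n) (h n))
    hF.tendsto_toLp hF'.tendsto_toLp

/-! ### The cubic phase factor -/

/-- The factor `exp (i β |z|²)`. -/
def cubicPhase (β : ℝ) (z : ℂ) : ℂ := Complex.exp (((β * ‖z‖ ^ 2 : ℝ) : ℂ) * Complex.I)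

/-- The first derivative `2 Re (z̄ a)` of `|z|²`, where `a` is a derivative of `z`. -/
def sqDeriv (z a : ℂ) : ℂ := conj a * z + conj z * a

/-- The second derivative of `|z|²`, where `a`, `b` are first derivatives of `z` and `c` is the
mixed second derivative. -/
def sqDerivDeriv (z a b c : ℂ) : ℂ := (conj c * z + conj a * b) + (conj b * a + conj z * c)

/-- The first derivative of `exp (i β |z|²) z`, without the phase factor. -/
def cubicDeriv (β : ℝ) (z a : ℂ) : ℂ := a + (β * Complex.I) * (sqDeriv z a * z)

/-- The second derivative of `exp (i β |z|²) z`, without the phase factor. -/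
def cubicDerivDeriv (β : ℝ) (z a b c : ℂ) : ℂ :=
  ((β * Complex.I) * sqDeriv z b) * cubicDeriv β z a +
    (c + (β * Complex.I) * (sqDerivDeriv z a b c * z + sqDeriv z a * b))

theorem norm_cubicPhase (β : ℝ) (z : ℂ) : ‖cubicPhase β z‖ = 1 :=
  Complex.norm_exp_ofReal_mul_I _

theorem continuous_cubicPhase (β : ℝ) : Continuous (cubicPhase β) := by
  unfold cubicPhase; fun_prop

theorem norm_exp_sub_exp_le (a b : ℝ) :
    ‖Complex.exp ((a : ℂ) * Complex.I) - Complex.exp ((b : ℂ) * Complex.I)‖ ≤ |a - b| := by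
  have h : Complex.exp ((a : ℂ) * Complex.I) - Complex.exp ((b : ℂ) * Complex.I) =
      Complex.exp ((b : ℂ) * Complex.I) * (Complex.exp (Complex.I * ((a - b : ℝ) : ℂ)) - 1) := by
    rw [mul_sub, ← Complex.exp_add, mul_one]
    congr 2
    push_cast
    ring
  rw [h, norm_mul, Complex.norm_exp_ofReal_mul_I, one_mul]
  exact Real.norm_exp_I_mul_ofReal_sub_one_le

theorem hasLineDerivAt_cubicPhase (β : ℝ) {f : Space d → ℂ} {a : ℂ} {x e : Space d}
    (h : HasLineDerivAt ℝ f a x e) :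
    HasLineDerivAt ℝ (fun y => cubicPhase β (f y))
      (cubicPhase β (f x) * ((β * Complex.I) * sqDeriv (f x) a)) x e := by
  -- Writing $|f|^2=\bar f f$ makes the exponent a product of line-differentiable functions.
  have e1 : (fun y => cubicPhase β (f y)) =
      fun y => Complex.exp ((β * Complex.I) * (conj (f y) * f y)) := by
    ext y
    rw [cubicPhase, mul_comm (conj (f y)), Complex.mul_conj, Complex.normSq_eq_norm_sq]
    congr 1
    push_cast
    ring
  have h1 := hasLineDerivAt_mul (hasLineDerivAt_conj h) h
  have h2 := (HasDerivAt.const_mul (β * Complex.I : ℂ) (x := (0 : ℝ)) h1).cexp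
  have e2 : cubicPhase β (f x) = Complex.exp ((β * Complex.I) * (conj (f x) * f x)) := congrFun e1 x
  rw [e1, HasLineDerivAt, e2]
  simpa [sqDeriv] using h2

theorem hasLineDerivAt_sqDeriv {f g : Space d → ℂ} {b c : ℂ} {x e : Space d}
    (hf : HasLineDerivAt ℝ f b x e) (hg : HasLineDerivAt ℝ g c x e) :
    HasLineDerivAt ℝ (fun y => sqDeriv (f y) (g y)) (sqDerivDeriv (f x) (g x) b c) x e :=
  HasDerivAt.fun_add (hasLineDerivAt_mul (hasLineDerivAt_conj hg) hf)
    (hasLineDerivAt_mul (hasLineDerivAt_conj hf) hg)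

theorem hasLineDerivAt_cubicPhase_mul (β : ℝ) {f : Space d → ℂ} {a : ℂ} {x e : Space d}
    (h : HasLineDerivAt ℝ f a x e) :
    HasLineDerivAt ℝ (fun y => cubicPhase β (f y) * f y)
      (cubicPhase β (f x) * cubicDeriv β (f x) a) x e := by
  have h1 := hasLineDerivAt_mul (hasLineDerivAt_cubicPhase β h) h
  convert h1 using 1
  simp only [cubicDeriv]
  ring

theorem hasLineDerivAt_cubicPhase_mul_cubicDeriv (β : ℝ) {f g : Space d → ℂ} {b c : ℂ}
    {x e : Space d} (hf : HasLineDerivAt ℝ f b x e) (hg : HasLineDerivAt ℝ g c x e) :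
    HasLineDerivAt ℝ (fun y => cubicPhase β (f y) * cubicDeriv β (f y) (g y))
      (cubicPhase β (f x) * cubicDerivDeriv β (f x) (g x) b c) x e := by
  have h0 : HasLineDerivAt ℝ (fun y => cubicDeriv β (f y) (g y))
      (c + (β * Complex.I) * (sqDerivDeriv (f x) (g x) b c * f x + sqDeriv (f x) (g x) * b)) x e :=
    HasDerivAt.fun_add hg (HasDerivAt.const_mul (β * Complex.I : ℂ) (x := (0 : ℝ))
      (hasLineDerivAt_mul (hasLineDerivAt_sqDeriv hf hg) hf))
  have h1 := hasLineDerivAt_mul (hasLineDerivAt_cubicPhase β hf) h0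
  convert h1 using 1
  simp only [cubicDerivDeriv]
  ring

/-- The map $r\mapsto e^{ir}$ is 1-Lipschitz, and $\beta|F_n|^2$ converges in $L^\infty$. -/
theorem LpTendsto.cubicPhase {F : ℕ → Space d → ℂ} {G : Space d → ℂ} (h : LpTendsto ∞ F G)
    (β : ℝ) : LpTendsto ∞ (fun n x => cubicPhase β (F n x)) (fun x => cubicPhase β (G x)) := by
  have hb : ∀ {g : Space d → ℂ}, AEStronglyMeasurable g volume →
      MemLp (fun x => CubicNLS.cubicPhase β (g x)) ∞ volume := fun hg =>
    memLp_top_of_bound ((continuous_cubicPhase β).comp_aestronglyMeasurable hg) 1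
      (Eventually.of_forall fun x => (norm_cubicPhase β _).le)
  refine ⟨fun n => hb (h.memLp n).1, hb h.memLp_limit.1, ?_⟩
  have h2 : LpTendsto ∞ (fun n x => β * (F n x * conj (F n x))) (fun x => β * (G x * conj (G x))) :=
    (h.mul le_top h.conjugate).const_mul _
  refine tendsto_of_tendsto_of_tendsto_of_le_of_le tendsto_const_nhds h2.tendsto
    (fun _ => zero_le) fun n => eLpNorm_mono fun x => ?_
  simp only [Pi.sub_apply, CubicNLS.cubicPhase]
  refine (norm_exp_sub_exp_le _ _).trans (le_of_eq ?_)
  rw [Complex.mul_conj, Complex.mul_conj, Complex.normSq_eq_norm_sq, Complex.normSq_eq_norm_sq,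
    ← Complex.ofReal_mul, ← Complex.ofReal_mul, ← Complex.ofReal_sub, Complex.norm_real,
    Real.norm_eq_abs]

/-- The chain rule for `exp (i β |u|²) u` with `u ∈ H²`. -/
theorem exists_cubicPhase_chain_rule (hd : d ∈ ({1, 2, 3} : Set ℕ)) {u : L2 d} (hu : MemH 2 u)
    (β : ℝ) :
    ∃ (z : L2 d) (zj : Fin d → L2 d) (zjk : Fin d → Fin d → L2 d),
      (z =ᵐ[volume] fun x => cubicPhase β (u x) * u x) ∧
      (∀ j, zj j =ᵐ[volume] fun x =>
        cubicPhase β (u x) * cubicDeriv β (u x) (partialDeriv j u x)) ∧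
      (∀ j k, zjk j k =ᵐ[volume] fun x => cubicPhase β (u x) * cubicDerivDeriv β (u x)
        (partialDeriv j u x) (partialDeriv k u x) (partialDeriv k (partialDeriv j u) x)) ∧
      (∀ j, HasWeakDeriv j z (zj j)) ∧ ∀ j k, HasWeakDeriv k (zj j) (zjk j k) := by
  obtain ⟨f, hf⟩ := exists_schwartzApprox hd hu
  have hT := hf.lpTendsto_top
  have hE := hT.cubicPhase β
  have g2 := fun j => lpTendsto_of_tendsto (hf.tendsto_deriv j)
  have g4 := hf.lpTendsto_four
  have h2 := fun j k => lpTendsto_of_tendsto (hf.tendsto_deriv_deriv k j)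
  have two : (1 : ℝ≥0∞) ≤ 2 := one_le_two
  have four : (1 : ℝ≥0∞) ≤ 4 := by norm_num
  -- The letters `P`, `Q`, `C`, `D` stand for `sqDeriv`, `sqDerivDeriv`, `cubicDeriv`,
  -- `cubicDerivDeriv`, and the digit is the Lebesgue exponent. The $L^4$ versions serve products of
  -- two first derivatives, which reach $L^2$ only as $L^4\cdot L^4$.
  have P2 := fun j => ((g2 j).conjugate.mul (q := ∞) two hT).add two
    (hT.conjugate.mul (q := 2) two (g2 j))
  have P4 := fun j => ((g4 j).conjugate.mul (q := ∞) four hT).add four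
    (hT.conjugate.mul (q := 4) four (g4 j))
  have Q2 := fun j k => (((h2 j k).conjugate.mul (q := ∞) two hT).add two
    ((g4 j).conjugate.mul (q := 4) two (g4 k))).add two
    (((g4 k).conjugate.mul (q := 4) two (g4 j)).add two
      (hT.conjugate.mul (q := 2) two (h2 j k)))
  have C2 := fun j => (g2 j).add two (((P2 j).mul (q := ∞) two hT).const_mul (β * Complex.I))
  have C4 := fun j => (g4 j).add four (((P4 j).mul (q := ∞) four hT).const_mul (β * Complex.I))
  have D2 := fun j k => (((P4 k).const_mul (β * Complex.I)).mul (q := 4) two (C4 j)).add two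
    ((h2 j k).add two ((((Q2 j k).mul (q := ∞) two hT).add two
      ((P4 j).mul (q := 4) two (g4 k))).const_mul (β * Complex.I)))
  have z0 := hE.mul (q := 2) two (lpTendsto_of_tendsto hf.tendsto)
  have z1 := fun j => hE.mul (q := 2) two (C2 j)
  have z2 := fun j k => hE.mul (q := 2) two (D2 j k)
  refine ⟨z0.memLp_limit.toLp _, fun j => (z1 j).memLp_limit.toLp _,
    fun j k => (z2 j k).memLp_limit.toLp _, MemLp.coeFn_toLp _, fun j => MemLp.coeFn_toLp _,
    fun j k => MemLp.coeFn_toLp _, fun j => hasWeakDeriv_of_lpTendsto z0 (z1 j) fun n x => ?_,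
    fun j k => hasWeakDeriv_of_lpTendsto (z1 j) (z2 j k) fun n x => ?_⟩
  · exact hasLineDerivAt_cubicPhase_mul β (hasLineDerivAt_schwartz (f n) x _)
  · exact hasLineDerivAt_cubicPhase_mul_cubicDeriv β (hasLineDerivAt_schwartz (f n) x _)
      (hasLineDerivAt_schwartz (∂_{coordVec j} (f n) : 𝓢(Space d, ℂ)) x _)

/-! ### Products with smooth functions of temperate growth -/

theorem smulLeftCLM_lineDerivOp {a a' : Space d → ℂ} (ha : a.HasTemperateGrowth)
    (ha' : a'.HasTemperateGrowth) {e : Space d} (h : ∀ x, HasLineDerivAt ℝ a (a' x) x e)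
    (T : 𝓢'(Space d, ℂ)) :
    ∂_{e} (TemperedDistribution.smulLeftCLM ℂ a T) =
      TemperedDistribution.smulLeftCLM ℂ a' T +
        TemperedDistribution.smulLeftCLM ℂ a (∂_{e} T) := by
  ext ψ
  have hψ : (∂_{e} (SchwartzMap.smulLeftCLM ℂ a ψ) : 𝓢(Space d, ℂ)) =
      SchwartzMap.smulLeftCLM ℂ a' ψ + SchwartzMap.smulLeftCLM ℂ a (∂_{e} ψ) := by
    ext x
    have h1 := hasLineDerivAt_mul (h x) (hasLineDerivAt_schwartz ψ x e)
    have h2 := hasLineDerivAt_schwartz (SchwartzMap.smulLeftCLM ℂ a ψ) x e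
    rw [SchwartzMap.smulLeftCLM_apply ha] at h2
    rw [add_apply, SchwartzMap.smulLeftCLM_apply_apply ha',
      SchwartzMap.smulLeftCLM_apply_apply ha]
    exact h2.unique h1
  simp only [TemperedDistribution.lineDerivOp_apply_apply, add_apply,
    TemperedDistribution.smulLeftCLM_apply_apply, map_neg, hψ, map_add]
  ring

/-- Only the sum has to be square integrable; neither product need be. This leaves room for
unbounded weights in the product rule. -/
theorem toDistribution_eq_smulLeftCLM_add {a b : Space d → ℂ} (ha : a.HasTemperateGrowth)
    (hb : b.HasTemperateGrowth) {F f g : L2 d}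
    (h : F =ᵐ[volume] fun x => a x * f x + b x * g x) :
    (F : 𝓢'(Space d, ℂ)) = TemperedDistribution.smulLeftCLM ℂ a f +
      TemperedDistribution.smulLeftCLM ℂ b g := by
  ext ψ
  have hi : ∀ (φ : 𝓢(Space d, ℂ)) (g : L2 d), Integrable (fun x => φ x • g x) := fun φ g =>
    (φ.memLp 2 volume).integrable_mul (Lp.memLp g)
  rw [add_apply]
  simp only [Lp.toTemperedDistribution_apply, TemperedDistribution.smulLeftCLM_apply_apply]
  rw [← integral_add (hi _ f) (hi _ g)]
  refine integral_congr_ae ?_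
  filter_upwards [h] with x hx
  simp only [hx, SchwartzMap.smulLeftCLM_apply_apply ha, SchwartzMap.smulLeftCLM_apply_apply hb,
    smul_eq_mul]
  ring

/-- The product rule. -/
theorem HasWeakDeriv.mul {j : Fin d} {f f' : L2 d} (h : HasWeakDeriv j f f')
    {a a' : Space d → ℂ} (ha : a.HasTemperateGrowth) (ha' : a'.HasTemperateGrowth)
    (hd : ∀ x, HasLineDerivAt ℝ a (a' x) x (coordVec j)) {F F' : L2 d}
    (hF : F =ᵐ[volume] fun x => a x * f x)
    (hF' : F' =ᵐ[volume] fun x => a' x * f x + a x * f' x) :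
    HasWeakDeriv j F F' := by
  rw [HasWeakDeriv, toDistribution_eq_smulLeftCLM ha hF,
    toDistribution_eq_smulLeftCLM_add ha' ha hF', smulLeftCLM_lineDerivOp ha ha' hd, h]

/-! ### Multiplication by coordinates and the free flow -/

/-- Testing with compactly supported smooth functions separates locally integrable functions. An
unbounded weight times an $L^2$ function is thereby recognised as an element of $L^2$. -/
theorem ae_eq_of_toDistribution_eq_smulLeftCLM {a : Space d → ℂ} (ha : a.HasTemperateGrowth)
    {F f : L2 d} (h : (F : 𝓢'(Space d, ℂ)) = TemperedDistribution.smulLeftCLM ℂ a f) :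
    F =ᵐ[volume] fun x => a x * f x := by
  have hloc : ∀ g : L2 d, LocallyIntegrable g (volume : Measure (Space d)) := fun g =>
    (Lp.memLp g).locallyIntegrable (by norm_num)
  have h2 : LocallyIntegrable (fun x => a x * f x) (volume : Measure (Space d)) :=
    (hloc f).continuous_smul ha.1.continuous
  refine ae_eq_of_integral_contDiff_smul_eq (hloc F) h2 fun ψ hψ hc => ?_
  have hψ' : ContDiff ℝ ((⊤ : ℕ∞) : WithTop ℕ∞) fun x => (ψ x : ℂ) := Complex.ofRealCLM.contDiff.comp hψ
  have hc' : HasCompactSupport fun x => (ψ x : ℂ) := hc.comp_left Complex.ofReal_zero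
  have h3 := DFunLike.congr_fun h (hc'.toSchwartzMap hψ')
  simp only [Lp.toTemperedDistribution_apply, TemperedDistribution.smulLeftCLM_apply_apply,
    SchwartzMap.smulLeftCLM_apply_apply ha, smul_eq_mul, HasCompactSupport.toSchwartzMap_toFun] at h3
  simp only [Complex.real_smul]
  refine h3.trans (integral_congr_ae (Eventually.of_forall fun x => ?_))
  simp only
  ring

theorem hasLineDerivAt_const_mul_norm_sq (c : ℝ) (j : Fin d) (x : Space d) :
    HasLineDerivAt ℝ (fun y : Space d => c * ‖y‖ ^ 2) (2 * c * x j) x (coordVec j) := by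
  have h : HasFDerivAt (fun y : Space d => ‖y‖ ^ 2) (2 • innerSL ℝ x) x :=
    (hasStrictFDerivAt_norm_sq x).hasFDerivAt
  have h1 := (h.const_mul c).hasLineDerivAt (coordVec j)
  have e : 2 * c * x j = (c • 2 • (innerSL ℝ) x) (coordVec j) := by
    simp [EuclideanSpace.inner_single_right]
    ring
  rw [e]
  exact h1

theorem hasLineDerivAt_freePhase (ε s : ℝ) (j : Fin d) (x : Space d) :
    HasLineDerivAt ℝ (freePhase d ε s) (-(s * ε * (2 * Real.pi) ^ 2 * x j)) x (coordVec j) := by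
  have e : freePhase d ε s = fun y => (-(s * (ε / 2) * (2 * Real.pi) ^ 2)) * ‖y‖ ^ 2 := by
    ext y; simp only [freePhase]; ring
  have e' : -(s * ε * (2 * Real.pi) ^ 2 * x j) =
      2 * (-(s * (ε / 2) * (2 * Real.pi) ^ 2)) * x j := by ring
  rw [e, e']
  exact hasLineDerivAt_const_mul_norm_sq _ j x

theorem hasLineDerivAt_potential (ω : ℝ) (j : Fin d) (x : Space d) :
    HasLineDerivAt ℝ (potential d ω) (ω ^ 2 * x j) x (coordVec j) := by
  have e : ω ^ 2 * x j = 2 * (1 / 2 * ω ^ 2) * x j := by ring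
  rw [e]
  exact hasLineDerivAt_const_mul_norm_sq _ j x

theorem hasLineDerivAt_phase {φ : Space d → ℝ} {φ' : ℝ} {x e : Space d}
    (h : HasLineDerivAt ℝ φ φ' x e) :
    HasLineDerivAt ℝ (fun x => Complex.exp ((φ x : ℂ) * Complex.I))
      (Complex.exp ((φ x : ℂ) * Complex.I) * (φ' * Complex.I)) x e := by
  have h1 := ((HasDerivAt.ofReal_comp h).mul_const Complex.I).cexp
  simpa [HasLineDerivAt] using h1

theorem hasTemperateGrowth_coord (j : Fin d) :
    (fun x : Space d => ((x j : ℝ) : ℂ)).HasTemperateGrowth := by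
  have : (fun x : Space d => ((x j : ℝ) : ℂ)) =
      Complex.ofRealCLM ∘L (EuclideanSpace.proj j : Space d →L[ℝ] ℝ) := rfl
  rw [this]
  exact ContinuousLinearMap.hasTemperateGrowth _

theorem inner_coordVec (j : Fin d) (x : Space d) : inner ℝ x (coordVec j) = x j := by
  simp [EuclideanSpace.inner_single_right]

/-- The commutator of a coordinate with the free flow. -/
theorem smulLeftCLM_coord_multiplier (ε s : ℝ) (j : Fin d) (T : 𝓢'(Space d, ℂ)) :
    TemperedDistribution.smulLeftCLM ℂ (fun x : Space d => ((x j : ℝ) : ℂ))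
      (TemperedDistribution.fourierMultiplierCLM ℂ
        (fun ξ => Complex.exp ((freePhase d ε s ξ : ℂ) * Complex.I)) T) =
    TemperedDistribution.fourierMultiplierCLM ℂ
        (fun ξ => Complex.exp ((freePhase d ε s ξ : ℂ) * Complex.I))
      (TemperedDistribution.smulLeftCLM ℂ (fun x : Space d => ((x j : ℝ) : ℂ)) T +
        (-(s * ε * Complex.I) : ℂ) • ∂_{coordVec j} T) := by
  set m : Space d → ℂ := fun ξ => Complex.exp ((freePhase d ε s ξ : ℂ) * Complex.I) with hm_def
  have hm : m.HasTemperateGrowth := hasTemperateGrowth_phase (hasTemperateGrowth_freePhase ε s)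
  have hx := hasTemperateGrowth_coord j
  set X : Space d → ℂ := fun x => ((x j : ℝ) : ℂ) with hX
  set q : ℂ := 2 * Real.pi * Complex.I with hq
  have hq0 : q ≠ 0 := Complex.two_pi_I_ne_zero
  have hXi : (fun x : Space d => ((inner ℝ x (coordVec j) : ℝ) : ℂ)) = X := by
    ext x; rw [inner_coordVec]
  have hmX : (m * X).HasTemperateGrowth := hm.mul hx
  -- Since $q=2\pi i$, the factor $q^2=-(2\pi)^2$ absorbs the sign of the phase derivative.
  have hm' : ∀ x, HasLineDerivAt ℝ m (((s * ε * Complex.I * q ^ 2) • (m * X)) x) x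
      (coordVec j) := by
    intro x
    convert hasLineDerivAt_phase (hasLineDerivAt_freePhase ε s j x) using 1
    simp only [Pi.smul_apply, Pi.mul_apply, smul_eq_mul, hm_def, hX, hq]
    push_cast
    linear_combination (Complex.exp ((freePhase d ε s x : ℂ) * Complex.I) * 4 * Real.pi ^ 2 * s *
      ε * Complex.I * (x j : ℂ)) * Complex.I_sq
  -- Multiplication by $x_j$ corresponds to differentiating $m\,\mathcal F T$. By Leibniz, the
  -- derivative of $\mathcal FT$ returns $x_jT$, and the derivative of $m$ brings down $\xi_j$, that
  -- is $\partial_jT$.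
  have h1 := TemperedDistribution.fourierInv_lineDerivOp_eq
    (TemperedDistribution.smulLeftCLM ℂ m (𝓕 T)) (coordVec j)
  have h2 := TemperedDistribution.lineDerivOp_fourier_eq T (coordVec j)
  have h3 := TemperedDistribution.fourier_lineDerivOp_eq T (coordVec j)
  rw [hXi, ← hq] at h1 h2 h3
  have hcmX : ((s * ε * Complex.I * q ^ 2 : ℂ) • (m * X)).HasTemperateGrowth :=
    (Function.HasTemperateGrowth.const (s * ε * Complex.I * q ^ 2 : ℂ)).mul hmX
  have h4 : TemperedDistribution.smulLeftCLM ℂ X (𝓕 T) = q⁻¹ • 𝓕 (∂_{coordVec j} T) := by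
    rw [h3, smul_smul, inv_mul_cancel₀ hq0, one_smul]
  rw [smulLeftCLM_lineDerivOp hm hcmX hm', TemperedDistribution.smulLeftCLM_smul hmX, h2,
    mul_comm m X, smul_apply,
    ← TemperedDistribution.smulLeftCLM_smulLeftCLM_apply hx hm, h4] at h1
  simp only [TemperedDistribution.fourierMultiplierCLM_apply]
  rw [← smul_right_injective _ (neg_ne_zero.2 hq0) |>.eq_iff]
  refine h1.symm.trans ?_
  simp only [map_smul, FourierTransform.fourier_smul, FourierTransform.fourierInv_smul,
    FourierTransform.fourierInv_add, FourierTransform.fourier_add, map_add, smul_add, smul_smul]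
  rw [add_comm]
  congr 2
  field_simp

/-- The identity `x_j e^{isεΔ/2} f = e^{isεΔ/2} (x_j f - i s ε ∂_j f)`, with `x_j` scaled by `κ`. -/
theorem coord_mul_flowA (κ ε s : ℝ) {j : Fin d} {f f' X : L2 d} (h : HasWeakDeriv j f f')
    (hX : X =ᵐ[volume] fun x => ((κ * x j : ℝ) : ℂ) * f x) :
    flowA ε s X + (-(κ * s * ε * Complex.I) : ℂ) • flowA ε s f' =ᵐ[volume]
      fun x => ((κ * x j : ℝ) : ℂ) * flowA ε s f x := by
  have e : (fun x : Space d => ((κ * x j : ℝ) : ℂ)) =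
      (κ : ℂ) • fun x : Space d => ((x j : ℝ) : ℂ) := by
    ext x; simp
  have hg := hasTemperateGrowth_coord (d := d) j
  have hκ : (fun x : Space d => ((κ * x j : ℝ) : ℂ)).HasTemperateGrowth := by
    rw [e]; exact (Function.HasTemperateGrowth.const (κ : ℂ)).mul hg
  refine ae_eq_of_toDistribution_eq_smulLeftCLM hκ ?_
  have h1 := toDistribution_eq_smulLeftCLM hκ hX
  rw [e, TemperedDistribution.smulLeftCLM_smul hg, smul_apply] at h1 ⊢
  rw [flowA_toDistribution, smulLeftCLM_coord_multiplier, toDistribution_add, toDistribution_smul,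
    flowA_toDistribution, flowA_toDistribution, h1, ← h]
  simp only [map_smul, map_add, smul_add, smul_smul]
  congr 2
  ring

/-! ### Integration by parts and weighted first derivatives -/

theorem inner_toLp_lineDerivOp {j : Fin d} {g g' : L2 d} (h : HasWeakDeriv j g g')
    (ψ : 𝓢(Space d, ℂ)) :
    inner ℂ ((∂_{coordVec j} ψ : 𝓢(Space d, ℂ)).toLp 2 volume) g =
      -inner ℂ (ψ.toLp 2 volume) g' := by
  -- The test function is conjugated because the inner product is antilinear in its first argument.
  set φ : 𝓢(Space d, ℂ) := SchwartzMap.postcompCLM (Complex.conjCLE : ℂ →L[ℝ] ℂ) ψ with hφ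
  have h1 : ∀ x, φ x = conj (ψ x) := fun x => by simp [hφ]
  have h2 : ∀ x, (∂_{coordVec j} φ : 𝓢(Space d, ℂ)) x =
      conj ((∂_{coordVec j} ψ : 𝓢(Space d, ℂ)) x) := fun x => by
    have h3 := hasLineDerivAt_schwartz φ x (coordVec j)
    have h4 := hasLineDerivAt_conj (hasLineDerivAt_schwartz ψ x (coordVec j))
    have h5 : (φ : Space d → ℂ) = fun y => conj (ψ y) := funext h1
    rw [h5] at h3
    exact h3.unique h4
  have h6 := hasWeakDeriv_iff.1 h φ
  simp only [h1, h2] at h6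
  rw [L2.inner_def, L2.inner_def]
  refine (integral_congr_ae ?_).trans (h6.trans (congrArg Neg.neg (integral_congr_ae ?_)))
  · filter_upwards [SchwartzMap.coeFn_toLp (∂_{coordVec j} ψ : 𝓢(Space d, ℂ)) 2 volume] with x hx
    rw [hx, RCLike.inner_apply, mul_comm]
  · filter_upwards [SchwartzMap.coeFn_toLp ψ 2 volume] with x hx
    rw [hx, RCLike.inner_apply, mul_comm]

theorem inner_partialDeriv {j : Fin d} {u g g' : L2 d} (hu : MemH 2 u) (h : HasWeakDeriv j g g') :
    inner ℂ (partialDeriv j u) g = -inner ℂ u g' := by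
  obtain ⟨ψ, h0, h1, -⟩ := hu.exists_schwartz_tendsto
  refine tendsto_nhds_unique (((h1 j).inner tendsto_const_nhds).congr fun n => ?_)
    (h0.inner (tendsto_const_nhds (x := g'))).neg
  exact inner_toLp_lineDerivOp h (ψ n)

/-! ### Truncated coordinates -/

/-- A bounded smooth approximation of the coordinate `x_j`. -/
def sinCoord (δ : ℝ) (j : Fin d) (x : Space d) : ℝ := Real.sin (δ * x j) / δ

theorem hasTemperateGrowth_linear_phase (δ : ℝ) (j : Fin d) :
    (fun x : Space d => Complex.exp (((δ * x j : ℝ) : ℂ) * Complex.I)).HasTemperateGrowth := by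
  have h : (fun x : Space d => x j) = (EuclideanSpace.proj j : Space d →L[ℝ] ℝ) := rfl
  have h' : (fun x : Space d => x j).HasTemperateGrowth := by
    rw [h]; exact ContinuousLinearMap.hasTemperateGrowth _
  exact hasTemperateGrowth_phase ((Function.HasTemperateGrowth.const δ).mul h')

theorem hasTemperateGrowth_sinCoord (δ : ℝ) (j : Fin d) :
    (fun x : Space d => (sinCoord δ j x : ℂ)).HasTemperateGrowth := by
  have h : (fun x : Space d => (sinCoord δ j x : ℂ)) = fun x =>
      (Complex.exp (((-δ * x j : ℝ) : ℂ) * Complex.I) -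
        Complex.exp (((δ * x j : ℝ) : ℂ) * Complex.I)) * (Complex.I / 2 / δ) := by
    ext x
    rw [sinCoord, Complex.ofReal_div, Complex.ofReal_sin, Complex.sin]
    push_cast
    ring_nf
  rw [h]
  exact ((hasTemperateGrowth_linear_phase (-δ) j).sub (hasTemperateGrowth_linear_phase δ j)).mul
    (Function.HasTemperateGrowth.const _)

theorem hasTemperateGrowth_cos_coord (δ : ℝ) (j : Fin d) :
    (fun x : Space d => (Real.cos (δ * x j) : ℂ)).HasTemperateGrowth := by
  have h : (fun x : Space d => (Real.cos (δ * x j) : ℂ)) = fun x =>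
      (Complex.exp (((δ * x j : ℝ) : ℂ) * Complex.I) +
        Complex.exp (((-δ * x j : ℝ) : ℂ) * Complex.I)) * (1 / 2) := by
    ext x
    rw [Complex.ofReal_cos, Complex.cos]
    push_cast
    ring_nf
  rw [h]
  exact ((hasTemperateGrowth_linear_phase δ j).add (hasTemperateGrowth_linear_phase (-δ) j)).mul
    (Function.HasTemperateGrowth.const _)

theorem hasLineDerivAt_coord (j k : Fin d) (x : Space d) :
    HasLineDerivAt ℝ (fun y : Space d => y j) (if j = k then 1 else 0) x (coordVec k) := by
  have h := ((EuclideanSpace.proj j : Space d →L[ℝ] ℝ).hasFDerivAt (x := x)).hasLineDerivAt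
    (coordVec k)
  have e : (EuclideanSpace.proj j : Space d →L[ℝ] ℝ) (coordVec k) = if j = k then 1 else 0 := by
    simp
  rw [e] at h
  exact h

theorem hasLineDerivAt_sinCoord {δ : ℝ} (hδ : δ ≠ 0) (j k : Fin d) (x : Space d) :
    HasLineDerivAt ℝ (fun y => (sinCoord δ j y : ℂ))
      ((Real.cos (δ * x j) : ℂ) * (if j = k then 1 else 0)) x (coordVec k) := by
  have h := (((HasDerivAt.const_mul δ (hasLineDerivAt_coord j k x)).sin).div_const δ).ofReal_comp
  have e : ((Real.cos (δ * x j) : ℂ) * (if j = k then 1 else 0)) =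
      ((Real.cos (δ * (x + (0 : ℝ) • coordVec k) j) * (δ * (if j = k then 1 else 0)) / δ : ℝ) : ℂ) := by
    split_ifs <;> simp [hδ]
  rw [e]
  exact h

theorem abs_sinCoord_le (δ : ℝ) (j : Fin d) (x : Space d) : |sinCoord δ j x| ≤ |x j| := by
  rcases eq_or_ne δ 0 with rfl | hδ
  · simp [sinCoord]
  rw [sinCoord, abs_div, div_le_iff₀ (abs_pos.2 hδ), mul_comm, ← abs_mul]
  exact Real.abs_sin_le_abs

theorem tendsto_sinCoord (j : Fin d) (x : Space d) :
    Tendsto (fun n : ℕ => sinCoord (1 / (n + 1 : ℝ)) j x) atTop (𝓝 (x j)) := by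
  have h1 : HasDerivAt (fun δ : ℝ => Real.sin (δ * x j)) (x j) 0 := by
    simpa using (HasDerivAt.mul_const (hasDerivAt_id (0 : ℝ)) (x j)).sin
  have h2 := h1.tendsto_slope_zero
  have h3 : Tendsto (fun n : ℕ => 1 / ((n : ℝ) + 1)) atTop (𝓝[≠] 0) :=
    tendsto_nhdsWithin_iff.2 ⟨tendsto_one_div_add_atTop_nhds_zero_nat,
      Eventually.of_forall fun n => by simp; positivity⟩
  refine (h2.comp h3).congr fun n => ?_
  simp [sinCoord, div_eq_inv_mul]

theorem exists_toL2_mul {a : Space d → ℂ} (ha : AEStronglyMeasurable a volume) {C : ℝ} (hC : ∀ x, ‖a x‖ ≤ C)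
    (f : L2 d) : ∃ F : L2 d, F =ᵐ[volume] fun x => a x * f x := by
  have h : MemLp (fun x => a x * f x) 2 volume :=
    (Lp.memLp f).of_le_mul (ha.mul (Lp.aestronglyMeasurable f)) (c := C)
      (Eventually.of_forall fun x => by
        rw [norm_mul]; exact mul_le_mul_of_nonneg_right (hC x) (norm_nonneg _))
  exact ⟨h.toLp, h.coeFn_toLp⟩

theorem norm_le_mul_norm_of_ae {a : Space d → ℂ} {C : ℝ} {F f : L2 d}
    (h : F =ᵐ[volume] fun x => a x * f x) (hC : ∀ x, ‖a x‖ ≤ C) : ‖F‖ ≤ C * ‖f‖ := by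
  refine Lp.norm_le_mul_norm_of_ae_le_mul ?_
  filter_upwards [h] with x hx
  rw [hx, norm_mul]
  exact mul_le_mul_of_nonneg_right (hC x) (norm_nonneg _)

theorem inner_eq_of_ae {f g f' g' : L2 d}
    (h : ∀ᵐ x, g x * conj (f x) = g' x * conj (f' x)) : inner ℂ f g = inner ℂ f' g' := by
  rw [L2.inner_def, L2.inner_def]
  refine integral_congr_ae ?_
  filter_upwards [h] with x hx
  rw [RCLike.inner_apply, RCLike.inner_apply]
  exact hx

/-- If $n>a+p+q$, then $n$ and $n-a$ both exceed $p+q$, so $n(n-a)>(p+q)^2\ge pq$. This absorbs the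
term in which the derivative falls on the weight. -/
theorem norm_le_of_sq_le {n a p q : ℝ} (hn : 0 ≤ n) (hp : 0 ≤ p) (hq : 0 ≤ q) (ha : 0 ≤ a)
    (h : n ^ 2 ≤ a * n + p * q) : n ≤ a + p + q := by
  by_contra! hc
  nlinarith [mul_nonneg hp hq, mul_nonneg ha hp, mul_nonneg ha hq]

/-- The weighted bound of a first derivative, with a bounded weight `b`. -/
theorem norm_bounded_weight_mul_partialDeriv_le {u X : L2 d} (hu : MemH 2 u) (k : Fin d)
    {b b' : Space d → ℝ} {C κ : ℝ} (hκ : 0 ≤ κ)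
    (hb : (fun x => (b x : ℂ)).HasTemperateGrowth)
    (hb' : (fun x => (b' x : ℂ)).HasTemperateGrowth)
    (hd : ∀ x, HasLineDerivAt ℝ (fun x => (b x : ℂ)) (b' x : ℂ) x (coordVec k))
    (hC : ∀ x, |b x| ≤ C) (hC' : ∀ x, |b' x| ≤ κ)
    (hX : ∀ᵐ x, b x ^ 2 * ‖u x‖ ≤ ‖X x‖) {B : L2 d}
    (hB : B =ᵐ[volume] fun x => (b x : ℂ) * partialDeriv k u x) :
    ‖B‖ ≤ 2 * κ * ‖u‖ + ‖X‖ + ‖partialDeriv k (partialDeriv k u)‖ := by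
  have hn : ∀ x, ‖(b x : ℂ)‖ ≤ C := fun x => by rw [Complex.norm_real]; exact hC x
  have hn' : ∀ x, ‖(b' x : ℂ)‖ ≤ κ := fun x => by rw [Complex.norm_real]; exact hC' x
  have hcb := hb.1.continuous.aestronglyMeasurable (μ := volume)
  have hcb' := hb'.1.continuous.aestronglyMeasurable (μ := volume)
  have hC0 : ∀ x : Space d, 0 ≤ C := fun x => (abs_nonneg _).trans (hC x)
  have hnn : ∀ x, ‖(b x : ℂ) * (b x : ℂ)‖ ≤ C * C := fun x => by
    rw [norm_mul]; exact mul_le_mul (hn x) (hn x) (norm_nonneg _) (hC0 x)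
  obtain ⟨G, hG⟩ := exists_toL2_mul (a := fun x => (b x : ℂ) * b x) (hcb.mul hcb) hnn (partialDeriv k u)
  obtain ⟨P, hP⟩ := exists_toL2_mul (a := fun x => (b' x : ℂ) * b x + b x * b' x) (C := κ * C + C * κ)
    ((hcb'.mul hcb).add (hcb.mul hcb')) (fun x => by
      refine (norm_add_le _ _).trans (add_le_add ?_ ?_)
      · rw [norm_mul]; exact mul_le_mul (hn' x) (hn x) (norm_nonneg _) hκ
      · rw [norm_mul]; exact mul_le_mul (hn x) (hn' x) (norm_nonneg _) (hC0 x))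
    (partialDeriv k u)
  obtain ⟨P', hP'⟩ := exists_toL2_mul (a := fun x => (b x : ℂ) * b x) (hcb.mul hcb) hnn (partialDeriv k (partialDeriv k u))
  obtain ⟨D, hD⟩ := exists_toL2_mul (a := fun x => 2 * (b' x : ℂ)) (C := 2 * κ)
    (aestronglyMeasurable_const.mul hcb') (fun x => by
      rw [norm_mul, Complex.norm_two]; exact mul_le_mul_of_nonneg_left (hn' x) two_pos.le) u
  obtain ⟨Q, hQ⟩ := exists_toL2_mul (a := fun x => (b x : ℂ) * b x) (hcb.mul hcb) hnn u
  have hW : HasWeakDeriv k G (P + P') := by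
    refine (MemH.hasWeakDeriv (hu.partialDeriv k) k).mul (hb.mul hb)
      ((hb'.mul hb).add (hb.mul hb')) (fun x => hasLineDerivAt_mul (hd x) (hd x)) hG ?_
    filter_upwards [hP, hP', Lp.coeFn_add P P'] with x h1 h2 h3
    rw [h3, Pi.add_apply, h1, h2]
    rfl
  -- The identity $\|b\,\partial_ku\|^2=-\langle2b'u,\,b\,\partial_ku\rangle-\langle
  -- b^2u,\,\partial_k^2u\rangle$; boundedness of $b$ puts $b^2\partial_ku$ in $L^2$.
  have key := inner_partialDeriv hu hW
  have e1 : inner ℂ (partialDeriv k u) G = inner ℂ B B := by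
    refine inner_eq_of_ae ?_
    filter_upwards [hG, hB] with x h1 h2
    rw [h1, h2, map_mul, Complex.conj_ofReal]
    ring
  have e2 : inner ℂ u P = inner ℂ D B := by
    refine inner_eq_of_ae ?_
    filter_upwards [hP, hB, hD] with x h1 h2 h3
    rw [h1, h2, h3, map_mul, map_mul, Complex.conj_ofReal, Complex.conj_ofNat]
    ring
  have e3 : inner ℂ u P' = inner ℂ Q (partialDeriv k (partialDeriv k u)) := by
    refine inner_eq_of_ae ?_
    filter_upwards [hP', hQ] with x h1 h2
    rw [h1, h2, map_mul, map_mul, Complex.conj_ofReal]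
    ring
  have hDn : ‖D‖ ≤ 2 * κ * ‖u‖ := norm_le_mul_norm_of_ae hD fun x => by
    rw [norm_mul, Complex.norm_two]; exact mul_le_mul_of_nonneg_left (hn' x) two_pos.le
  have hQn : ‖Q‖ ≤ ‖X‖ := by
    refine Lp.norm_le_norm_of_ae_le ?_
    filter_upwards [hQ, hX] with x h1 h2
    rw [h1, norm_mul, norm_mul, Complex.norm_real, Real.norm_eq_abs, abs_mul_abs_self, ← sq]
    exact h2
  refine norm_le_of_sq_le (norm_nonneg _) (norm_nonneg _) (norm_nonneg _) (by positivity) ?_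
  rw [inner_add_right, e1, e2, e3] at key
  have h5 : ‖B‖ ^ 2 = ‖inner ℂ B B‖ := by
    rw [inner_self_eq_norm_sq_to_K]; simp
  rw [h5, key, norm_neg]
  refine (norm_add_le _ _).trans (add_le_add ?_ ?_)
  · exact (norm_inner_le_norm _ _).trans (mul_le_mul_of_nonneg_right hDn (norm_nonneg _))
  · exact (norm_inner_le_norm _ _).trans (mul_le_mul_of_nonneg_right hQn (norm_nonneg _))

/-- If `u ∈ H²` and `κ² x_j² u ∈ L²`, then `κ x_j ∂_k u ∈ L²`. -/
theorem exists_coord_mul_partialDeriv {u X : L2 d} (hu : MemH 2 u) (j k : Fin d) {κ : ℝ}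
    (hκ : 0 ≤ κ) (hX : ∀ᵐ x, (κ * x j) ^ 2 * ‖u x‖ ≤ ‖X x‖) :
    ∃ Y : L2 d, (Y =ᵐ[volume] fun x => ((κ * x j : ℝ) : ℂ) * partialDeriv k u x) ∧
      ‖Y‖ ≤ 2 * κ * ‖u‖ + ‖X‖ + ‖partialDeriv k (partialDeriv k u)‖ := by
  -- The weights $\kappa\sin(\delta_nx_j)/\delta_n$ are bounded, dominated by $\kappa|x_j|$, and
  -- have slope at most $\kappa$. The bound is therefore uniform in $n$, and Fatou's lemma removes
  -- the truncation.
  set δ : ℕ → ℝ := fun n => 1 / (n + 1 : ℝ) with hδ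
  have hδ0 : ∀ n, 0 < δ n := fun n => by simp only [hδ]; positivity
  set R := 2 * κ * ‖u‖ + ‖X‖ + ‖partialDeriv k (partialDeriv k u)‖ with hR
  have hR0 : 0 ≤ R := by positivity
  have hbd : ∀ n x, ‖((κ * sinCoord (δ n) j x : ℝ) : ℂ)‖ ≤ κ * (1 / δ n) := fun n x => by
    rw [Complex.norm_real, Real.norm_eq_abs, abs_mul, abs_of_nonneg hκ, sinCoord, abs_div,
      abs_of_pos (hδ0 n)]
    exact mul_le_mul_of_nonneg_left
      (div_le_div_of_nonneg_right (Real.abs_sin_le_one _) (hδ0 n).le) hκ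
  have hgr : ∀ n, (fun x : Space d => ((κ * sinCoord (δ n) j x : ℝ) : ℂ)).HasTemperateGrowth := by
    intro n
    simp only [Complex.ofReal_mul]
    exact (Function.HasTemperateGrowth.const (κ : ℂ)).mul (hasTemperateGrowth_sinCoord (δ n) j)
  choose B hB using fun n => exists_toL2_mul (hgr n).1.continuous.aestronglyMeasurable (hbd n) (partialDeriv k u)
  have hite : ((if j = k then 1 else 0 : ℝ) : ℂ) = if j = k then 1 else 0 := by
    split_ifs <;> simp
  have hBn : ∀ n, ‖B n‖ ≤ R := by
    intro n
    refine norm_bounded_weight_mul_partialDeriv_le hu k (C := κ * (1 / δ n))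
      (b' := fun x => κ * (Real.cos (δ n * x j) * (if j = k then 1 else 0))) hκ (hgr n) ?_ ?_
      (fun x => ?_) (fun x => ?_) ?_ (hB n)
    · have h1 : (fun x : Space d => ((κ * (Real.cos (δ n * x j) * (if j = k then 1 else 0)) : ℝ) : ℂ))
          = fun x => (κ : ℂ) * ((Real.cos (δ n * x j) : ℂ) * (if j = k then 1 else 0)) := by
        ext x; rw [← hite]; push_cast; rfl
      rw [h1]
      exact (Function.HasTemperateGrowth.const _).mul
        ((hasTemperateGrowth_cos_coord (δ n) j).mul (Function.HasTemperateGrowth.const _))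
    · intro x
      have h1 := HasDerivAt.const_mul (κ : ℂ) (hasLineDerivAt_sinCoord (hδ0 n).ne' j k x)
      simp only [HasLineDerivAt]
      rw [← hite] at h1
      push_cast at h1 ⊢
      exact h1
    · have := hbd n x
      rwa [Complex.norm_real] at this
    · rw [abs_mul, abs_of_nonneg hκ]
      refine mul_le_of_le_one_right hκ ?_
      rw [abs_mul]
      refine mul_le_one₀ (Real.abs_cos_le_one _) (abs_nonneg _) ?_
      split_ifs <;> simp
    · filter_upwards [hX] with x hx
      refine le_trans (mul_le_mul_of_nonneg_right ?_ (norm_nonneg _)) hx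
      rw [mul_pow, mul_pow]
      exact mul_le_mul_of_nonneg_left (sq_le_sq.2 (abs_sinCoord_le _ _ _)) (sq_nonneg _)
  set F : Space d → ℂ := fun x => ((κ * x j : ℝ) : ℂ) * partialDeriv k u x with hF
  have hlim : ∀ᵐ x, Tendsto (fun n => B n x) atTop (𝓝 (F x)) := by
    filter_upwards [ae_all_iff.2 hB] with x hx
    simp only [hx]
    exact ((Complex.continuous_ofReal.tendsto _).comp
      ((tendsto_sinCoord j x).const_mul κ)).mul_const _
  have hle : eLpNorm F 2 volume ≤ ENNReal.ofReal R := by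
    refine (Lp.eLpNorm_lim_le_liminf_eLpNorm (fun n => Lp.aestronglyMeasurable (B n)) F hlim).trans ?_
    refine (liminf_le_liminf (Eventually.of_forall fun n => ?_)).trans
      (le_of_eq (liminf_const (ENNReal.ofReal R)))
    rw [← Lp.enorm_def, ← ofReal_norm]
    exact ENNReal.ofReal_le_ofReal (hBn n)
  have hm : AEStronglyMeasurable F volume :=
    aestronglyMeasurable_of_tendsto_ae atTop (fun n => Lp.aestronglyMeasurable (B n)) hlim
  have hmem : MemLp F 2 volume := ⟨hm, hle.trans_lt ENNReal.ofReal_lt_top⟩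
  refine ⟨hmem.toLp, hmem.coeFn_toLp, ?_⟩
  rw [Lp.norm_toLp]
  exact ENNReal.toReal_le_of_le_ofReal hR0 hle

/-! ### Weighted norms along the free flow -/

theorem hasTemperateGrowth_const_mul_coord (κ : ℝ) (j : Fin d) :
    (fun x : Space d => ((κ * x j : ℝ) : ℂ)).HasTemperateGrowth := by
  simp only [Complex.ofReal_mul]
  exact (Function.HasTemperateGrowth.const (κ : ℂ)).mul (hasTemperateGrowth_coord j)

theorem HasWeakDeriv.coord_mul {κ : ℝ} {j k : Fin d} {f f' X X' : L2 d} (h : HasWeakDeriv k f f')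
    (hX : X =ᵐ[volume] fun x => ((κ * x j : ℝ) : ℂ) * f x)
    (hX' : X' =ᵐ[volume] fun x => ((κ * x j : ℝ) : ℂ) * f' x) :
    HasWeakDeriv k X ((if j = k then (κ : ℂ) else 0) • f + X') := by
  refine h.mul (hasTemperateGrowth_const_mul_coord κ j)
    (a' := fun _ => if j = k then (κ : ℂ) else 0) (Function.HasTemperateGrowth.const _)
    (fun x => ?_) hX ?_
  · have h1 := (HasDerivAt.const_mul κ (hasLineDerivAt_coord j k x)).ofReal_comp
    have e : (if j = k then (κ : ℂ) else 0) = ((κ * (if j = k then 1 else 0) : ℝ) : ℂ) := by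
      split_ifs <;> simp
    rw [e]
    exact h1
  · filter_upwards [Lp.coeFn_add ((if j = k then (κ : ℂ) else 0) • f) X',
      Lp.coeFn_smul (if j = k then (κ : ℂ) else 0) f, hX'] with x h1 h2 h3
    rw [h1, Pi.add_apply, h2, h3, Pi.smul_apply, smul_eq_mul]

/-- The commutator identity and the isometry of the flow. The factor $s\varepsilon$ later cancels
one $1/\varepsilon$. -/
theorem exists_coord_mul_flowA {κ ε s : ℝ} (hκ : 0 ≤ κ) (hs : 0 ≤ s * ε) {j : Fin d}
    {f f' X : L2 d} (h : HasWeakDeriv j f f')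
    (hX : X =ᵐ[volume] fun x => ((κ * x j : ℝ) : ℂ) * f x) :
    ∃ Y : L2 d, (Y =ᵐ[volume] fun x => ((κ * x j : ℝ) : ℂ) * flowA ε s f x) ∧
      ‖Y‖ ≤ ‖X‖ + κ * (s * ε) * ‖f'‖ := by
  refine ⟨_, coord_mul_flowA κ ε s h hX, (norm_add_le _ _).trans ?_⟩
  rw [norm_smul, norm_flowA, norm_flowA, norm_neg, norm_mul, Complex.norm_I, mul_one, mul_assoc,
    ← Complex.ofReal_mul, ← Complex.ofReal_mul, Complex.norm_real, Real.norm_eq_abs,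
    abs_of_nonneg (mul_nonneg hκ hs)]

theorem normL2_eq_norm {F : Type*} [NormedAddCommGroup F] {f : Space d → F}
    (h : MemLp f 2 volume) : normL2 f = ‖h.toLp f‖ := (Lp.norm_toLp f h).symm

/-- A function that is dominated by square integrable functions is square integrable. -/
theorem exists_toL2_of_le {F : Space d → ℂ} (hF : AEStronglyMeasurable F volume) {r : Space d → ℝ}
    (hr : MemLp r 2 volume) (h : ∀ᵐ x, ‖F x‖ ≤ r x) :
    ∃ f : L2 d, f =ᵐ[volume] F :=
  have h1 : MemLp F 2 volume := hr.mono' hF h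
  ⟨h1.toLp, h1.coeFn_toLp⟩

theorem gradient_potential (ω : ℝ) (x : Space d) (j : Fin d) :
    gradient (potential d ω) x j = ω ^ 2 * x j := by
  have hd : DifferentiableAt ℝ (potential d ω) x :=
    ((hasTemperateGrowth_potential ω).1.differentiable (by simp)) x
  have h1 := hd.hasGradientAt.hasFDerivAt.hasLineDerivAt (coordVec j)
  have h2 := h1.unique (hasLineDerivAt_potential ω j x)
  rw [InnerProductSpace.toDual_apply_apply, EuclideanSpace.inner_single_right] at h2
  simpa using h2

/-- The vector field `(∇U) u` controls the products `ω² x_j u`. -/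
theorem exists_coord_mul_of_gradPotMul {ω : ℝ} {u : L2 d}
    (hu : MemLp (gradPotMul ω u) 2 volume) (j : Fin d) :
    ∃ X : L2 d, (X =ᵐ[volume] fun x => ((ω ^ 2 * x j : ℝ) : ℂ) * u x) ∧
      ‖X‖ ≤ normL2 (gradPotMul ω u) := by
  have hm : AEStronglyMeasurable (fun x => ((ω ^ 2 * x j : ℝ) : ℂ) * u x) volume :=
    (hasTemperateGrowth_const_mul_coord (ω ^ 2) j).1.continuous.aestronglyMeasurable.mul
      (Lp.aestronglyMeasurable u)
  have hle : ∀ x, ‖((ω ^ 2 * x j : ℝ) : ℂ) * u x‖ ≤ ‖gradPotMul ω u x‖ := fun x => by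
    have h := PiLp.norm_apply_le (gradPotMul ω u x) j
    simpa only [gradPotMul, gradient_potential] using h
  obtain ⟨X, hX⟩ := exists_toL2_of_le hm hu.norm (Eventually.of_forall hle)
  refine ⟨X, hX, ?_⟩
  rw [normL2_eq_norm hu]
  refine Lp.norm_le_norm_of_ae_le ?_
  filter_upwards [hX, hu.coeFn_toLp] with x h1 h2
  rw [h1, h2]
  exact hle x

theorem sq_coord_le (x : Space d) (j : Fin d) : x j ^ 2 ≤ ‖x‖ ^ 2 := by
  rw [EuclideanSpace.norm_sq_eq]
  refine le_trans ?_ (Finset.single_le_sum (f := fun i => ‖x i‖ ^ 2) (fun _ _ => by positivity)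
    (Finset.mem_univ j))
  simp

theorem abs_coord_mul_coord_le (κ : ℝ) (x : Space d) (j k : Fin d) :
    |κ * x j * (κ * x k)| ≤ κ ^ 2 * ‖x‖ ^ 2 := by
  have h1 := sq_coord_le x j
  have h2 := sq_coord_le x k
  rw [show κ * x j * (κ * x k) = κ ^ 2 * (x j * x k) by ring, abs_mul, abs_of_nonneg (sq_nonneg κ)]
  refine mul_le_mul_of_nonneg_left ?_ (sq_nonneg κ)
  rw [abs_le]
  constructor <;> nlinarith [sq_nonneg (x j + x k), sq_nonneg (x j - x k)]

theorem norm_potMul (ω : ℝ) (u : L2 d) (x : Space d) :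
    ω ^ 2 * ‖potMul ω u x‖ * 2 = (ω ^ 2) ^ 2 * ‖x‖ ^ 2 * ‖u x‖ := by
  rw [potMul, norm_mul, Complex.norm_real, potential, Real.norm_eq_abs,
    abs_of_nonneg (by positivity)]
  ring

/-- The product `U u` controls the products `ω² x_j u`. -/
theorem exists_coord_mul_of_potMul {ω : ℝ} {u : L2 d} (hu : MemLp (potMul ω u) 2 volume)
    (j : Fin d) :
    ∃ X : L2 d, (X =ᵐ[volume] fun x => ((ω ^ 2 * x j : ℝ) : ℂ) * u x) ∧
      ‖X‖ ≤ ω ^ 2 * normL2 (potMul ω u) + ‖u‖ := by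
  have hm : AEStronglyMeasurable (fun x => ((ω ^ 2 * x j : ℝ) : ℂ) * u x) volume :=
    (hasTemperateGrowth_const_mul_coord (ω ^ 2) j).1.continuous.aestronglyMeasurable.mul
      (Lp.aestronglyMeasurable u)
  have hle : ∀ x, ‖((ω ^ 2 * x j : ℝ) : ℂ) * u x‖ ≤ ω ^ 2 * ‖potMul ω u x‖ + ‖u x‖ := fun x => by
    have h1 := norm_potMul ω u x
    have h2 := abs_coord_mul_coord_le (ω ^ 2) x j j
    rw [norm_mul, Complex.norm_real, Real.norm_eq_abs]
    -- From $|y|\le(y^2+1)/2$; the quadratic part is $\omega^2U$. Keeping the scale $\omega^2x_j$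
    -- avoids division by $\omega$, so $\omega=0$ is included.
    have h3 : |ω ^ 2 * x j| ≤ ((ω ^ 2) ^ 2 * ‖x‖ ^ 2) / 2 + 1 := by
      rw [abs_mul_self] at h2
      rw [abs_le]
      constructor <;> nlinarith [sq_nonneg (ω ^ 2 * x j - 1), sq_nonneg (ω ^ 2 * x j + 1)]
    nlinarith [mul_le_mul_of_nonneg_right h3 (norm_nonneg (u x))]
  obtain ⟨X, hX⟩ := exists_toL2_of_le hm
    ((hu.norm.const_mul (ω ^ 2)).add (Lp.memLp u).norm) (Eventually.of_forall hle)
  refine ⟨X, hX, ?_⟩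
  set A : Lp ℝ 2 (volume : Measure (Space d)) := hu.norm.toLp with hA
  set B : Lp ℝ 2 (volume : Measure (Space d)) := (Lp.memLp u).norm.toLp with hB
  have hA' : ‖A‖ = normL2 (potMul ω u) := by rw [hA, Lp.norm_toLp, eLpNorm_norm]; rfl
  have hB' : ‖B‖ = ‖u‖ := by rw [hB, Lp.norm_toLp, eLpNorm_norm]; rfl
  have h1 : ‖X‖ ≤ ‖ω ^ 2 • A + B‖ := by
    refine Lp.norm_le_norm_of_ae_le ?_
    filter_upwards [hX, hu.norm.coeFn_toLp, (Lp.memLp u).norm.coeFn_toLp,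
      Lp.coeFn_add (ω ^ 2 • A) B, Lp.coeFn_smul (ω ^ 2) A] with x h1 h2 h3 h4 h5
    rw [h1, h4, Pi.add_apply, h5, Pi.smul_apply, h2, h3]
    exact (hle x).trans (le_abs_self _)
  refine h1.trans ((norm_add_le _ _).trans ?_)
  rw [norm_smul, hA', hB', Real.norm_eq_abs, abs_of_nonneg (sq_nonneg ω)]

/-- The product `U u` controls the products `ω⁴ x_j x_k u`. -/
theorem exists_coord_mul_coord_mul_of_potMul {ω : ℝ} {u : L2 d}
    (hu : MemLp (potMul ω u) 2 volume) (j k : Fin d) :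
    ∃ X : L2 d, (X =ᵐ[volume] fun x =>
        ((ω ^ 2 * x j : ℝ) : ℂ) * (((ω ^ 2 * x k : ℝ) : ℂ) * u x)) ∧
      ‖X‖ ≤ 2 * ω ^ 2 * normL2 (potMul ω u) := by
  have hm : AEStronglyMeasurable (fun x =>
      ((ω ^ 2 * x j : ℝ) : ℂ) * (((ω ^ 2 * x k : ℝ) : ℂ) * u x)) volume :=
    (hasTemperateGrowth_const_mul_coord (ω ^ 2) j).1.continuous.aestronglyMeasurable.mul
      ((hasTemperateGrowth_const_mul_coord (ω ^ 2) k).1.continuous.aestronglyMeasurable.mul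
        (Lp.aestronglyMeasurable u))
  have hle : ∀ x, ‖((ω ^ 2 * x j : ℝ) : ℂ) * (((ω ^ 2 * x k : ℝ) : ℂ) * u x)‖ ≤
      2 * ω ^ 2 * ‖potMul ω u x‖ := fun x => by
    rw [← mul_assoc, norm_mul, ← Complex.ofReal_mul, Complex.norm_real, Real.norm_eq_abs,
      show 2 * ω ^ 2 * ‖potMul ω u x‖ = ω ^ 2 * ‖potMul ω u x‖ * 2 by ring, norm_potMul]
    exact mul_le_mul_of_nonneg_right (abs_coord_mul_coord_le _ x j k) (norm_nonneg _)
  obtain ⟨X, hX⟩ := exists_toL2_of_le hm (hu.norm.const_mul (2 * ω ^ 2)) (Eventually.of_forall hle)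
  refine ⟨X, hX, ?_⟩
  rw [normL2_eq_norm hu]
  refine Lp.norm_le_mul_norm_of_ae_le_mul ?_
  filter_upwards [hX, hu.coeFn_toLp] with x h1 h2
  rw [h1, h2]
  exact hle x

/-- First moments of the free flow. -/
theorem exists_moments_of_gradPotMul {ω ε s : ℝ} (hs : 0 ≤ s * ε) {u : L2 d} (hu : MemH 1 u)
    (hU : MemLp (gradPotMul ω u) 2 volume) (j : Fin d) :
    ∃ Y : L2 d, (Y =ᵐ[volume] fun x => ((ω ^ 2 * x j : ℝ) : ℂ) * flowA ε s u x) ∧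
      ‖Y‖ ≤ normL2 (gradPotMul ω u) + ω ^ 2 * (s * ε) * normH 1 u := by
  obtain ⟨X, hX, hXn⟩ := exists_coord_mul_of_gradPotMul hU j
  obtain ⟨Y, hY, hYn⟩ := exists_coord_mul_flowA (sq_nonneg ω) hs (MemH.hasWeakDeriv hu j) hX
  refine ⟨Y, hY, hYn.trans (add_le_add hXn (mul_le_mul_of_nonneg_left ?_ (by positivity)))⟩
  exact norm_partialDeriv_le_normH le_rfl j u

/-- Moments of the free flow up to order two. -/
theorem exists_moments_of_potMul {ω ε s : ℝ} (hs : 0 ≤ s * ε) {u : L2 d} (hu : MemH 2 u)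
    (hU : MemLp (potMul ω u) 2 volume) :
    (∀ j, ∃ Y : L2 d, (Y =ᵐ[volume] fun x => ((ω ^ 2 * x j : ℝ) : ℂ) * flowA ε s u x) ∧
      ‖Y‖ ≤ ω ^ 2 * normL2 (potMul ω u) + normH 2 u + ω ^ 2 * (s * ε) * normH 2 u) ∧
    (∀ j k, ∃ Y : L2 d, (Y =ᵐ[volume] fun x =>
        ((ω ^ 2 * x j : ℝ) : ℂ) * partialDeriv k (flowA ε s u) x) ∧
      ‖Y‖ ≤ 2 * ω ^ 2 * normL2 (potMul ω u) + (2 * ω ^ 2 + 1) * normH 2 u +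
        ω ^ 2 * (s * ε) * normH 2 u) ∧
    ∀ j k, ∃ Y : L2 d, (Y =ᵐ[volume] fun x =>
        ((ω ^ 2 * x j : ℝ) : ℂ) * (((ω ^ 2 * x k : ℝ) : ℂ) * flowA ε s u x)) ∧
      ‖Y‖ ≤ 2 * ω ^ 2 * normL2 (potMul ω u) + 2 * (ω ^ 2 * (s * ε) *
        (2 * ω ^ 2 * normL2 (potMul ω u) + (3 * ω ^ 2 + 1) * normH 2 u)) +
        (ω ^ 2 * (s * ε)) ^ 2 * normH 2 u := by
  have hκ := sq_nonneg ω
  set κ := ω ^ 2 with hκ_def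
  set q := s * ε with hq
  set N := normL2 (potMul ω u) with hN
  set H := normH 2 u with hH
  have hκq : 0 ≤ κ * q := mul_nonneg hκ hs
  have hu0 : ‖u‖ ≤ H := norm_le_normH 2 u
  have hu1 : ∀ j, ‖partialDeriv j u‖ ≤ H := fun j => norm_partialDeriv_le_normH one_le_two j u
  have hu2 : ∀ j k, ‖partialDeriv j (partialDeriv k u)‖ ≤ H := fun j k =>
    norm_partialDeriv_partialDeriv_le_normH le_rfl j k (hu.mono one_le_two)
  have hw1 : ∀ j, HasWeakDeriv j u (partialDeriv j u) := (hu.mono one_le_two).hasWeakDeriv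
  have hw2 : ∀ j k, HasWeakDeriv j (partialDeriv k u) (partialDeriv j (partialDeriv k u)) :=
    fun j k => (hu.partialDeriv k).hasWeakDeriv j
  choose X hX hXn using exists_coord_mul_of_potMul hU
  choose XX hXX hXXn using exists_coord_mul_coord_mul_of_potMul hU
  have hD : ∀ j k, ∃ Y : L2 d, (Y =ᵐ[volume] fun x => ((κ * x j : ℝ) : ℂ) * partialDeriv k u x) ∧
      ‖Y‖ ≤ 2 * κ * N + (2 * κ + 1) * H := by
    intro j k
    obtain ⟨Y, hY, hYn⟩ := exists_coord_mul_partialDeriv hu j k hκ (X := XX j j) (by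
      filter_upwards [hXX j j] with x hx
      rw [hx, ← mul_assoc, norm_mul, ← Complex.ofReal_mul, Complex.norm_real, Real.norm_eq_abs,
        abs_mul_self, ← sq])
    refine ⟨Y, hY, hYn.trans ?_⟩
    have := mul_le_mul_of_nonneg_left hu0 hκ
    linarith [hXXn j j, hu2 k k]
  choose XD hXD hXDn using hD
  have hvD : ∀ k, partialDeriv k (flowA ε s u) = flowA ε s (partialDeriv k u) := fun k =>
    ((hw1 k).flowA ε s).partialDeriv_eq
  have hDv : ∀ j k, ∃ Y : L2 d, (Y =ᵐ[volume] fun x =>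
        ((κ * x j : ℝ) : ℂ) * flowA ε s (partialDeriv k u) x) ∧
      ‖Y‖ ≤ 2 * κ * N + (2 * κ + 1) * H + κ * q * H := by
    intro j k
    obtain ⟨Y, hY, hYn⟩ := exists_coord_mul_flowA hκ hs (hw2 j k) (hXD j k)
    exact ⟨Y, hY, hYn.trans (add_le_add (hXDn j k) (mul_le_mul_of_nonneg_left (hu2 j k) hκq))⟩
  refine ⟨fun j => ?_, fun j k => ?_, fun j k => ?_⟩
  · obtain ⟨Y, hY, hYn⟩ := exists_coord_mul_flowA (ε := ε) (s := s) hκ hs (hw1 j) (hX j)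
    refine ⟨Y, hY, hYn.trans (add_le_add ((hXn j).trans ?_)
      (mul_le_mul_of_nonneg_left (hu1 j) hκq))⟩
    linarith
  · rw [hvD]
    exact hDv j k
  · have hXXjk : XX j k =ᵐ[volume] fun x => ((κ * x j : ℝ) : ℂ) * X k x := by
      filter_upwards [hXX j k, hX k] with x h1 h2
      rw [h1, h2]
    -- The commutator is applied twice. After $\kappa x_k$ has passed through, $\kappa x_j$ acts on
    -- the flows of $\kappa x_ku$ and of $\partial_ku$; the derivative of the former contains
    -- $\kappa u$ when $j=k$.
    obtain ⟨Y1, hY1, hY1n⟩ := exists_coord_mul_flowA (ε := ε) (s := s) hκ hs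
      ((hw1 j).coord_mul (hX k) (hXD k j)) hXXjk
    obtain ⟨Y2, hY2, hY2n⟩ := hDv j k
    have hXk := coord_mul_flowA κ ε s (hw1 k) (hX k)
    refine ⟨Y1 + (-(κ * s * ε * Complex.I) : ℂ) • Y2, ?_, (norm_add_le _ _).trans ?_⟩
    · filter_upwards [hXk, hY1, hY2, Lp.coeFn_add Y1 ((-(κ * s * ε * Complex.I) : ℂ) • Y2),
        Lp.coeFn_smul (-(κ * s * ε * Complex.I) : ℂ) Y2,
        Lp.coeFn_add (flowA ε s (X k))
          ((-(κ * s * ε * Complex.I) : ℂ) • flowA ε s (partialDeriv k u)),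
        Lp.coeFn_smul (-(κ * s * ε * Complex.I) : ℂ) (flowA ε s (partialDeriv k u))]
        with x h1 h2 h3 h4 h5 h6 h7
      rw [← h1, h4, Pi.add_apply, h5, h6, Pi.add_apply, h7, Pi.smul_apply, Pi.smul_apply, h2, h3,
        smul_eq_mul, smul_eq_mul]
      ring
    · rw [norm_smul, norm_neg, norm_mul, Complex.norm_I, mul_one, mul_assoc (κ : ℂ),
        ← Complex.ofReal_mul, ← Complex.ofReal_mul, Complex.norm_real, Real.norm_eq_abs,
        abs_of_nonneg hκq]
      have h1 : ‖(if k = j then (κ : ℂ) else 0) • u + XD k j‖ ≤ κ * H + (2 * κ * N + (2 * κ + 1) * H) := by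
        refine (norm_add_le _ _).trans (add_le_add ?_ (hXDn k j))
        rw [norm_smul]
        refine mul_le_mul ?_ hu0 (norm_nonneg _) hκ
        split_ifs
        · rw [Complex.norm_real, Real.norm_eq_abs, abs_of_nonneg hκ]
        · simpa using hκ
      have h2 := mul_le_mul_of_nonneg_left h1 hκq
      have h3 := mul_le_mul_of_nonneg_left hY2n hκq
      have h4 : ‖XX j k‖ ≤ 2 * κ * N := hXXn j k
      have h5 : ‖Y1‖ ≤ ‖XX j k‖ +
        κ * q * ‖(if k = j then (κ : ℂ) else 0) • u + XD k j‖ := hY1n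
      have h6 : 0 ≤ κ * q * (κ * H) := mul_nonneg hκq (mul_nonneg hκ (normH_nonneg 2 u))
      linarith

/-! ### Derivatives of the nonlinear flow -/

/-- The linear part `exp (-iτU)` of the phase factor. -/
def potentialPhase (d : ℕ) (ω τ : ℝ) (x : Space d) : ℂ :=
  Complex.exp (((-(τ * potential d ω x) : ℝ) : ℂ) * Complex.I)

theorem norm_potentialPhase (ω τ : ℝ) (x : Space d) : ‖potentialPhase d ω τ x‖ = 1 :=
  Complex.norm_exp_ofReal_mul_I _

theorem hasTemperateGrowth_potentialPhase (ω τ : ℝ) :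
    (potentialPhase d ω τ).HasTemperateGrowth := by
  have h : (fun x => -(τ * potential d ω x)) = fun x => (-τ) * potential d ω x := by
    ext x; ring
  refine hasTemperateGrowth_phase ?_
  rw [h]
  exact (Function.HasTemperateGrowth.const (-τ)).mul (hasTemperateGrowth_potential ω)

theorem hasLineDerivAt_potentialPhase (ω τ : ℝ) (j : Fin d) (x : Space d) :
    HasLineDerivAt ℝ (potentialPhase d ω τ)
      (potentialPhase d ω τ x * (-(τ * Complex.I) * ((ω ^ 2 * x j : ℝ) : ℂ))) x (coordVec j) := by
  have h := hasLineDerivAt_phase (φ := fun x => -(τ * potential d ω x))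
    (HasDerivAt.neg (HasDerivAt.const_mul τ (hasLineDerivAt_potential ω j x)))
  have e : potentialPhase d ω τ x * (-(τ * Complex.I) * ((ω ^ 2 * x j : ℝ) : ℂ)) =
      Complex.exp (((-(τ * potential d ω x) : ℝ) : ℂ) * Complex.I) *
        (((-(τ * (ω ^ 2 * x j)) : ℝ) : ℂ) * Complex.I) := by
    simp only [potentialPhase]
    push_cast
    ring
  rw [e]
  exact h

/-- The derivative of `exp (-iτU) f`, up to the phase factor. -/
theorem HasWeakDeriv.potentialPhase_mul {ω τ : ℝ} {j : Fin d} {f f' X W W' : L2 d}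
    (h : HasWeakDeriv j f f') (hX : X =ᵐ[volume] fun x => ((ω ^ 2 * x j : ℝ) : ℂ) * f x)
    (hW : W =ᵐ[volume] fun x => potentialPhase d ω τ x * f x)
    (hW' : W' =ᵐ[volume] fun x =>
      potentialPhase d ω τ x * (f' + (-(τ * Complex.I) : ℂ) • X : L2 d) x) :
    HasWeakDeriv j W W' := by
  have hg := hasTemperateGrowth_potentialPhase (d := d) ω τ
  refine h.mul hg (hg.mul ((Function.HasTemperateGrowth.const (-(τ * Complex.I) : ℂ)).mul
    (hasTemperateGrowth_const_mul_coord (ω ^ 2) j))) (hasLineDerivAt_potentialPhase ω τ j) hW ?_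
  filter_upwards [hX, hW', Lp.coeFn_add f' ((-(τ * Complex.I) : ℂ) • X),
    Lp.coeFn_smul (-(τ * Complex.I) : ℂ) X] with x h1 h2 h3 h4
  rw [h2, h3, Pi.add_apply, h4, Pi.smul_apply, h1, smul_eq_mul]
  simp only [Pi.mul_apply]
  ring

theorem exists_potentialPhase_mul (ω τ : ℝ) (f : L2 d) :
    ∃ F : L2 d, F =ᵐ[volume] fun x => potentialPhase d ω τ x * f x :=
  exists_toL2_mul (hasTemperateGrowth_potentialPhase ω τ).1.continuous.aestronglyMeasurable
    (fun x => (norm_potentialPhase ω τ x).le) f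

/-- The phase is split because its factors need different arguments: approximation for the rough
cubic factor, temperate growth for the unbounded potential. -/
theorem flowB_ae_eq (ω θ ε t : ℝ) {v z : L2 d}
    (hz : z =ᵐ[volume] fun x => cubicPhase (-(t / ε * θ)) (v x) * v x) :
    flowB ω θ ε t v =ᵐ[volume] fun x => potentialPhase d ω (t / ε) x * z x := by
  filter_upwards [hz, MemLp.coeFn_toLp
    (memLp_phase_mul (aestronglyMeasurable_nonlinearPhase ω θ ε t v) v)] with x h1 h2
  rw [flowB, h2, h1, potentialPhase, cubicPhase, ← mul_assoc, ← Complex.exp_add, nonlinearPhase]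
  congr 2
  push_cast
  ring

theorem exists_cubicPhase_mul (β : ℝ) (v f : L2 d) :
    ∃ F : L2 d, F =ᵐ[volume] fun x => cubicPhase β (v x) * f x := by
  have hm : AEStronglyMeasurable (fun x => cubicPhase β (v x) * f x) volume :=
    ((continuous_cubicPhase β).comp_aestronglyMeasurable (Lp.aestronglyMeasurable v)).mul
      (Lp.aestronglyMeasurable f)
  exact exists_toL2_of_le hm (Lp.memLp f).norm (Eventually.of_forall fun x => by
    rw [norm_mul, norm_cubicPhase, one_mul])

/-! ### Pointwise majorants of the derivatives -/

theorem norm_sqDeriv_le (z a : ℂ) : ‖sqDeriv z a‖ ≤ 2 * (‖z‖ * ‖a‖) := by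
  refine (norm_add_le _ _).trans (le_of_eq ?_)
  rw [norm_mul, norm_mul, RCLike.norm_conj, RCLike.norm_conj]
  ring

theorem norm_sqDerivDeriv_le (z a b c : ℂ) :
    ‖sqDerivDeriv z a b c‖ ≤ 2 * (‖a‖ * ‖b‖) + 2 * (‖z‖ * ‖c‖) := by
  refine (norm_add_le _ _).trans ((add_le_add (norm_add_le _ _) (norm_add_le _ _)).trans
    (le_of_eq ?_))
  simp only [norm_mul, RCLike.norm_conj]
  ring

theorem norm_ofReal_mul_I (β : ℝ) : ‖(β * Complex.I : ℂ)‖ = |β| := by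
  rw [norm_mul, Complex.norm_I, mul_one, Complex.norm_real, Real.norm_eq_abs]

theorem norm_cubicDeriv_le (β : ℝ) (z a : ℂ) :
    ‖cubicDeriv β z a‖ ≤ ‖a‖ + 2 * |β| * (‖z‖ ^ 2 * ‖a‖) := by
  refine (norm_add_le _ _).trans (add_le_add le_rfl ?_)
  rw [norm_mul, norm_ofReal_mul_I, norm_mul]
  have := mul_le_mul_of_nonneg_left (mul_le_mul_of_nonneg_right (norm_sqDeriv_le z a)
    (norm_nonneg z)) (abs_nonneg β)
  refine this.trans (le_of_eq ?_)
  ring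

/-- The 6 collects three terms of size $2|\beta||z||a||b|$: the phase derivative times $a$, the
product $ab$ in the second derivative of $|z|^2$, and the first derivative of $|z|^2$ times $b$. -/
theorem norm_cubicDerivDeriv_le (β : ℝ) (z a b c : ℂ) :
    ‖cubicDerivDeriv β z a b c‖ ≤ ‖c‖ + (|β| * (6 * (‖z‖ * (‖a‖ * ‖b‖)) + 2 * (‖z‖ ^ 2 * ‖c‖)) +
      4 * β ^ 2 * (‖z‖ ^ 3 * (‖a‖ * ‖b‖))) := by
  have h1 : ‖((β * Complex.I) * sqDeriv z b) * cubicDeriv β z a‖ ≤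
      (|β| * (2 * (‖z‖ * ‖b‖))) * (‖a‖ + 2 * |β| * (‖z‖ ^ 2 * ‖a‖)) := by
    rw [norm_mul, norm_mul, norm_ofReal_mul_I]
    exact mul_le_mul (mul_le_mul_of_nonneg_left (norm_sqDeriv_le z b) (abs_nonneg β))
      (norm_cubicDeriv_le β z a) (norm_nonneg _) (by positivity)
  have h2 : ‖(β * Complex.I) * (sqDerivDeriv z a b c * z + sqDeriv z a * b)‖ ≤
      |β| * ((2 * (‖a‖ * ‖b‖) + 2 * (‖z‖ * ‖c‖)) * ‖z‖ + 2 * (‖z‖ * ‖a‖) * ‖b‖) := by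
    rw [norm_mul, norm_ofReal_mul_I]
    refine mul_le_mul_of_nonneg_left ((norm_add_le _ _).trans (add_le_add ?_ ?_)) (abs_nonneg β)
    · rw [norm_mul]
      exact mul_le_mul_of_nonneg_right (norm_sqDerivDeriv_le z a b c) (norm_nonneg _)
    · rw [norm_mul]
      exact mul_le_mul_of_nonneg_right (norm_sqDeriv_le z a) (norm_nonneg _)
  refine (norm_add_le _ _).trans ((add_le_add h1 ((norm_add_le _ _).trans
    (add_le_add le_rfl h2))).trans (le_of_eq ?_))
  rw [← sq_abs β]
  ring

theorem norm_neg_ofReal_mul_I {τ : ℝ} (hτ : 0 ≤ τ) : ‖(-(τ * Complex.I) : ℂ)‖ = τ := by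
  rw [norm_neg, norm_ofReal_mul_I, abs_of_nonneg hτ]

/-- First derivatives of the nonlinear flow. -/
theorem exists_deriv_flowB (hd : d ∈ ({1, 2, 3} : Set ℕ)) {ω θ ε t : ℝ} (hτ : 0 ≤ t / ε)
    {v : L2 d} (hv : MemH 2 v) {Y : Fin d → L2 d}
    (hY : ∀ j, Y j =ᵐ[volume] fun x => ((ω ^ 2 * x j : ℝ) : ℂ) * v x) :
    ∃ w : Fin d → L2 d, (∀ j, HasWeakDeriv j (flowB ω θ ε t v) (w j)) ∧
      ∀ j, ∀ᵐ x, ‖w j x‖ ≤ ‖partialDeriv j v x‖ +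
        (2 * (t / ε * |θ|) * (‖v x‖ ^ 2 * ‖partialDeriv j v x‖) + t / ε * ‖Y j x‖) := by
  obtain ⟨z, zj, -, hz, hzj, -, hdz, -⟩ := exists_cubicPhase_chain_rule hd hv (-(t / ε * θ))
  choose Z hZ using fun j => exists_cubicPhase_mul (-(t / ε * θ)) v (Y j)
  have hZz : ∀ j, Z j =ᵐ[volume] fun x => ((ω ^ 2 * x j : ℝ) : ℂ) * z x := fun j => by
    filter_upwards [hZ j, hY j, hz] with x h1 h2 h3
    rw [h1, h2, h3]; ring
  choose w hw using fun j => exists_potentialPhase_mul ω (t / ε)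
    (zj j + (-((t / ε : ℝ) * Complex.I) : ℂ) • Z j)
  refine ⟨w, fun j => (hdz j).potentialPhase_mul (hZz j) (flowB_ae_eq ω θ ε t hz) (hw j),
    fun j => ?_⟩
  filter_upwards [hw j, hzj j, hZ j, Lp.coeFn_add (zj j) ((-((t / ε : ℝ) * Complex.I) : ℂ) • Z j),
    Lp.coeFn_smul (-((t / ε : ℝ) * Complex.I) : ℂ) (Z j)] with x h1 h2 h3 h4 h5
  rw [h1, norm_mul, norm_potentialPhase, one_mul, h4, Pi.add_apply, h5, Pi.smul_apply, h2, h3,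
    smul_eq_mul]
  refine (norm_add_le _ _).trans ?_
  rw [norm_mul, norm_mul, norm_mul, norm_cubicPhase, one_mul, one_mul, norm_neg_ofReal_mul_I hτ]
  have h6 := norm_cubicDeriv_le (-(t / ε * θ)) (v x) (partialDeriv j v x)
  rw [abs_neg, abs_mul, abs_of_nonneg hτ] at h6
  linarith

/-- Second derivatives of the nonlinear flow. -/
theorem exists_deriv_deriv_flowB (hd : d ∈ ({1, 2, 3} : Set ℕ)) {ω θ ε t M : ℝ} (hτ : 0 ≤ t / ε)
    {v : L2 d} (hv : MemH 2 v) (hM : ∀ᵐ x, ‖v x‖ ≤ M) {Y : Fin d → L2 d} {YD YY : Fin d → Fin d → L2 d}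
    (hY : ∀ j, Y j =ᵐ[volume] fun x => ((ω ^ 2 * x j : ℝ) : ℂ) * v x)
    (hYD : ∀ j k, YD j k =ᵐ[volume] fun x => ((ω ^ 2 * x j : ℝ) : ℂ) * partialDeriv k v x)
    (hYY : ∀ j k, YY j k =ᵐ[volume] fun x =>
      ((ω ^ 2 * x j : ℝ) : ℂ) * (((ω ^ 2 * x k : ℝ) : ℂ) * v x)) :
    ∃ (w : Fin d → L2 d) (w' : Fin d → Fin d → L2 d),
      (∀ j, HasWeakDeriv j (flowB ω θ ε t v) (w j)) ∧ (∀ j k, HasWeakDeriv k (w j) (w' j k)) ∧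
      ∀ j k, ∀ᵐ x, ‖w' j k x‖ ≤ ‖partialDeriv k (partialDeriv j v) x‖ +
        (t / ε * |θ| * (6 * (‖v x‖ * (‖partialDeriv j v x‖ * ‖partialDeriv k v x‖)) +
            2 * (‖v x‖ ^ 2 * ‖partialDeriv k (partialDeriv j v) x‖)) +
          4 * (t / ε * |θ|) ^ 2 * (‖v x‖ ^ 3 * (‖partialDeriv j v x‖ * ‖partialDeriv k v x‖)) +
          t / ε * (ω ^ 2 * ‖v x‖ + (‖YD j k x‖ + 2 * (t / ε * |θ|) * (‖v x‖ ^ 2 * ‖YD j k x‖))) +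
          t / ε * (‖YD k j x‖ + 2 * (t / ε * |θ|) * (‖v x‖ ^ 2 * ‖YD k j x‖) +
            t / ε * ‖YY k j x‖)) := by
  set τ := t / ε with hτ_def
  set β := -(τ * θ) with hβ
  have hβ' : |β| = τ * |θ| := by rw [hβ, abs_neg, abs_mul, abs_of_nonneg hτ]
  set c : ℂ := -((τ : ℝ) * Complex.I) with hc
  have hcn : ‖c‖ = τ := norm_neg_ofReal_mul_I hτ
  obtain ⟨z, zj, zjk, hz, hzj, hzjk, hdz, hddz⟩ := exists_cubicPhase_chain_rule hd hv β
  have hzn : ∀ᵐ x, ‖z x‖ = ‖v x‖ := by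
    filter_upwards [hz] with x h1
    rw [h1, norm_mul, norm_cubicPhase, one_mul]
  choose Z hZ using fun j => exists_cubicPhase_mul β v (Y j)
  have hZz : ∀ j, Z j =ᵐ[volume] fun x => ((ω ^ 2 * x j : ℝ) : ℂ) * z x := fun j => by
    filter_upwards [hZ j, hY j, hz] with x h1 h2 h3
    rw [h1, h2, h3]; ring
  choose ZZ hZZ using fun j k => exists_cubicPhase_mul β v (YY j k)
  have hZZz : ∀ j k, ZZ j k =ᵐ[volume] fun x => ((ω ^ 2 * x j : ℝ) : ℂ) * Z k x := fun j k => by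
    filter_upwards [hZZ j k, hYY j k, hZ k, hY k] with x h1 h2 h3 h4
    rw [h1, h2, h3, h4]; ring
  have hZZn : ∀ j k, ∀ᵐ x, ‖ZZ j k x‖ = ‖YY j k x‖ := fun j k => by
    filter_upwards [hZZ j k] with x h1
    rw [h1, norm_mul, norm_cubicPhase, one_mul]
  have hle : ∀ j k, ∀ᵐ x, ‖((ω ^ 2 * x j : ℝ) : ℂ) * zj k x‖ ≤
      ‖YD j k x‖ + 2 * (τ * |θ|) * (‖v x‖ ^ 2 * ‖YD j k x‖) := fun j k => by
    filter_upwards [hzj k, hYD j k] with x h1 h2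
    have h3 := mul_le_mul_of_nonneg_left (norm_cubicDeriv_le β (v x) (partialDeriv k v x))
      (norm_nonneg ((ω ^ 2 * x j : ℝ) : ℂ))
    rw [hβ'] at h3
    rw [h1, h2, norm_mul, norm_mul, norm_mul, norm_cubicPhase, one_mul]
    linarith
  have hZD : ∀ j k, ∃ F : L2 d, F =ᵐ[volume] fun x => ((ω ^ 2 * x j : ℝ) : ℂ) * zj k x := by
    intro j k
    -- The bound `M` serves here only for square integrability; the conclusion keeps the pointwise
    -- majorant `hle`.
    refine exists_toL2_of_le ((hasTemperateGrowth_const_mul_coord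
      (ω ^ 2) j).1.continuous.aestronglyMeasurable.mul (Lp.aestronglyMeasurable _))
      ((Lp.memLp (YD j k)).norm.const_mul (1 + 2 * (τ * |θ|) * M ^ 2)) ?_
    filter_upwards [hle j k, hM] with x h1 h2
    refine h1.trans ?_
    have h3 := mul_le_mul_of_nonneg_right (pow_le_pow_left₀ (norm_nonneg _) h2 2)
      (norm_nonneg (YD j k x))
    have h4 := mul_le_mul_of_nonneg_left h3 (show 0 ≤ 2 * (τ * |θ|) by positivity)
    linarith
  choose ZD hZD using hZD
  choose w hw using fun j => exists_potentialPhase_mul ω τ (zj j + c • Z j)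
  have hS : ∀ j k, ZD k j + c • ZZ k j =ᵐ[volume] fun x =>
      ((ω ^ 2 * x k : ℝ) : ℂ) * (zj j + c • Z j : L2 d) x := fun j k => by
    filter_upwards [Lp.coeFn_add (ZD k j) (c • ZZ k j), Lp.coeFn_smul c (ZZ k j), hZD k j,
      hZZz k j, Lp.coeFn_add (zj j) (c • Z j), Lp.coeFn_smul c (Z j)] with x h1 h2 h3 h4 h5 h6
    rw [h1, Pi.add_apply, h2, Pi.smul_apply, h3, h4, h5, Pi.add_apply, h6, Pi.smul_apply,
      smul_eq_mul, smul_eq_mul]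
    ring
  set e : Fin d → Fin d → ℂ := fun j k => if j = k then ((ω ^ 2 : ℝ) : ℂ) else 0 with he
  have hen : ∀ j k, ‖e j k‖ ≤ ω ^ 2 := fun j k => by
    simp only [he]
    split_ifs
    · rw [Complex.norm_real, Real.norm_eq_abs, abs_of_nonneg (sq_nonneg ω)]
    · simpa using sq_nonneg ω
  have hdS : ∀ j k, HasWeakDeriv k (zj j + c • Z j) (zjk j k + c • (e j k • z + ZD j k)) :=
    fun j k => (hddz j k).add (((hdz k).coord_mul (hZz j) (hZD j k)).smul c)
  -- With $S_j$ the first derivative stripped of $e^{-i\tau U}$, the second one is $e^{-i\tau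
  -- U}(\partial_kS_j-i\tau\omega^2x_kS_j)$.
  choose w' hw' using fun j k => exists_potentialPhase_mul ω τ
    ((zjk j k + c • (e j k • z + ZD j k)) + c • (ZD k j + c • ZZ k j))
  refine ⟨w, w', fun j => (hdz j).potentialPhase_mul (hZz j) (flowB_ae_eq ω θ ε t hz) (hw j),
    fun j k => (hdS j k).potentialPhase_mul (hS j k) (hw j) (hw' j k), fun j k => ?_⟩
  filter_upwards [hw' j k, hzjk j k, hZZn k j, hle j k, hle k j, hZD j k, hZD k j, hzn,
    Lp.coeFn_add (zjk j k + c • (e j k • z + ZD j k)) (c • (ZD k j + c • ZZ k j)),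
    Lp.coeFn_add (zjk j k) (c • (e j k • z + ZD j k)), Lp.coeFn_smul c (e j k • z + ZD j k),
    Lp.coeFn_add (e j k • z) (ZD j k), Lp.coeFn_smul (e j k) z,
    Lp.coeFn_smul c (ZD k j + c • ZZ k j), Lp.coeFn_add (ZD k j) (c • ZZ k j),
    Lp.coeFn_smul c (ZZ k j)] with x h1 h2 h3 h4 h5 h6 h7 h8 a1 a2 a3 a4 a5 a6 a7 a8
  rw [h1, norm_mul, norm_potentialPhase, one_mul, a1, Pi.add_apply, a2, Pi.add_apply, a3,
    Pi.smul_apply, a4, Pi.add_apply, a5, Pi.smul_apply, a6, Pi.smul_apply, a7, Pi.add_apply, a8,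
    Pi.smul_apply]
  simp only [smul_eq_mul]
  rw [← h6] at h4
  rw [← h7] at h5
  have b1 : ‖zjk j k x‖ ≤ ‖partialDeriv k (partialDeriv j v) x‖ +
      (τ * |θ| * (6 * (‖v x‖ * (‖partialDeriv j v x‖ * ‖partialDeriv k v x‖)) +
        2 * (‖v x‖ ^ 2 * ‖partialDeriv k (partialDeriv j v) x‖)) +
        4 * (τ * |θ|) ^ 2 * (‖v x‖ ^ 3 * (‖partialDeriv j v x‖ * ‖partialDeriv k v x‖))) := by
    rw [h2, norm_mul, norm_cubicPhase, one_mul, ← hβ', sq_abs]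
    exact norm_cubicDerivDeriv_le _ _ _ _ _
  have b2 : ‖c * (e j k * z x + ZD j k x)‖ ≤ τ * (ω ^ 2 * ‖v x‖ + (‖YD j k x‖ +
      2 * (τ * |θ|) * (‖v x‖ ^ 2 * ‖YD j k x‖))) := by
    rw [norm_mul, hcn]
    refine mul_le_mul_of_nonneg_left ((norm_add_le _ _).trans (add_le_add ?_ h4)) hτ
    rw [norm_mul, h8]
    exact mul_le_mul_of_nonneg_right (hen j k) (norm_nonneg _)
  have b3 : ‖c * (ZD k j x + c * ZZ k j x)‖ ≤ τ * (‖YD k j x‖ +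
      2 * (τ * |θ|) * (‖v x‖ ^ 2 * ‖YD k j x‖) + τ * ‖YY k j x‖) := by
    rw [norm_mul, hcn]
    refine mul_le_mul_of_nonneg_left ((norm_add_le _ _).trans (add_le_add h5 ?_)) hτ
    rw [norm_mul, hcn, h3]
  have b4 := (norm_add_le (zjk j k x + c * (e j k * z x + ZD j k x))
    (c * (ZD k j x + c * ZZ k j x))).trans
    (add_le_add ((norm_add_le _ _).trans (add_le_add b1 b2)) b3)
  linarith

/-! ### Bounds in `L²` of pointwise majorants -/

/-- The function `r` has `L²` norm at most `R`. -/
structure L2Bound (r : Space d → ℝ) (R : ℝ) : Prop where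
  aestronglyMeasurable : AEStronglyMeasurable r volume
  nonneg : 0 ≤ R
  le : eLpNorm r 2 volume ≤ ENNReal.ofReal R

theorem L2Bound.norm {f : L2 d} {R : ℝ} (h : ‖f‖ ≤ R) : L2Bound (fun x => ‖f x‖) R where
  aestronglyMeasurable := (Lp.aestronglyMeasurable f).norm
  nonneg := (norm_nonneg f).trans h
  le := by
    rw [eLpNorm_norm, ← Lp.enorm_def, ← ofReal_norm]
    exact ENNReal.ofReal_le_ofReal h

theorem L2Bound.add {r s : Space d → ℝ} {R S : ℝ} (hr : L2Bound r R) (hs : L2Bound s S) :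
    L2Bound (fun x => r x + s x) (R + S) where
  aestronglyMeasurable := hr.1.add hs.1
  nonneg := add_nonneg hr.2 hs.2
  le := by
    rw [ENNReal.ofReal_add hr.2 hs.2]
    exact (eLpNorm_add_le hr.1 hs.1 one_le_two).trans (add_le_add hr.3 hs.3)

theorem L2Bound.mul_of_le {r g : Space d → ℝ} {R C : ℝ} (hr : L2Bound r R)
    (hg : AEStronglyMeasurable g volume) (hC : 0 ≤ C) (h : ∀ᵐ x, |g x| ≤ C) :
    L2Bound (fun x => g x * r x) (C * R) where
  aestronglyMeasurable := hg.mul hr.1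
  nonneg := mul_nonneg hC hr.2
  le := by
    rw [ENNReal.ofReal_mul hC]
    refine (eLpNorm_le_mul_eLpNorm_of_ae_le_mul (c := C) ?_ 2).trans (mul_le_mul_right hr.3 _)
    filter_upwards [h] with x hx
    rw [norm_mul]
    exact mul_le_mul_of_nonneg_right hx (norm_nonneg _)

theorem L2Bound.const_mul {r : Space d → ℝ} {R c : ℝ} (hr : L2Bound r R) (hc : 0 ≤ c) :
    L2Bound (fun x => c * r x) (c * R) :=
  hr.mul_of_le aestronglyMeasurable_const hc (Eventually.of_forall fun _ => (abs_of_nonneg hc).le)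

theorem L2Bound.norm_pow_mul {r : Space d → ℝ} {R M : ℝ} (hr : L2Bound r R) {v : L2 d}
    (hM : 0 ≤ M) (h : ∀ᵐ x, ‖v x‖ ≤ M) (n : ℕ) :
    L2Bound (fun x => ‖v x‖ ^ n * r x) (M ^ n * R) := by
  refine hr.mul_of_le ((Lp.aestronglyMeasurable v).norm.pow n) (pow_nonneg hM n) ?_
  filter_upwards [h] with x hx
  rw [abs_of_nonneg (by positivity)]
  exact pow_le_pow_left₀ (norm_nonneg _) hx n

theorem L2Bound.norm_le {r : Space d → ℝ} {R : ℝ} (hr : L2Bound r R) {F : L2 d}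
    (h : ∀ᵐ x, ‖F x‖ ≤ r x) : ‖F‖ ≤ R := by
  refine ENNReal.toReal_le_of_le_ofReal hr.2 ((eLpNorm_mono_ae ?_).trans hr.3)
  filter_upwards [h] with x hx
  exact hx.trans (le_abs_self _)

theorem L2Bound.norm_mul_norm {f g : L2 d} {a b : ℝ} (hb : 0 ≤ b) (ha : 0 ≤ a)
    (hf : eLpNorm f 4 volume ≤ ENNReal.ofReal a) (hg : eLpNorm g 4 volume ≤ ENNReal.ofReal b) :
    L2Bound (fun x => ‖f x‖ * ‖g x‖) (a * b) where
  aestronglyMeasurable := (Lp.aestronglyMeasurable f).norm.mul (Lp.aestronglyMeasurable g).norm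
  nonneg := mul_nonneg ha hb
  le := by
    rw [ENNReal.ofReal_mul ha]
    refine le_trans ?_ (mul_le_mul' hf hg)
    have h := eLpNorm_smul_le_mul_eLpNorm (p := 4) (q := 4) (r := 2) (μ := volume)
      (Lp.aestronglyMeasurable g).norm (Lp.aestronglyMeasurable f).norm
    rw [eLpNorm_norm, eLpNorm_norm] at h
    exact h

/-! ### The bounds of the splitting step -/

/-- One error bound for every component costs the number $\sum_{k\le m}d^k$ of components, a
constant depending on $d$ and $m$ only. -/
theorem normH_le_add_of_forall {m : ℕ} {w v : L2 d} {B T C : ℝ} (hB : 0 ≤ B)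
    (h : ∀ k ≤ m, ∀ j : Fin k → Fin d, ‖weakDeriv j w‖ ≤ ‖weakDeriv j v‖ + B)
    (hBT : B ≤ C * T) :
    normH m w ≤ normH m v + (∑ k ∈ Finset.range (m + 1), (d : ℝ) ^ k) * C * T := by
  refine (normH_le_add (fun _ _ => B) (fun _ _ => hB) h).trans (add_le_add le_rfl ?_)
  simp only [Finset.sum_const, Finset.card_univ, Fintype.card_fun, Fintype.card_fin, nsmul_eq_mul,
    Nat.cast_pow, ← Finset.sum_mul]
  rw [mul_assoc]
  exact mul_le_mul_of_nonneg_left hBT (Finset.sum_nonneg fun _ _ => by positivity)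

theorem ae_norm_le_of_eLpNorm_top_le {f : L2 d} {M : ℝ} (hM : 0 ≤ M)
    (h : eLpNorm f ∞ volume ≤ ENNReal.ofReal M) : ∀ᵐ x, ‖f x‖ ≤ M := by
  rw [eLpNorm_exponent_top] at h
  filter_upwards [ae_le_eLpNormEssSup (f := f) (μ := volume)] with x hx
  have := hx.trans h
  rwa [← ofReal_norm, ENNReal.ofReal_le_ofReal_iff hM] at this

/-- The first derivatives of the nonlinear flow, for a datum bounded by `M`. -/
theorem norm_partialDeriv_flowB_le (hd : d ∈ ({1, 2, 3} : Set ℕ)) {ω θ ε t M D A : ℝ}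
    (hτ : 0 ≤ t / ε) {v : L2 d} (hv : MemH 2 v) (hM0 : 0 ≤ M) (hM : ∀ᵐ x, ‖v x‖ ≤ M)
    (hD : ∀ j, ‖partialDeriv j v‖ ≤ D) {Y : Fin d → L2 d}
    (hY : ∀ j, Y j =ᵐ[volume] fun x => ((ω ^ 2 * x j : ℝ) : ℂ) * v x) (hA : ∀ j, ‖Y j‖ ≤ A) :
    MemH 1 (flowB ω θ ε t v) ∧ ∀ j, ‖partialDeriv j (flowB ω θ ε t v)‖ ≤
      ‖partialDeriv j v‖ + (2 * (t / ε * |θ|) * (M ^ 2 * D) + t / ε * A) := by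
  obtain ⟨w, hw, hwb⟩ := exists_deriv_flowB (θ := θ) hd hτ hv hY
  refine ⟨memH_one_of hw, fun j => ?_⟩
  rw [(hw j).partialDeriv_eq]
  have p := ((L2Bound.norm (hD j)).norm_pow_mul hM0 hM 2).const_mul
    (show 0 ≤ 2 * (t / ε * |θ|) by positivity)
  have q := (L2Bound.norm (hA j)).const_mul hτ
  exact ((L2Bound.norm le_rfl).add (p.add q)).norm_le (hwb j)

/-- The second derivatives of the nonlinear flow, for a datum bounded by `M`. -/
theorem norm_partialDeriv_partialDeriv_flowB_le (hd : d ∈ ({1, 2, 3} : Set ℕ))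
    {ω θ ε t M D P b c : ℝ} (hτ : 0 ≤ t / ε) {v : L2 d} (hv : MemH 2 v) (hM0 : 0 ≤ M)
    (hM : ∀ᵐ x, ‖v x‖ ≤ M) (hD0 : ‖v‖ ≤ D)
    (hD : ∀ j k, ‖partialDeriv j (partialDeriv k v)‖ ≤ D)
    (hP : ∀ j k, L2Bound (fun x => ‖partialDeriv j v x‖ * ‖partialDeriv k v x‖) P)
    {Y : Fin d → L2 d} {YD YY : Fin d → Fin d → L2 d}
    (hY : ∀ j, Y j =ᵐ[volume] fun x => ((ω ^ 2 * x j : ℝ) : ℂ) * v x)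
    (hYD : ∀ j k, YD j k =ᵐ[volume] fun x => ((ω ^ 2 * x j : ℝ) : ℂ) * partialDeriv k v x)
    (hYY : ∀ j k, YY j k =ᵐ[volume] fun x =>
      ((ω ^ 2 * x j : ℝ) : ℂ) * (((ω ^ 2 * x k : ℝ) : ℂ) * v x))
    (hb : ∀ j k, ‖YD j k‖ ≤ b) (hc : ∀ j k, ‖YY j k‖ ≤ c) :
    MemH 2 (flowB ω θ ε t v) ∧ ∀ j k, ‖partialDeriv k (partialDeriv j (flowB ω θ ε t v))‖ ≤
      ‖partialDeriv k (partialDeriv j v)‖ +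
        (t / ε * |θ| * (6 * (M ^ 1 * P) + 2 * (M ^ 2 * D)) +
          4 * (t / ε * |θ|) ^ 2 * (M ^ 3 * P) +
          t / ε * (ω ^ 2 * D + (b + 2 * (t / ε * |θ|) * (M ^ 2 * b))) +
          t / ε * (b + 2 * (t / ε * |θ|) * (M ^ 2 * b) + t / ε * c)) := by
  obtain ⟨w, w', hw, hw', hwb'⟩ := exists_deriv_deriv_flowB (θ := θ) hd hτ hv hM hY hYD hYY
  refine ⟨memH_two_of hw hw', fun j k => ?_⟩
  rw [(hw j).partialDeriv_eq, (hw' j k).partialDeriv_eq]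
  have hτθ : 0 ≤ t / ε * |θ| := mul_nonneg hτ (abs_nonneg θ)
  have p1 := (hP j k).norm_pow_mul hM0 hM 1
  have p2 := (L2Bound.norm (hD k j)).norm_pow_mul hM0 hM 2
  have p3 := (hP j k).norm_pow_mul hM0 hM 3
  have r : ∀ j k, L2Bound
      (fun x => ‖YD j k x‖ + 2 * (t / ε * |θ|) * (‖v x‖ ^ 2 * ‖YD j k x‖))
      (b + 2 * (t / ε * |θ|) * (M ^ 2 * b)) := fun j k =>
    (L2Bound.norm (hb j k)).add (((L2Bound.norm (hb j k)).norm_pow_mul hM0 hM 2).const_mul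
      (mul_nonneg two_pos.le hτθ))
  have q1 := ((p1.const_mul (show (0 : ℝ) ≤ 6 by norm_num)).add
    (p2.const_mul two_pos.le)).const_mul hτθ
  have q2 := p3.const_mul (show 0 ≤ 4 * (t / ε * |θ|) ^ 2 by positivity)
  have q3 := (((L2Bound.norm hD0).const_mul (sq_nonneg ω)).add (r j k)).const_mul hτ
  have q4 := ((r k j).add ((L2Bound.norm (hc k j)).const_mul hτ)).const_mul hτ
  refine ((L2Bound.norm (f := partialDeriv k (partialDeriv j v)) le_rfl).add
    (((q1.add q2).add q3).add q4)).norm_le ?_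
  filter_upwards [hwb' j k] with x hx
  rw [pow_one]
  exact hx

/-- Agmon's inequality is used in its interpolated form: $\|v\|_\infty^2\|\partial_jv\|\le
K^2\|u\|_{H^2}\|u\|_{H^1}^2$, which is linear in the $H^2$ norm. -/
theorem normH_one_halfStep_le (hd : d ∈ ({1, 2, 3} : Set ℕ)) {K : ℝ} (hK : 0 < K)
    (hA : ∀ u : L2 d, MemH 2 u →
      eLpNorm u ∞ volume ≤ ENNReal.ofReal (K * √(normH 1 u * normH 2 u)))
    (ω : ℝ) {ε t : ℝ} (hε : 0 < ε) (ht : 0 ≤ t) (θ : ℝ) {u : L2 d} (hu : MemH 2 u)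
    (hU : MemLp (gradPotMul ω u) 2 volume) :
    MemH 1 (halfStep ω θ ε t u) ∧
      normH 1 (halfStep ω θ ε t u) ≤ normH 1 u +
        (∑ k ∈ Finset.range (1 + 1), (d : ℝ) ^ k) * (2 * K ^ 2 + 1 + ω ^ 2) *
          (t / ε * (normL2 (gradPotMul ω u) + |θ| * normH 2 u * normH 1 u ^ 2) +
            t ^ 2 * normH 1 u) := by
  have hτ : 0 ≤ t / ε := by positivity
  have hq : 0 ≤ t / 2 * ε := by positivity
  have h1 := normH_flowA 1 ε (t / 2) u
  have h2 := normH_flowA 2 ε (t / 2) u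
  have hv : MemH 2 (flowA ε (t / 2) u) := hu.flowA ε (t / 2)
  choose Y hY hYn using exists_moments_of_gradPotMul hq (hu.mono one_le_two) hU
  have hAv := hA _ hv
  rw [halfStep]
  generalize flowA ε (t / 2) u = v at *
  have hH1 : 0 ≤ normH 1 u := normH_nonneg 1 u
  have hH2 : 0 ≤ normH 2 u := normH_nonneg 2 u
  have hN : 0 ≤ normL2 (gradPotMul ω u) := ENNReal.toReal_nonneg
  rw [h1, h2] at hAv
  have hvj : ∀ j, ‖partialDeriv j v‖ ≤ normH 1 u := fun j =>
    h1 ▸ norm_partialDeriv_le_normH le_rfl j v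
  generalize normH 1 u = H1 at *
  generalize normH 2 u = H2 at *
  generalize normL2 (gradPotMul ω u) = N at *
  have hM0 : 0 ≤ K * √(H1 * H2) := by positivity
  have hMsq : (K * √(H1 * H2)) ^ 2 = K ^ 2 * (H1 * H2) := by
    rw [mul_pow, Real.sq_sqrt (mul_nonneg hH1 hH2)]
  have hM := ae_norm_le_of_eLpNorm_top_le hM0 hAv
  obtain ⟨hmem, hbd⟩ := norm_partialDeriv_flowB_le (θ := θ) hd hτ hv hM0 hM hvj hY hYn
  refine ⟨hmem, ?_⟩
  have hB0 : 0 ≤ 2 * (t / ε * |θ|) * ((K * √(H1 * H2)) ^ 2 * H1) +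
    t / ε * (N + ω ^ 2 * (t / 2 * ε) * H1) := by positivity
  rw [← h1]
  refine normH_le_add_of_forall hB0 (fun k hk j => ?_) ?_
  · interval_cases k
    · rw [weakDeriv_zero, weakDeriv_zero, norm_flowB]
      exact le_add_of_nonneg_right hB0
    · rw [weakDeriv_one, weakDeriv_one]
      exact hbd (j 0)
  · rw [hMsq, h1]
    -- The $\varepsilon$ of the commutator cancels that of the nonlinear phase, which leaves the
    -- $t^2$ term.
    have e : t / ε * (ω ^ 2 * (t / 2 * ε) * H1) = ω ^ 2 / 2 * (t ^ 2 * H1) := by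
      field_simp
    have a1 : 0 ≤ t ^ 2 * H1 := by positivity
    have a2 : 0 ≤ t / ε * N := by positivity
    have a3 : 0 ≤ t / ε * (|θ| * H2 * H1 ^ 2) := by positivity
    have c1 : 0 ≤ K ^ 2 := sq_nonneg K
    have c2 : 0 ≤ ω ^ 2 := sq_nonneg ω
    linarith [mul_nonneg c1 a1, mul_nonneg c1 a2, mul_nonneg c2 a1, mul_nonneg c2 a2,
      mul_nonneg c2 a3]

/-- Read $\kappa=\omega^2$, $\tau=t/\varepsilon$, $q=t\varepsilon/2$, $s=|\theta|$; then $2\tau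
q=t^2$, $2\tau^2q=t^3/\varepsilon$, $4\tau^2q^2=t^4$, and $T$ is the bracket of the $H^2$ estimate.
The left side is a combination of twelve monomials, each at most $T$; the constant is the sum of
their coefficients. -/
theorem strang_bound_aux {κ K τ q N H s T : ℝ} (hκ : 0 ≤ κ) (hτ : 0 ≤ τ) (hq : 0 ≤ q)
    (hN : 0 ≤ N) (hH : 0 ≤ H) (hs : 0 ≤ s)
    (hT : T = τ * (N + H + s * H ^ 3) + 2 * (τ * q) * H +
      τ ^ 2 * (N + s * N * H ^ 2 + s * H ^ 3 + s ^ 2 * H ^ 5) +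
      2 * (τ ^ 2 * q) * (N + H + s * H ^ 3) + 4 * (τ ^ 2 * q ^ 2) * H) :
    2 * (τ * s) * ((K * H) ^ 2 * H) + τ * (κ * N + H + κ * q * H) +
      (τ * s * (6 * ((K * H) ^ 1 * (3 * (K * H) * H)) + 2 * ((K * H) ^ 2 * H)) +
        4 * (τ * s) ^ 2 * ((K * H) ^ 3 * (3 * (K * H) * H)) +
        τ * (κ * H + ((2 * κ * N + (2 * κ + 1) * H + κ * q * H) +
          2 * (τ * s) * ((K * H) ^ 2 * (2 * κ * N + (2 * κ + 1) * H + κ * q * H)))) +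
        τ * ((2 * κ * N + (2 * κ + 1) * H + κ * q * H) +
          2 * (τ * s) * ((K * H) ^ 2 * (2 * κ * N + (2 * κ + 1) * H + κ * q * H)) +
          τ * (2 * κ * N + 2 * (κ * q * (2 * κ * N + (3 * κ + 1) * H)) + (κ * q) ^ 2 * H))) ≤
    (3 + 22 * K ^ 2 + 12 * K ^ 4 + 17 * κ + 4 * K ^ 2 * (5 * κ + 1) + 11 * κ ^ 2) * T := by
  have a1 : 0 ≤ τ * N := by positivity
  have a2 : 0 ≤ τ * H := by positivity
  have a3 : 0 ≤ τ * s * H ^ 3 := by positivity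
  have a4 : 0 ≤ τ * q * H := by positivity
  have a5 : 0 ≤ τ ^ 2 * N := by positivity
  have a6 : 0 ≤ τ ^ 2 * s * N * H ^ 2 := by positivity
  have a7 : 0 ≤ τ ^ 2 * s * H ^ 3 := by positivity
  have a8 : 0 ≤ τ ^ 2 * s ^ 2 * H ^ 5 := by positivity
  have a9 : 0 ≤ τ ^ 2 * q * N := by positivity
  have a10 : 0 ≤ τ ^ 2 * q * H := by positivity
  have a11 : 0 ≤ τ ^ 2 * q * s * H ^ 3 := by positivity
  have a12 : 0 ≤ τ ^ 2 * q ^ 2 * H := by positivity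
  have hK2 : 0 ≤ K ^ 2 := sq_nonneg K
  have hK4 : 0 ≤ K ^ 4 := by positivity
  have hKκ : 0 ≤ K ^ 2 * κ := mul_nonneg hK2 hκ
  have hκ2 : 0 ≤ κ ^ 2 := sq_nonneg κ
  have b1 : τ * N ≤ T := by linarith
  have b2 : τ * H ≤ T := by linarith
  have b3 : τ * s * H ^ 3 ≤ T := by linarith
  have b4 : τ * q * H ≤ T := by linarith
  have b5 : τ ^ 2 * N ≤ T := by linarith
  have b6 : τ ^ 2 * s * N * H ^ 2 ≤ T := by linarith
  have b7 : τ ^ 2 * s * H ^ 3 ≤ T := by linarith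
  have b8 : τ ^ 2 * s ^ 2 * H ^ 5 ≤ T := by linarith
  have b9 : τ ^ 2 * q * N ≤ T := by linarith
  have b10 : τ ^ 2 * q * H ≤ T := by linarith
  have b11 : τ ^ 2 * q * s * H ^ 3 ≤ T := by linarith
  have b12 : τ ^ 2 * q ^ 2 * H ≤ T := by linarith
  clear hT
  have m := fun {c a : ℝ} (hc : 0 ≤ c) (h : a ≤ T) => mul_le_mul_of_nonneg_left h hc
  linarith [m hκ b1, m hκ b2, m hκ b4, m hK2 b3, m hK4 b8, m hKκ b6, m hKκ b7, m hK2 b7,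
    m hKκ b11, m hκ b5, m hκ2 b9, m hκ2 b10, m hκ b10, m hκ2 b12]

/-- Agmon's inequality is weakened to $\|v\|_\infty\le KH$ with $H=\|u\|_{H^2}$, and the $L^4$ bound
gives $3KH^2$ for products of two first derivatives. Every error term then becomes a monomial in $H$
and $\|Uu\|$. -/
theorem normH_two_halfStep_le (hd : d ∈ ({1, 2, 3} : Set ℕ)) {K : ℝ} (hK : 0 < K)
    (hA : ∀ u : L2 d, MemH 2 u →
      eLpNorm u ∞ volume ≤ ENNReal.ofReal (K * √(normH 1 u * normH 2 u)) ∧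
      ∀ j, eLpNorm (partialDeriv j u) 4 volume ≤
        ENNReal.ofReal (√(3 * (K * √(normH 1 u * normH 2 u)) *
          ‖partialDeriv j (partialDeriv j u)‖)))
    (ω : ℝ) {ε t : ℝ} (hε : 0 < ε) (ht : 0 ≤ t) (θ : ℝ) {u : L2 d} (hu : MemH 2 u)
    (hU : MemLp (potMul ω u) 2 volume) :
    MemH 2 (halfStep ω θ ε t u) ∧
      normH 2 (halfStep ω θ ε t u) ≤ normH 2 u +
        (∑ k ∈ Finset.range (2 + 1), (d : ℝ) ^ k) *
          (3 + 22 * K ^ 2 + 12 * K ^ 4 + 17 * ω ^ 2 + 4 * K ^ 2 * (5 * ω ^ 2 + 1) +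
            11 * (ω ^ 2) ^ 2) *
          (t / ε * (normL2 (potMul ω u) + normH 2 u + |θ| * normH 2 u ^ 3)
            + t ^ 2 * normH 2 u
            + t ^ 2 / ε ^ 2 * (normL2 (potMul ω u) + |θ| * normL2 (potMul ω u) * normH 2 u ^ 2
                + |θ| * normH 2 u ^ 3 + |θ| ^ 2 * normH 2 u ^ 5)
            + t ^ 3 / ε * (normL2 (potMul ω u) + normH 2 u + |θ| * normH 2 u ^ 3)
            + t ^ 4 * normH 2 u) := by
  have hτ : 0 ≤ t / ε := by positivity
  have hq : 0 ≤ t / 2 * ε := by positivity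
  have h12 := normH_mono one_le_two u
  have h1 := normH_flowA 1 ε (t / 2) u
  have h2 := normH_flowA 2 ε (t / 2) u
  have hv : MemH 2 (flowA ε (t / 2) u) := hu.flowA ε (t / 2)
  obtain ⟨hY, hYD, hYY⟩ := exists_moments_of_potMul hq hu hU
  choose Y hY hYn using hY
  choose YD hYD hYDn using hYD
  choose YY hYY hYYn using hYY
  obtain ⟨hA1, hA2⟩ := hA _ hv
  rw [halfStep]
  generalize flowA ε (t / 2) u = v at *
  rw [h1, h2] at hA1 hA2
  have hH : 0 ≤ normH 2 u := normH_nonneg 2 u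
  have hN : 0 ≤ normL2 (potMul ω u) := ENNReal.toReal_nonneg
  generalize normH 1 u = H1 at *
  generalize normH 2 u = H at *
  generalize normL2 (potMul ω u) = N at *
  have hM0 : 0 ≤ K * H := by positivity
  have hsqrt : K * √(H1 * H) ≤ K * H := by
    refine mul_le_mul_of_nonneg_left (Real.sqrt_le_iff.2 ⟨hH, ?_⟩) hK.le
    rw [sq]
    exact mul_le_mul_of_nonneg_right h12 hH
  have hM := ae_norm_le_of_eLpNorm_top_le hM0 (hA1.trans (ENNReal.ofReal_le_ofReal hsqrt))
  have hv0 : ‖v‖ ≤ H := h2 ▸ norm_le_normH 2 v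
  have hv1 : ∀ j, ‖partialDeriv j v‖ ≤ H := fun j =>
    h2 ▸ norm_partialDeriv_le_normH one_le_two j v
  have hv2 : ∀ j k, ‖partialDeriv j (partialDeriv k v)‖ ≤ H := fun j k =>
    h2 ▸ norm_partialDeriv_partialDeriv_le_normH le_rfl j k (hv.mono one_le_two)
  have h4 : ∀ j, eLpNorm (partialDeriv j v) 4 volume ≤
      ENNReal.ofReal (√(3 * (K * H) * H)) := fun j =>
    (hA2 j).trans (ENNReal.ofReal_le_ofReal (Real.sqrt_le_sqrt
      (mul_le_mul (mul_le_mul_of_nonneg_left hsqrt (by norm_num)) (hv2 j j) (norm_nonneg _)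
        (by positivity))))
  have hprod : ∀ j k, L2Bound (fun x => ‖partialDeriv j v x‖ * ‖partialDeriv k v x‖)
      (3 * (K * H) * H) := fun j k => by
    have h5 := L2Bound.norm_mul_norm (Real.sqrt_nonneg _) (Real.sqrt_nonneg _) (h4 j) (h4 k)
    rwa [Real.mul_self_sqrt (by positivity)] at h5
  obtain ⟨hmem1, key1⟩ := norm_partialDeriv_flowB_le (θ := θ) hd hτ hv hM0 hM hv1 hY hYn
  obtain ⟨hmem2, key2⟩ := norm_partialDeriv_partialDeriv_flowB_le (θ := θ) hd hτ hv hM0 hM hv0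
    hv2 hprod hY hYD hYY hYDn hYYn
  refine ⟨hmem2, ?_⟩
  rw [← h2]
  have haux := strang_bound_aux (K := K) (sq_nonneg ω) hτ hq hN hH (abs_nonneg θ) rfl
  have hB1 : 0 ≤ 2 * (t / ε * |θ|) * ((K * H) ^ 2 * H) +
    t / ε * (ω ^ 2 * N + H + ω ^ 2 * (t / 2 * ε) * H) := by positivity
  -- The common error is the sum of the first-order and second-order errors.
  refine normH_le_add_of_forall ?_ (fun k hk j => ?_) (haux.trans (le_of_eq ?_))
  · positivity
  · interval_cases k
    · rw [weakDeriv_zero, weakDeriv_zero, norm_flowB]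
      exact le_add_of_nonneg_right (by positivity)
    · rw [weakDeriv_one, weakDeriv_one]
      exact (key1 (j 0)).trans (add_le_add le_rfl (le_add_of_nonneg_right (by positivity)))
    · rw [weakDeriv_two j hmem1, weakDeriv_two j (hv.mono one_le_two)]
      exact (key2 (j 1) (j 0)).trans (add_le_add le_rfl (le_add_of_nonneg_left hB1))
  · rw [h2]
    field_simp
    ring

end CubicNLS

end

/-! ### Conclusion -/

theorem mainTheorem7 (d : ℕ) (hd : d ∈ ({1, 2, 3} : Set ℕ)) (ω : ℝ) :
    (∀ ε ∈ Ioo (0 : ℝ) 1, ∀ θ t : ℝ, 0 ≤ t → ∀ u : L2 d,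
      (‖flowA ε t u‖ = ‖u‖ ∧ ‖flowB ω θ ε t u‖ = ‖u‖) ∧
      (‖strangStep ω θ ε t u‖ = ‖halfStep ω θ ε t u‖ ∧ ‖halfStep ω θ ε t u‖ = ‖u‖) ∧
      (∀ m : ℕ, MemH m u → MemH m (flowA ε t u) ∧ normH m (flowA ε t u) = normH m u) ∧
      (∀ m : ℕ, (MemH m (strangStep ω θ ε t u) ↔ MemH m (halfStep ω θ ε t u)) ∧
        (MemH m (halfStep ω θ ε t u) →
          normH m (strangStep ω θ ε t u) = normH m (halfStep ω θ ε t u)))) ∧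
    ∃ C : ℝ, 0 < C ∧ ∀ ε ∈ Ioo (0 : ℝ) 1, ∀ θ t : ℝ, 0 ≤ t → ∀ u : L2 d, MemH 2 u →
      (MemLp (gradPotMul ω u) 2 volume →
        MemH 1 (halfStep ω θ ε t u) ∧ MemH 1 (strangStep ω θ ε t u) ∧
        normH 1 (strangStep ω θ ε t u) = normH 1 (halfStep ω θ ε t u) ∧
        normH 1 (halfStep ω θ ε t u) ≤
          normH 1 u + C * (t / ε * (normL2 (gradPotMul ω u) + |θ| * normH 2 u * normH 1 u ^ 2)
            + t ^ 2 * normH 1 u)) ∧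
      (MemLp (potMul ω u) 2 volume →
        MemH 2 (halfStep ω θ ε t u) ∧ MemH 2 (strangStep ω θ ε t u) ∧
        normH 2 (strangStep ω θ ε t u) = normH 2 (halfStep ω θ ε t u) ∧
        normH 2 (halfStep ω θ ε t u) ≤
          normH 2 u + C * (
            t / ε * (normL2 (potMul ω u) + normH 2 u + |θ| * normH 2 u ^ 3)
            + t ^ 2 * normH 2 u
            + t ^ 2 / ε ^ 2 * (normL2 (potMul ω u) + |θ| * normL2 (potMul ω u) * normH 2 u ^ 2
                + |θ| * normH 2 u ^ 3 + |θ| ^ 2 * normH 2 u ^ 5)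
            + t ^ 3 / ε * (normL2 (potMul ω u) + normH 2 u + |θ| * normH 2 u ^ 3)
            + t ^ 4 * normH 2 u)) := by
  have hpos : ∀ m : ℕ, 0 < ∑ k ∈ Finset.range (m + 1), (d : ℝ) ^ k := fun m => by
    rw [Finset.sum_range_succ']
    positivity
  have hS : ∀ (m : ℕ) (θ ε t : ℝ) (u : L2 d),
      normH m (strangStep ω θ ε t u) = normH m (halfStep ω θ ε t u) := fun m θ ε t u =>
    normH_flowA m ε (t / 2) (halfStep ω θ ε t u)
  have hmem : ∀ (m : ℕ) (θ ε t : ℝ) (u : L2 d),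
      MemH m (strangStep ω θ ε t u) ↔ MemH m (halfStep ω θ ε t u) := fun m θ ε t u =>
    memH_flowA_iff ε (t / 2)
  refine ⟨fun ε _ θ t _ u => ⟨⟨norm_flowA ε t u, norm_flowB ω θ ε t u⟩, ⟨norm_flowA _ _ _, ?_⟩,
    fun m hu => ⟨hu.flowA ε t, normH_flowA m ε t u⟩,
    fun m => ⟨hmem m θ ε t u, fun _ => hS m θ ε t u⟩⟩, ?_⟩
  · rw [halfStep, norm_flowB, norm_flowA]
  obtain ⟨K, hK, hA⟩ := exists_agmon hd
  set C1 := (∑ k ∈ Finset.range (1 + 1), (d : ℝ) ^ k) * (2 * K ^ 2 + 1 + ω ^ 2) with hC1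
  set C2 := (∑ k ∈ Finset.range (2 + 1), (d : ℝ) ^ k) *
    (3 + 22 * K ^ 2 + 12 * K ^ 4 + 17 * ω ^ 2 + 4 * K ^ 2 * (5 * ω ^ 2 + 1) +
      11 * (ω ^ 2) ^ 2) with hC2
  have hC1pos : 0 < C1 := mul_pos (hpos 1) (by positivity)
  -- The Agmon constant depends on $d$ alone, so $C_1$ and $C_2$ depend only on $d$ and $\omega$.
  -- Both brackets are nonnegative, so the larger constant serves for both.
  refine ⟨max C1 C2, lt_max_of_lt_left hC1pos, fun ε hε θ t ht u hu =>
    ⟨fun hU => ?_, fun hU => ?_⟩⟩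
  · have hN : 0 ≤ normL2 (gradPotMul ω u) := ENNReal.toReal_nonneg
    have hε0 : 0 < ε := hε.1
    have h1 := normH_nonneg 1 u
    have h2 := normH_nonneg 2 u
    obtain ⟨hm, hle⟩ := normH_one_halfStep_le hd hK (fun u hu => (hA u hu).1) ω hε.1 ht θ hu hU
    refine ⟨hm, (hmem 1 θ ε t u).2 hm, hS 1 θ ε t u, hle.trans (add_le_add le_rfl ?_)⟩
    exact mul_le_mul_of_nonneg_right (le_max_left _ _) (by positivity)
  · have hN : 0 ≤ normL2 (potMul ω u) := ENNReal.toReal_nonneg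
    have hε0 : 0 < ε := hε.1
    have h2 := normH_nonneg 2 u
    obtain ⟨hm, hle⟩ := normH_two_halfStep_le hd hK hA ω hε.1 ht θ hu hU
    refine ⟨hm, (hmem 2 θ ε t u).2 hm, hS 2 θ ε t u, hle.trans (add_le_add le_rfl ?_)⟩
    exact mul_le_mul_of_nonneg_right (le_max_right _ _) (by positivity)
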